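/- Let $N\in\mathbb N$ and $s\in(0,1)$ with $N>2s$, and put $2^*_s=\frac{2N}{N-2s}$. Let $V:\mathbb R^N\to\mathbb R$ be continuous and $1$-periodic in each coordinate, with $\alpha\le V(x)\le\beta$ for all $x\in\mathbb R^N$ and some constants $0<\alpha\le\beta$. Let $f:\mathbb R^N\times\mathbb R\to\mathbb R$ be continuous, put $F(x,t)=\int_0^t f(x,\tau)\,d\tau$ and $G(x,t)=f(x,t)t-2F(x,t)$, and assume: (f1) $f$ is $1$-periodic in each coordinate of $x$, and $\lim_{|t|\to\infty}\frac{f(x,t)}{|t|^{2^*_s-1}}=0$ uniformly in $x\in\mathbb R^N$; (f2) $\lim_{t\to0}\frac{f(x,t)}{t}=0$ uniformly in $x\in\mathbb R^N$; (f3) $\lim_{|t|\to\infty}\frac{F(x,t)}{|t|^2}=+\infty$ for every $x\in\mathbb R^N$; (f4) there is $\lambda\ge1$ such that $G(x,\theta t)\le\lambda\,G(x,t)$ for all $(x,t)\in\mathbb R^N\times\mathbb R$ and all $\theta\in[0,1]$. Let $$[u]^2=\iint_{\mathbb R^{2N}}\frac{|u(x)-u(y)|^2}{|x-y|^{N+2s}}\,dx\,dy,\qquad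 H^s(\mathbb R^N)=\{u\in L^2(\mathbb R^N):[u]<\infty\},\qquad \|u\|_{H^s}^2=[u]^2+\int_{\mathbb R^N}u^2\,dx .$$ Then $F(\cdot,v)$ is integrable for every $v\in H^s(\mathbb R^N)$, so that the functional $$\mathcal J(v)=\frac12\Bigl([v]^2+\int_{\mathbb R^N}V(x)v^2\,dx\Bigr)-\int_{\mathbb R^N}F(x,v)\,dx$$ is defined on $H^s(\mathbb R^N)$, and the equation $(-\Delta)^s u+V(x)u=f(x,u)$ in $\mathbb R^N$ has a nontrivial ground state $u\in H^s(\mathbb R^N)$. That is: $u\ne0$; $\mathcal J$ is Fréchet differentiable at $u$ with $\mathcal J'(u)=0$; $\mathcal J(u)\le\mathcal J(v)$ for every $v\in H^s(\mathbb R^N)\setminus\{0\}$ at which $\mathcal J$ is Fréchet differentiable with $\mathcal J'(v)=0$; and $u$ is a weak solution of the equation, i.e. for every $\varphi\in H^s(\mathbb R^N)$ the function $f(\cdot,u)\varphi$ is integrable and $$\iint_{\mathbb R^{2N}}\frac{(u(x)-u(y))(\varphi(x)-\varphi(y))}{|x-y|^{N+2s}}\,dx\,dy+\int_{\mathbb R^N}V(x)u\varphi\,dx=\int_{\mathbb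 R^N}f(x,u)\varphi\,dx .$$ (Here $(-\Delta)^s$ is normalized so that its bilinear form is the double integral above; any other positive normalization constant can be absorbed by dividing $V$ and $f$ by it, which preserves all the assumptions.) -/

import Mathlib

open MeasureTheory Filter Topology

/-- The Euclidean space `ℝ^N`. -/
abbrev RN (N : ℕ) : Type := EuclideanSpace ℝ (Fin N)

/-- The function `(x, y) ↦ (u x - u y) (v x - v y) / |x - y| ^ (N + 2 s)` on `ℝ^N × ℝ^N`. -/
noncomputable def gagliardoKernel {N : ℕ} (s : ℝ) (u v : RN N → ℝ) (p : RN N × RN N) : ℝ :=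
  (u p.1 - u p.2) * (v p.1 - v p.2) / ‖p.1 - p.2‖ ^ ((N : ℝ) + 2 * s)

/-- `∬ (u x - u y) (v x - v y) / |x - y| ^ (N + 2 s) dx dy`; on the diagonal `u = v` this is the
squared Gagliardo seminorm `[u]²`. -/
noncomputable def gagliardoForm {N : ℕ} (s : ℝ) (u v : RN N → ℝ) : ℝ :=
  ∫ p : RN N × RN N, gagliardoKernel s u v p

theorem gagliardoKernel_congr {N : ℕ} (s : ℝ) {u u' v v' : RN N → ℝ}
    (hu : u =ᵐ[volume] u') (hv : v =ᵐ[volume] v') :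
    gagliardoKernel s u v =ᵐ[volume] gagliardoKernel s u' v' := by
  have h1 := (Measure.quasiMeasurePreserving_fst (μ := (volume : Measure (RN N)))
    (ν := (volume : Measure (RN N)))).ae_eq_comp hu
  have h2 := (Measure.quasiMeasurePreserving_snd (μ := (volume : Measure (RN N)))
    (ν := (volume : Measure (RN N)))).ae_eq_comp hu
  have h3 := (Measure.quasiMeasurePreserving_fst (μ := (volume : Measure (RN N)))
    (ν := (volume : Measure (RN N)))).ae_eq_comp hv
  have h4 := (Measure.quasiMeasurePreserving_snd (μ := (volume : Measure (RN N)))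
    (ν := (volume : Measure (RN N)))).ae_eq_comp hv
  rw [← Measure.volume_eq_prod] at h1 h2 h3 h4
  filter_upwards [h1, h2, h3, h4] with p p1 p2 p3 p4
  simp only [Function.comp_apply] at p1 p2 p3 p4
  simp only [gagliardoKernel, p1, p2, p3, p4]

theorem gagliardoKernel_aestronglyMeasurable {N : ℕ} (s : ℝ) {u v : RN N → ℝ}
    (hu : AEStronglyMeasurable u volume) (hv : AEStronglyMeasurable v volume) :
    AEStronglyMeasurable (gagliardoKernel s u v) volume := by
  have hu1 : AEStronglyMeasurable (fun p : RN N × RN N => u p.1) volume := hu.comp_fst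
  have hu2 : AEStronglyMeasurable (fun p : RN N × RN N => u p.2) volume := hu.comp_snd
  have hv1 : AEStronglyMeasurable (fun p : RN N × RN N => v p.1) volume := hv.comp_fst
  have hv2 : AEStronglyMeasurable (fun p : RN N × RN N => v p.2) volume := hv.comp_snd
  have hk : Measurable (fun p : RN N × RN N => ‖p.1 - p.2‖ ^ ((N : ℝ) + 2 * s)) := by
    fun_prop
  exact (((hu1.sub hu2).mul (hv1.sub hv2)).aemeasurable.div
    hk.aemeasurable).aestronglyMeasurable

theorem gagliardoKernel_integrable {N : ℕ} (s : ℝ) {u v : RN N → ℝ}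
    (hu : AEStronglyMeasurable u volume) (hv : AEStronglyMeasurable v volume)
    (hu' : Integrable (gagliardoKernel s u u)) (hv' : Integrable (gagliardoKernel s v v)) :
    Integrable (gagliardoKernel s u v) := by
  refine (hu'.add hv').mono' (gagliardoKernel_aestronglyMeasurable s hu hv)
    (Eventually.of_forall fun p => ?_)
  have hd : 0 ≤ ‖p.1 - p.2‖ ^ ((N : ℝ) + 2 * s) := by positivity
  simp only [gagliardoKernel, Pi.add_apply, Real.norm_eq_abs]
  rw [abs_div, abs_of_nonneg hd, ← add_div]
  refine div_le_div_of_nonneg_right (abs_le.2 ⟨?_, ?_⟩) hd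
  · nlinarith [sq_nonneg ((u p.1 - u p.2) + (v p.1 - v p.2)), sq_nonneg (u p.1 - u p.2),
      sq_nonneg (v p.1 - v p.2)]
  · nlinarith [sq_nonneg ((u p.1 - u p.2) - (v p.1 - v p.2)), sq_nonneg (u p.1 - u p.2),
      sq_nonneg (v p.1 - v p.2)]

theorem gagliardoKernel_add_left {N : ℕ} (s : ℝ) (u v w : RN N → ℝ) :
    gagliardoKernel s (u + v) w = gagliardoKernel s u w + gagliardoKernel s v w := by
  funext p
  simp only [gagliardoKernel, Pi.add_apply]
  ring

theorem gagliardoKernel_smul_left {N : ℕ} (s c : ℝ) (u w : RN N → ℝ) :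
    gagliardoKernel s (c • u) w = c • gagliardoKernel s u w := by
  funext p
  simp only [gagliardoKernel, Pi.smul_apply, smul_eq_mul]
  ring

theorem gagliardoKernel_comm {N : ℕ} (s : ℝ) (u v : RN N → ℝ) :
    gagliardoKernel s u v = gagliardoKernel s v u := by
  funext p
  simp only [gagliardoKernel]
  ring

/-- The elements of `L²(ℝ^N)` with finite Gagliardo seminorm, as a linear subspace of `L²`. -/
noncomputable def fracSobolevSubmodule (N : ℕ) (s : ℝ) :
    Submodule ℝ (Lp ℝ 2 (volume : Measure (RN N))) where
  carrier := {u | Integrable (gagliardoKernel s u u)}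
  zero_mem' := by
    have h : gagliardoKernel s (0 : RN N → ℝ) 0 = 0 := by
      funext p
      simp [gagliardoKernel]
    have h0 := Lp.coeFn_zero ℝ 2 (volume : Measure (RN N))
    refine Integrable.congr ?_ (gagliardoKernel_congr s h0 h0).symm
    rw [h]
    exact integrable_zero _ _ _
  add_mem' := by
    intro u v hu hv
    have hau := Lp.aestronglyMeasurable u
    have hav := Lp.aestronglyMeasurable v
    have huv := gagliardoKernel_integrable s hau hav hu hv
    have hvu := gagliardoKernel_integrable s hav hau hv hu
    refine Integrable.congr ?_
      (gagliardoKernel_congr s (Lp.coeFn_add u v) (Lp.coeFn_add u v)).symm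
    rw [gagliardoKernel_add_left, gagliardoKernel_comm s u, gagliardoKernel_comm s v,
      gagliardoKernel_add_left, gagliardoKernel_add_left]
    exact (Integrable.add hu hvu).add (Integrable.add huv hv)
  smul_mem' := by
    intro c u hu
    refine Integrable.congr ?_
      (gagliardoKernel_congr s (Lp.coeFn_smul c u) (Lp.coeFn_smul c u)).symm
    rw [gagliardoKernel_smul_left, gagliardoKernel_comm, gagliardoKernel_smul_left]
    exact Integrable.smul c (Integrable.smul c hu)

/-- The fractional Sobolev space `H^s(ℝ^N) = {u ∈ L² : [u] < ∞}`. It is a separate type, so that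
it carries the `H^s` norm defined below and not the norm of `L²`. -/
def FracSobolev (N : ℕ) (s : ℝ) : Type := fracSobolevSubmodule N s

namespace FracSobolev

variable {N : ℕ} {s : ℝ}

noncomputable instance : AddCommGroup (FracSobolev N s) :=
  inferInstanceAs (AddCommGroup (fracSobolevSubmodule N s))

noncomputable instance : Module ℝ (FracSobolev N s) :=
  inferInstanceAs (Module ℝ (fracSobolevSubmodule N s))

/-- The inclusion of `H^s` in `L²`. -/
noncomputable def toL2 : FracSobolev N s →ₗ[ℝ] Lp ℝ 2 (volume : Measure (RN N)) :=
  (fracSobolevSubmodule N s).subtype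

/-- An element of `H^s` as a function on `ℝ^N`, through the representative chosen by `Lp`. -/
noncomputable instance : CoeFun (FracSobolev N s) (fun _ => RN N → ℝ) where
  coe u := (toL2 u : RN N → ℝ)

theorem toL2_injective : Function.Injective (toL2 : FracSobolev N s →ₗ[ℝ] _) :=
  Subtype.val_injective

theorem integrable_kernel (u v : FracSobolev N s) : Integrable (gagliardoKernel s u v) :=
  gagliardoKernel_integrable s (Lp.aestronglyMeasurable _) (Lp.aestronglyMeasurable _)
    u.property v.property

theorem gagliardoForm_add_left (u v w : FracSobolev N s) :
    gagliardoForm s ⇑(toL2 (u + v)) ⇑(toL2 w)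
      = gagliardoForm s ⇑(toL2 u) ⇑(toL2 w) + gagliardoForm s ⇑(toL2 v) ⇑(toL2 w) := by
  have h : ⇑(toL2 (u + v)) =ᵐ[volume] ⇑(toL2 u) + ⇑(toL2 v) := by
    rw [map_add]
    exact Lp.coeFn_add _ _
  unfold gagliardoForm
  rw [integral_congr_ae (gagliardoKernel_congr s h (EventuallyEq.refl _ ⇑(toL2 w))),
    gagliardoKernel_add_left]
  exact integral_add (integrable_kernel u w) (integrable_kernel v w)

theorem gagliardoForm_smul_left (c : ℝ) (u w : FracSobolev N s) :
    gagliardoForm s ⇑(toL2 (c • u)) ⇑(toL2 w) = c * gagliardoForm s ⇑(toL2 u) ⇑(toL2 w) := by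
  have h : ⇑(toL2 (c • u)) =ᵐ[volume] c • ⇑(toL2 u) := by
    rw [map_smul]
    exact Lp.coeFn_smul _ _
  unfold gagliardoForm
  rw [integral_congr_ae (gagliardoKernel_congr s h (EventuallyEq.refl _ ⇑(toL2 w))),
    gagliardoKernel_smul_left]
  exact integral_const_mul c _

theorem gagliardoForm_comm (u v : RN N → ℝ) : gagliardoForm s u v = gagliardoForm s v u := by
  unfold gagliardoForm
  rw [gagliardoKernel_comm]

theorem gagliardoForm_self_nonneg (u : RN N → ℝ) : 0 ≤ gagliardoForm s u u := by
  refine integral_nonneg fun p => ?_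
  exact div_nonneg (mul_self_nonneg _) (by positivity)

theorem integral_mul_eq_inner (u v : FracSobolev N s) :
    ∫ x, u x * v x = inner ℝ (toL2 u) (toL2 v) := by
  rw [L2.inner_def]
  refine integral_congr_ae (Eventually.of_forall fun x => ?_)
  simp [mul_comm]

/-- The inner product of `H^s`:
`∬ (u x - u y) (v x - v y) / |x - y| ^ (N + 2 s) dx dy + ∫ u v dx`. -/
@[reducible]
noncomputable def core : InnerProductSpace.Core ℝ (FracSobolev N s) where
  inner u v := gagliardoForm s u v + ∫ x, u x * v x
  conj_inner_symm u v := by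
    simp only [conj_trivial, gagliardoForm_comm ⇑(toL2 v) ⇑(toL2 u), mul_comm]
  re_inner_nonneg u := by
    simp only [integral_mul_eq_inner, RCLike.re_to_real]
    exact add_nonneg (gagliardoForm_self_nonneg _) real_inner_self_nonneg
  add_left u v w := by
    simp only [integral_mul_eq_inner, gagliardoForm_add_left]
    rw [map_add, inner_add_left]
    ring
  smul_left u v c := by
    simp only [integral_mul_eq_inner, gagliardoForm_smul_left]
    rw [map_smul, inner_smul_left, conj_trivial]
    ring
  definite u h := by
    simp only [integral_mul_eq_inner] at h
    have h1 := gagliardoForm_self_nonneg (s := s) ⇑(toL2 u)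
    have h2 : (0 : ℝ) ≤ inner ℝ (toL2 u) (toL2 u) := real_inner_self_nonneg
    have h3 : inner ℝ (toL2 u) (toL2 u) = (0 : ℝ) := by linarith
    apply toL2_injective
    rw [inner_self_eq_zero.1 h3, map_zero]

/-- The norm of `H^s` is `‖u‖ = ([u]² + ∫ u²) ^ (1/2)`. -/
noncomputable instance : NormedAddCommGroup (FracSobolev N s) :=
  (core (N := N) (s := s)).toNormedAddCommGroup

noncomputable instance : InnerProductSpace ℝ (FracSobolev N s) :=
  InnerProductSpace.ofCore core.toCore

theorem norm_eq (u : FracSobolev N s) :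
    ‖u‖ = √(gagliardoForm s u u + ∫ x, u x ^ 2) := by
  have h : ‖u‖ = √(gagliardoForm s u u + ∫ x, u x * u x) := rfl
  rw [h]
  simp only [pow_two]

end FracSobolev

/-- `g` is `1`-periodic in each of the coordinates of `ℝ^N`. -/
def IsOnePeriodic {N : ℕ} {β : Type*} (g : RN N → β) : Prop :=
  ∀ (i : Fin N) (x : RN N), g (x + EuclideanSpace.single i 1) = g x

/-- The primitive `F(x, t) = ∫₀ᵗ f(x, τ) dτ`. -/
noncomputable def primitiveF {N : ℕ} (f : RN N → ℝ → ℝ) (x : RN N) (t : ℝ) : ℝ :=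
  ∫ τ in (0 : ℝ)..t, f x τ

/-- `G(x, t) = f(x, t) t - 2 F(x, t)`. -/
noncomputable def jeanjeanG {N : ℕ} (f : RN N → ℝ → ℝ) (x : RN N) (t : ℝ) : ℝ :=
  f x t * t - 2 * primitiveF f x t

/-- The critical exponent `2N / (N - 2s)`. -/
noncomputable def criticalExponent (N : ℕ) (s : ℝ) : ℝ := 2 * (N : ℝ) / ((N : ℝ) - 2 * s)

/-- The energy `J(u) = ([u]² + ∫ V u²) / 2 - ∫ F(x, u)` on `H^s(ℝ^N)`. -/
noncomputable def energyJ {N : ℕ} {s : ℝ} (V : RN N → ℝ) (f : RN N → ℝ → ℝ)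
    (u : FracSobolev N s) : ℝ :=
  (1 / 2) * (gagliardoForm s u u + ∫ x, V x * u x ^ 2) - ∫ x, primitiveF f x (u x)

/-- `u` is a critical point of `J`: the Fréchet derivative of `J` on `H^s(ℝ^N)` exists at `u`
and vanishes. -/
def IsCriticalPointJ {N : ℕ} {s : ℝ} (V : RN N → ℝ) (f : RN N → ℝ → ℝ)
    (u : FracSobolev N s) : Prop :=
  HasFDerivAt (energyJ V f) (0 : FracSobolev N s →L[ℝ] ℝ) u

/-- `u ∈ H^s(ℝ^N)` is a weak solution of `(-Δ)^s u + V(x) u = f(x, u)`. -/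
def IsWeakSolution {N : ℕ} {s : ℝ} (V : RN N → ℝ) (f : RN N → ℝ → ℝ)
    (u : FracSobolev N s) : Prop :=
  ∀ v : FracSobolev N s,
    Integrable (fun x => f x (u x) * v x) ∧
      gagliardoForm s u v + ∫ x, V x * u x * v x = ∫ x, f x (u x) * v x

/-- A nontrivial ground state: a nonzero critical point of `J` that minimizes `J` among all
nonzero critical points. -/
def IsGroundState {N : ℕ} {s : ℝ} (V : RN N → ℝ) (f : RN N → ℝ → ℝ)
    (u : FracSobolev N s) : Prop :=
  u ≠ 0 ∧ IsCriticalPointJ V f u ∧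
    ∀ v : FracSobolev N s, v ≠ 0 → IsCriticalPointJ V f v → energyJ V f u ≤ energyJ V f v

/-! The solution is a critical point of `energyJ` produced by a mountain pass and then improved to
one of least energy. Three difficulties have to be met: `f` is only continuous and has no
Ambrosetti-Rabinowitz condition, its growth reaches up to the critical exponent `q`, and
translations destroy compactness.

Growth: since `f` is `o(t)` at zero and `o(|t| ^ (q - 1))` at infinity, it is Lipschitz in `t` up to
an arbitrarily small error of linear plus critical size (`exists_approx_lipschitz`). With the
Sobolev inequality this makes `energyJ` differentiable with a gradient uniformly continuous on
bounded sets, and lets the nonlinear term pass to weak limits. Likewise `f(x, t) t` and `F` are at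
most `ε (t² + |t| ^ q)` plus a constant on `{|t| ≥ δ}`, so a bounded sequence that is small in
measure has a negligible nonlinear term.

Boundedness: (f4) with `θ = 0` gives `G ≥ 0`, so `F(x, r t) / r²` increases with `r` and
superquadraticity becomes uniform in `x`. Scale a function `u` of large norm, with bounded energy
and bounded `J'(u) u`, to a fixed norm `R`. If the scaled function is small in measure, its energy
is large; the maximum of the energy on the segment from `0` to `u` is then interior, and (f4) at
that point bounds it by the data of `u`, a contradiction (`energyJ_smul_le`). Otherwise `F` is huge
on a large set and the energy of `u` is very negative (`exists_norm_bound`).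

Compactness: an almost critical sequence bounded away from zero cannot be small in measure, hence
has mass in some unit ball (`exists_ball_mass`). Lattice translations, which preserve the energy,
bring that mass near the origin, so the weak limit is nonzero; it is critical, and Fatou's lemma
applied to `∫ G = 2 J(u) - J'(u) u` bounds its energy by the limit of the energies
(`exists_critical_of_seq`). This is used twice, for a Cerami sequence at the mountain pass level and
for a minimizing sequence of critical points.

All properties of `H^s` rest on one pointwise inequality comparing `u x` with its averages over
balls (`sq_volume_mul_le`): it yields the Sobolev inequality, local compactness and the location of
mass. -/

/-! ### Mountain pass theorem by a discrete descent flow. -/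

section MountainPass

variable {H : Type*} [NormedAddCommGroup H]

/-- Uniform continuity on bounded sets. -/
def UniformContinuousOnBounded (g : H → H) : Prop :=
  ∀ R ε : ℝ, 0 < ε → ∃ δ > 0, ∀ u v, ‖u‖ ≤ R → ‖v‖ ≤ R → ‖u - v‖ ≤ δ → ‖g u - g v‖ ≤ ε

theorem UniformContinuousOnBounded.continuous {g : H → H} (hg : UniformContinuousOnBounded g) :
    Continuous g := by
  rw [Metric.continuous_iff]
  intro u ε hε
  obtain ⟨δ, hδ, h⟩ := hg (‖u‖ + 1) (ε / 2) (by positivity)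
  refine ⟨min δ 1, by positivity, fun v hv => ?_⟩
  rw [dist_eq_norm] at hv ⊢
  have h1 : ‖v‖ ≤ ‖u‖ + 1 := by
    have := norm_sub_norm_le v u
    have := min_le_right δ 1
    linarith
  have := h v u h1 (by linarith) (hv.le.trans (min_le_left _ _))
  linarith

variable [InnerProductSpace ℝ H]

/-- The normalized gradient direction used to deform paths. -/
noncomputable def ceramiField (g : H → H) (u : H) : H :=
  ((1 + ‖u‖) ^ 2 / (1 + (1 + ‖u‖) * ‖g u‖)) • g u

theorem ceramiField_continuous {g : H → H} (hg : Continuous g) : Continuous (ceramiField g) := by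
  unfold ceramiField
  refine Continuous.smul (Continuous.div (by fun_prop) (by fun_prop) fun u => ?_) hg
  positivity

/-- Linear growth is the purpose of the weight: flowing for total time one multiplies `1 + ‖u‖` by
at most `e`, so the whole deformation stays in one ball. -/
theorem norm_ceramiField_le (g : H → H) (u : H) : ‖ceramiField g u‖ ≤ 1 + ‖u‖ := by
  have h : (0 : ℝ) < 1 + (1 + ‖u‖) * ‖g u‖ := by positivity
  rw [ceramiField, norm_smul, Real.norm_of_nonneg (by positivity), div_mul_eq_mul_div,
    div_le_iff₀ h]
  nlinarith [norm_nonneg u, norm_nonneg (g u)]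

/-- The rate of descent is a function of the Cerami quantity `(1 + ‖u‖) * ‖g u‖` alone. -/
theorem inner_ceramiField (g : H → H) (u : H) :
    inner ℝ (g u) (ceramiField g u)
      = ((1 + ‖u‖) * ‖g u‖) ^ 2 / (1 + (1 + ‖u‖) * ‖g u‖) := by
  rw [ceramiField, inner_smul_right, real_inner_self_eq_norm_sq]
  ring

/-- One step of the discrete descent flow, switched off where `J ≤ 0`. -/
noncomputable def ceramiStep (J : H → ℝ) (g : H → H) (ρ τ : ℝ) (u : H) : H :=
  u - (τ * min 1 (max 0 (2 * J u / ρ))) • ceramiField g u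

theorem ceramiStep_continuous {J : H → ℝ} {g : H → H} (hJ : Continuous J) (hg : Continuous g)
    (ρ τ : ℝ) : Continuous (ceramiStep J g ρ τ) := by
  have := ceramiField_continuous hg
  unfold ceramiStep
  fun_prop

theorem ceramiStep_eq_self {J : H → ℝ} {g : H → H} {ρ τ : ℝ} {u : H} (hρ : 0 < ρ) (hu : J u ≤ 0) :
    ceramiStep J g ρ τ u = u := by
  have : 2 * J u / ρ ≤ 0 := div_nonpos_of_nonpos_of_nonneg (by linarith) hρ.le
  simp [ceramiStep, max_eq_left this]

theorem norm_ceramiStep_sub_le (J : H → ℝ) (g : H → H) (ρ : ℝ) {τ : ℝ} (hτ : 0 ≤ τ) (u : H) :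
    ‖ceramiStep J g ρ τ u - u‖ ≤ τ * (1 + ‖u‖) := by
  have h0 : 0 ≤ min 1 (max 0 (2 * J u / ρ)) := by positivity
  have h1 : min 1 (max 0 (2 * J u / ρ)) ≤ 1 := min_le_left _ _
  have : ceramiStep J g ρ τ u - u = -((τ * min 1 (max 0 (2 * J u / ρ))) • ceramiField g u) := by
    simp [ceramiStep]
  rw [this, norm_neg, norm_smul, Real.norm_of_nonneg (by positivity)]
  exact mul_le_mul (mul_le_of_le_one_right hτ h1) (norm_ceramiField_le g u) (norm_nonneg _) hτ

/-- Mean value inequality on the intersection of a ball about `0` with a ball about `u`, where the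
gradient stays within `ω` of `g u`. The radius `2 * R + 1` is `R` plus the longest possible step `1
+ R`. -/
theorem energy_ceramiStep_le {J : H → ℝ} {g : H → H}
    (hJ : ∀ u, HasFDerivAt J (innerSL ℝ (g u)) u) {R δ ω τ ρ : ℝ} (hτ : 0 ≤ τ) (hω : 0 ≤ ω)
    (hτ1 : τ ≤ 1) (hδ : ∀ u v, ‖u‖ ≤ 2 * R + 1 → ‖v‖ ≤ 2 * R + 1 → ‖u - v‖ ≤ δ → ‖g u - g v‖ ≤ ω)
    (hτδ : τ * (1 + R) ≤ δ) {u : H} (hu : ‖u‖ ≤ R) :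
    J (ceramiStep J g ρ τ u) ≤ J u - τ * (min 1 (max 0 (2 * J u / ρ)) *
      (((1 + ‖u‖) * ‖g u‖) ^ 2 / (1 + (1 + ‖u‖) * ‖g u‖))) + τ * (ω * (1 + R)) := by
  set v := ceramiStep J g ρ τ u with hv
  have hvu : ‖v - u‖ ≤ τ * (1 + R) := (norm_ceramiStep_sub_le J g ρ hτ u).trans (by gcongr)
  have hR : 0 ≤ R := (norm_nonneg u).trans hu
  have hball : Convex ℝ (Metric.closedBall (0 : H) (2 * R + 1) ∩ Metric.closedBall u δ) :=
    (convex_closedBall _ _).inter (convex_closedBall _ _)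
  have hvn : ‖v‖ ≤ 2 * R + 1 := by
    have := norm_le_norm_add_norm_sub' v u
    nlinarith
  have key := hball.norm_image_sub_le_of_norm_hasFDerivWithin_le' (f := J) (C := ω)
    (φ := innerSL ℝ (g u)) (f' := fun w => innerSL ℝ (g w)) (x := u) (y := v)
    (fun w _ => (hJ w).hasFDerivWithinAt) (fun w hw => by
      rw [← map_sub, innerSL_apply_norm]
      refine hδ w u (by simpa using hw.1) (by linarith) ?_
      simpa [dist_eq_norm] using hw.2)
    ⟨by simpa using (by linarith : ‖u‖ ≤ 2 * R + 1), by simpa using (by nlinarith : 0 ≤ δ)⟩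
    ⟨by simpa using hvn, by simpa [dist_eq_norm] using hvu.trans hτδ⟩
  have hin : innerSL ℝ (g u) (v - u) = - (τ * (min 1 (max 0 (2 * J u / ρ)) *
      (((1 + ‖u‖) * ‖g u‖) ^ 2 / (1 + (1 + ‖u‖) * ‖g u‖)))) := by
    have : v - u = -((τ * min 1 (max 0 (2 * J u / ρ))) • ceramiField g u) := by
      simp [hv, ceramiStep]
    rw [this, map_neg, map_smul, innerSL_apply_apply, inner_ceramiField, smul_eq_mul]
    ring
  rw [Real.norm_eq_abs] at key
  have h1 := le_of_abs_le key
  have h2 : ω * ‖v - u‖ ≤ ω * (τ * (1 + R)) := by gcongr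
  rw [hin] at h1
  linarith

theorem sq_div_one_add_le {a b : ℝ} (ha : 0 ≤ a) (hab : a ≤ b) :
    a ^ 2 / (1 + a) ≤ b ^ 2 / (1 + b) := by
  have hb := ha.trans hab
  rw [div_le_div_iff₀ (by positivity) (by positivity)]
  have : 0 ≤ (b - a) * (b + a + b * a) := mul_nonneg (by linarith) (by positivity)
  nlinarith

set_option maxHeartbeats 400000 in
/-- **Mountain pass theorem** with Cerami points, for a functional whose gradient is uniformly
continuous on bounded sets. -/
theorem exists_cerami_level {J : H → ℝ} {g : H → H}
    (hJ : ∀ u, HasFDerivAt J (innerSL ℝ (g u)) u) (hg : UniformContinuousOnBounded g)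
    {r ρ : ℝ} (hr : 0 ≤ r) (hρ : 0 < ρ) (hJ0 : J 0 ≤ 0) (hsphere : ∀ u, ‖u‖ = r → ρ ≤ J u)
    {e : H} (he : r ≤ ‖e‖) (hJe : J e ≤ 0) :
    ∃ c, ρ ≤ c ∧ ∀ ε > 0, ∃ u, |J u - c| ≤ ε ∧ (1 + ‖u‖) * ‖g u‖ ≤ ε := by
  have hJc : Continuous J := continuous_iff_continuousAt.2 fun u => (hJ u).continuousAt
  -- Upper bounds of `J` along paths from `0` to `e`; the infimum of `S` is the mountain pass level.
  let S : Set ℝ := {a | ∃ γ : Path (0 : H) e, ∀ t, J (γ t) ≤ a}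
  have hSb : ∀ a ∈ S, ρ ≤ a := by
    rintro a ⟨γ, hγ⟩
    have hc : Continuous fun t => ‖γ t‖ := by fun_prop
    obtain ⟨t, ht⟩ := mem_range_of_exists_le_of_exists_ge hc (c := r)
      ⟨0, by simpa using hr⟩ ⟨1, by simpa using he⟩
    exact (hsphere _ ht).trans (hγ t)
  have hSne : S.Nonempty := by
    let γ : Path (0 : H) e := (PathConnectedSpace.somePath 0 e)
    obtain ⟨b, hb⟩ := (isCompact_range (hJc.comp γ.continuous)).bddAbove
    exact ⟨b, γ, fun t => hb ⟨t, rfl⟩⟩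
  have hSbdd : BddBelow S := ⟨ρ, hSb⟩
  refine ⟨sInf S, le_csInf hSne hSb, ?_⟩
  by_contra! hcon
  obtain ⟨ε, hε, hcon⟩ := hcon
  set c := sInf S with hc
  have hcρ : ρ ≤ c := le_csInf hSne hSb
  -- The cap `ρ / 2` ensures that `J u ≥ c - ε₀` implies `2 * J u / ρ ≥ 1`, so the cutoff is
  -- inactive there. Below, `κ` is the least rate of descent where the Cerami quantity exceeds `ε₀`.
  set ε₀ := min ε (ρ / 2) with hε₀
  have hε₀pos : 0 < ε₀ := by positivity
  have hε₀ε : ε₀ ≤ ε := min_le_left _ _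
  have hε₀ρ : ε₀ ≤ ρ / 2 := min_le_right _ _
  set κ := ε₀ ^ 2 / (1 + ε₀) with hκ
  have hκpos : 0 < κ := by positivity
  have hκε : κ ≤ ε₀ := by
    rw [hκ, div_le_iff₀ (by positivity)]
    nlinarith
  obtain ⟨a, ⟨γ, hγ⟩, ha⟩ := exists_lt_of_csInf_lt hSne (show sInf S < c + κ / 4 by linarith)
  obtain ⟨R₀, hR₀⟩ := (isCompact_range γ.continuous).isBounded.exists_norm_le
  have hR₀' : ∀ t, ‖γ t‖ ≤ R₀ := fun t => hR₀ _ ⟨t, rfl⟩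
  have hR₀0 : 0 ≤ R₀ := (norm_nonneg _).trans (hR₀' 0)
  set R := (1 + R₀) * Real.exp 1 with hR
  have hRpos : 0 < R := by positivity
  obtain ⟨δ, hδ, hmod⟩ := hg (2 * R + 1) (κ / (2 * (1 + R))) (by positivity)
  obtain ⟨n, hn⟩ := exists_nat_one_div_lt (show 0 < min 1 (δ / (1 + R)) by positivity)
  set τ := 1 / ((n : ℝ) + 1) with hτdef
  have hτ : 0 < τ := by positivity
  have hτ1 : τ ≤ 1 := hn.le.trans (min_le_left _ _)
  have hτδ : τ * (1 + R) ≤ δ := by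
    have := hn.le.trans (min_le_right _ _)
    rwa [le_div_iff₀ (by positivity)] at this
  set η := ceramiStep J g ρ τ with hη
  have hηc : Continuous η := ceramiStep_continuous hJc hg.continuous ρ τ
  have hnτ : ((n + 1 : ℕ) : ℝ) * τ = 1 := by
    rw [hτdef]; push_cast; field_simp
  -- The modulus of continuity was chosen to cost `τ * κ / 2` per step, half of the guaranteed
  -- descent. After total time one the net gain is `κ / 2`, which beats the initial excess `κ / 4`
  -- and leaves the path below `c`.
  have main : ∀ t, ∀ k : ℕ, k ≤ n + 1 → 1 + ‖η^[k] (γ t)‖ ≤ (1 + R₀) * Real.exp (k * τ) ∧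
      J (η^[k] (γ t)) ≤ c + κ / 4 - k * τ * (κ / 2) := by
    intro t k
    induction k with
    | zero =>
      intro _
      have := hγ t
      have := hR₀' t
      simp
      constructor <;> linarith
    | succ k ih =>
      intro hk
      obtain ⟨h1, h2⟩ := ih (by omega)
      rw [Function.iterate_succ_apply']
      set w := η^[k] (γ t)
      have hkτ : ((k + 1 : ℕ) : ℝ) * τ ≤ 1 := by
        rw [← hnτ]; gcongr
      push_cast at hkτ ⊢
      have hwR : ‖w‖ ≤ R := by
        have : Real.exp (k * τ) ≤ Real.exp 1 := Real.exp_le_exp.2 (by linarith)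
        have : (1 + R₀) * Real.exp (k * τ) ≤ R := by rw [hR]; gcongr
        linarith
      constructor
      · have h3 := norm_ceramiStep_sub_le J g ρ hτ.le w
        have h4 : ‖η w‖ ≤ ‖w‖ + ‖η w - w‖ := norm_le_norm_add_norm_sub' _ _
        have h5 : τ + 1 ≤ Real.exp τ := Real.add_one_le_exp τ
        have h6 : Real.exp ((k + 1) * τ) = Real.exp (k * τ) * Real.exp τ := by
          rw [← Real.exp_add]; ring_nf
        calc 1 + ‖η w‖ ≤ (1 + ‖w‖) * (τ + 1) := by linarith
          _ ≤ ((1 + R₀) * Real.exp (k * τ)) * Real.exp τ := by gcongr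
          _ = _ := by rw [h6]; ring
      · have hstep := energy_ceramiStep_le hJ (ρ := ρ) hτ.le
          (by positivity : 0 ≤ κ / (2 * (1 + R))) hτ1 hmod hτδ hwR
        have hω : κ / (2 * (1 + R)) * (1 + R) = κ / 2 := by field_simp
        rw [hω] at hstep
        set m := (1 + ‖w‖) * ‖g w‖ with hm
        have hm0 : 0 ≤ m := by positivity
        by_cases hw : c - ε₀ ≤ J w
        · have hkt : 0 ≤ k * τ * (κ / 2) := by positivity
          have hmε : ε < m := hcon w (abs_le.2 ⟨by linarith, by linarith⟩)
          have hχ : min 1 (max 0 (2 * J w / ρ)) = 1 := by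
            refine min_eq_left (le_max_of_le_right ?_)
            rw [le_div_iff₀ hρ]
            linarith
          have hκm : κ ≤ m ^ 2 / (1 + m) := sq_div_one_add_le hε₀pos.le (by linarith)
          rw [hχ, one_mul] at hstep
          have : τ * κ ≤ τ * (m ^ 2 / (1 + m)) := by gcongr
          linarith
        -- Under the level `c - ε₀` descent is not guaranteed, but a step raises `J` by at most `τ *
        -- κ / 2`, and `κ ≤ ε₀` leaves room for that.
        · have : 0 ≤ τ * (min 1 (max 0 (2 * J w / ρ)) * (m ^ 2 / (1 + m))) := by positivity
          have h7 : (k + 1) * τ * (κ / 2) ≤ κ / 2 := mul_le_of_le_one_left (by linarith) hkτ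
          have h8 : τ * (κ / 2) ≤ κ / 2 := mul_le_of_le_one_left (by linarith) hτ1
          linarith
  have hfix : ∀ u, J u ≤ 0 → η^[n + 1] u = u := fun u hu =>
    Function.iterate_fixed (ceramiStep_eq_self hρ hu) _
  have hmem : c - κ / 4 ∈ S := by
    refine ⟨(γ.map (hηc.iterate (n + 1))).cast (hfix 0 hJ0).symm (hfix e hJe).symm, fun t => ?_⟩
    have := (main t (n + 1) le_rfl).2
    rw [hnτ] at this
    simp only [Path.cast_coe, Path.map_coe, Function.comp_apply]
    linarith
  have := csInf_le hSbdd hmem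
  linarith

end MountainPass

/-! ### Weak compactness and two integral inequalities. -/

/-- Bounded sequences of a Hilbert space have weakly convergent subsequences. -/
theorem exists_subseq_weakly_tendsto {H : Type*} [NormedAddCommGroup H] [InnerProductSpace ℝ H]
    [CompleteSpace H] {u : ℕ → H} {R : ℝ} (hu : ∀ n, ‖u n‖ ≤ R) :
    ∃ (w : H) (φ : ℕ → ℕ), StrictMono φ ∧
      ∀ v, Tendsto (fun n => inner ℝ (u (φ n)) v) atTop (𝓝 (inner ℝ w v)) := by
  -- The closed span of the sequence is separable, so sequential Banach-Alaoglu applies in it; other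
  -- test vectors are projected onto it.
  let K : Submodule ℝ H := (Submodule.span ℝ (Set.range u)).topologicalClosure
  have hKc : IsClosed (K : Set H) := Submodule.isClosed_topologicalClosure _
  have : CompleteSpace K := hKc.completeSpace_coe
  have : TopologicalSpace.SeparableSpace K := by
    have h1 : TopologicalSpace.IsSeparable (Set.range u) := (Set.countable_range u).isSeparable
    have h2 := (h1.span (R := ℝ)).closure
    have : (K : Set H) = closure (Submodule.span ℝ (Set.range u) : Set H) :=
      Submodule.topologicalClosure_coe _
    rw [← this] at h2
    exact h2.separableSpace
  have huK : ∀ n, u n ∈ K := fun n =>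
    Submodule.le_topologicalClosure _ (Submodule.subset_span ⟨n, rfl⟩)
  let ℓ : ℕ → WeakDual ℝ K := fun n =>
    StrongDual.toWeakDual (InnerProductSpace.toDual ℝ K ⟨u n, huK n⟩)
  have hℓ : ∀ n, ℓ n ∈ WeakDual.toStrongDual ⁻¹' Metric.closedBall (0 : StrongDual ℝ K) R := by
    intro n
    have h : ‖InnerProductSpace.toDual ℝ K ⟨u n, huK n⟩‖ ≤ R := by
      rw [LinearIsometryEquiv.norm_map]
      exact hu n
    exact mem_closedBall_zero_iff.2 h
  obtain ⟨w, -, φ, hφ, hlim⟩ := WeakDual.isSeqCompact_closedBall ℝ K 0 R hℓ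
  refine ⟨((InnerProductSpace.toDual ℝ K).symm (WeakDual.toStrongDual w) : K), φ, hφ, fun v => ?_⟩
  have hev : Tendsto (fun n => ℓ (φ n) (K.orthogonalProjectionOnto v)) atTop
      (𝓝 (w (K.orthogonalProjectionOnto v))) :=
    ((WeakDual.eval_continuous (K.orthogonalProjectionOnto v)).tendsto w).comp hlim
  have h1 : ∀ z : K, inner ℝ (z : H) v = inner ℝ z (K.orthogonalProjectionOnto v) := fun z => by
    rw [Submodule.inner_orthogonalProjectionOnto_eq_of_mem_left]
  have h2 : w (K.orthogonalProjectionOnto v)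
      = inner ℝ ((InnerProductSpace.toDual ℝ K).symm (WeakDual.toStrongDual w))
        (K.orthogonalProjectionOnto v) := by
    rw [InnerProductSpace.toDual_symm_apply]; rfl
  rw [h1, ← h2]
  refine hev.congr fun n => ?_
  have := h1 ⟨u (φ n), huK _⟩
  exact this.symm

/-- Cauchy-Schwarz against the constant function on a set of finite measure. -/
theorem sq_setIntegral_le {α : Type*} [MeasurableSpace α] {μ : Measure α} {B : Set α}
    (hB : μ B ≠ ⊤) {g : α → ℝ} (hg : IntegrableOn g B μ) (hg2 : IntegrableOn (fun x => g x ^ 2) B μ) :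
    (∫ x in B, g x ∂μ) ^ 2 ≤ μ.real B * ∫ x in B, g x ^ 2 ∂μ := by
  set m := μ.real B with hm
  set I := ∫ x in B, g x ∂μ with hI
  have : IsFiniteMeasure (μ.restrict B) := ⟨by simpa using hB.lt_top⟩
  have h0 : 0 ≤ ∫ x in B, (m * g x - I) ^ 2 ∂μ := integral_nonneg fun x => sq_nonneg _
  have h1 : ∫ x in B, (m * g x - I) ^ 2 ∂μ = m ^ 2 * ∫ x in B, g x ^ 2 ∂μ - m * I ^ 2 := by
    have : ∀ x, (m * g x - I) ^ 2 = m ^ 2 * g x ^ 2 - (2 * m * I) * g x + I ^ 2 := fun x => by ring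
    simp only [this]
    have e : Integrable (fun x => m ^ 2 * g x ^ 2 - (2 * m * I) * g x) (μ.restrict B) :=
      (hg2.const_mul _).sub (hg.const_mul _)
    rw [integral_add e (integrable_const _), integral_sub (hg2.const_mul _) (hg.const_mul _), integral_const_mul, integral_const_mul]
    simp [← hm, ← hI]
    ring
  rw [h1] at h0
  rcases (measureReal_nonneg : 0 ≤ μ.real B).eq_or_lt with h | h
  · have : μ.restrict B = 0 := by
      rw [Measure.restrict_eq_zero]
      exact (measureReal_eq_zero_iff hB).1 h.symm
    simp [hI, this]
  · have : 0 ≤ m * (m * ∫ x in B, g x ^ 2 ∂μ - I ^ 2) := by nlinarith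
    have := nonneg_of_mul_nonneg_right this h
    linarith

/-- Hölder's inequality for `|u| ^ (q - 1) * |v|`. -/
theorem integral_abs_rpow_mul_abs_le {α : Type*} [MeasurableSpace α] {μ : Measure α} {q : ℝ}
    (hq : 1 < q) {u v : α → ℝ} (hum : AEStronglyMeasurable u μ) (hvm : AEStronglyMeasurable v μ)
    (hu : Integrable (fun x => |u x| ^ q) μ) (hv : Integrable (fun x => |v x| ^ q) μ) :
    Integrable (fun x => |u x| ^ (q - 1) * |v x|) μ ∧
    ∫ x, |u x| ^ (q - 1) * |v x| ∂μ
      ≤ (∫ x, |u x| ^ q ∂μ) ^ (1 - 1 / q) * (∫ x, |v x| ^ q ∂μ) ^ (1 / q) := by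
  have hq0 : 0 < q := by linarith
  have hq1 : 0 < q - 1 := by linarith
  have hconj : (q / (q - 1)).HolderConjugate q := by
    rw [Real.holderConjugate_iff]
    constructor
    · rw [lt_div_iff₀ hq1]; linarith
    · field_simp; ring
  have hpow : ∀ x, (|u x| ^ (q - 1)) ^ (q / (q - 1)) = |u x| ^ q := fun x => by
    rw [← Real.rpow_mul (abs_nonneg _)]
    congr 1
    field_simp
  have hpm : AEStronglyMeasurable (fun x => |u x| ^ (q - 1)) μ :=
    (Real.continuous_rpow_const hq1.le).comp_aestronglyMeasurable
      (continuous_abs.comp_aestronglyMeasurable hum)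
  have hum' : MemLp (fun x => |u x| ^ (q - 1)) (ENNReal.ofReal (q / (q - 1))) μ := by
    have hp : 0 < q / (q - 1) := by positivity
    rw [← integrable_norm_rpow_iff hpm (by simpa using hp) ENNReal.ofReal_ne_top,
      ENNReal.toReal_ofReal hp.le]
    refine hu.congr (Eventually.of_forall fun x => ?_)
    simp only [Real.norm_eq_abs]
    rw [abs_of_nonneg (by positivity : 0 ≤ |u x| ^ (q - 1)), hpow]
  have hvm' : MemLp (fun x => |v x|) (ENNReal.ofReal q) μ := by
    rw [← integrable_norm_rpow_iff (continuous_abs.comp_aestronglyMeasurable hvm)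
      (by simpa using hq0) ENNReal.ofReal_ne_top, ENNReal.toReal_ofReal hq0.le]
    simpa using hv
  constructor
  · have := hconj.ennrealOfReal
    exact MemLp.integrable_mul hum' hvm'
  · have := integral_mul_le_Lp_mul_Lq_of_nonneg hconj (Eventually.of_forall fun x => by positivity)
      (Eventually.of_forall fun x => by positivity) hum' hvm'
    simp only [hpow] at this
    convert this using 3
    field_simp

/-! ### The Gagliardo density and concentration of mass. -/

section Density

variable {N : ℕ} {s : ℝ}

/-- The density `x ↦ ∫ |u x - u y|² / |x - y| ^ (N + 2 s) dy` of the Gagliardo seminorm. -/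
noncomputable def gagliardoDensity (s : ℝ) (u : RN N → ℝ) (x : RN N) : ℝ :=
  ∫ y, gagliardoKernel s u u (x, y)

theorem gagliardoKernel_self_nonneg (u : RN N → ℝ) (p : RN N × RN N) :
    0 ≤ gagliardoKernel s u u p :=
  div_nonneg (mul_self_nonneg _) (by positivity)

theorem gagliardoDensity_nonneg (u : RN N → ℝ) (x : RN N) : 0 ≤ gagliardoDensity s u x :=
  integral_nonneg fun _ => gagliardoKernel_self_nonneg _ _

theorem integrable_gagliardoDensity {u : RN N → ℝ} (hu : Integrable (gagliardoKernel s u u)) :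
    Integrable (gagliardoDensity s u) := by
  rw [Measure.volume_eq_prod] at hu
  exact hu.integral_prod_left

theorem integral_gagliardoDensity {u : RN N → ℝ} (hu : Integrable (gagliardoKernel s u u)) :
    ∫ x, gagliardoDensity s u x = gagliardoForm s u u := by
  unfold gagliardoForm gagliardoDensity
  rw [Measure.volume_eq_prod] at hu ⊢
  exact (integral_prod _ hu).symm

theorem volume_real_ball_eq (x : RN N) {r : ℝ} (hr : 0 < r) :
    volume.real (Metric.ball x r) = r ^ (N : ℝ) * volume.real (Metric.ball (0 : RN N) 1) := by
  rw [measureReal_def, Measure.addHaar_ball_of_pos _ _ hr, ENNReal.toReal_mul, measureReal_def,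
    ENNReal.toReal_ofReal (by positivity), finrank_euclideanSpace_fin, Real.rpow_natCast]

theorem volume_real_ball_pos (x : RN N) {r : ℝ} (hr : 0 < r) :
    0 < volume.real (Metric.ball x r) :=
  ENNReal.toReal_pos (Metric.measure_ball_pos _ _ hr).ne' measure_ball_lt_top.ne

/-- Pointwise comparison of a function with its averages over balls. -/
theorem sq_volume_mul_le (hs : 0 < s) {u : RN N → ℝ} (hu : MemLp u 2 volume)
    {x : RN N} (hx : Integrable fun y => gagliardoKernel s u u (x, y)) {r : ℝ} (hr : 0 < r) :
    (volume.real (Metric.ball x r) * u x) ^ 2 ≤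
      2 * (volume.real (Metric.ball x r) * (r ^ ((N : ℝ) + 2 * s) * gagliardoDensity s u x))
        + 2 * (∫ y in Metric.ball x r, u y) ^ 2 := by
  set B := Metric.ball x r
  have hBfin : volume B ≠ ⊤ := measure_ball_lt_top.ne
  have : IsFiniteMeasure (volume.restrict B) := ⟨by simpa using hBfin.lt_top⟩
  have huB : MemLp u 2 (volume.restrict B) := hu.restrict B
  have hg : MemLp (fun y => u x - u y) 2 (volume.restrict B) := (memLp_const _).sub huB
  have h1 := sq_setIntegral_le hBfin (hg.integrable (by norm_num)) hg.integrable_sq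
  have h2 : ∫ y in B, (u x - u y) = volume.real B * u x - ∫ y in B, u y := by
    rw [integral_sub (integrable_const _) (huB.integrable (by norm_num))]
    simp
  have he : (0 : ℝ) < (N : ℝ) + 2 * s := by positivity
  -- On the ball `|x - y| ≤ r`, so inserting the singular weight costs at most `r ^ (N + 2 s)`.
  have h3 : ∫ y in B, (u x - u y) ^ 2 ≤ r ^ ((N : ℝ) + 2 * s) * gagliardoDensity s u x := by
    calc ∫ y in B, (u x - u y) ^ 2
        ≤ ∫ y in B, r ^ ((N : ℝ) + 2 * s) * gagliardoKernel s u u (x, y) := by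
          refine setIntegral_mono_on hg.integrable_sq (hx.integrableOn.const_mul _)
            measurableSet_ball fun y hy => ?_
          rcases eq_or_ne x y with rfl | hxy
          · simp [gagliardoKernel]
          · have hpos : 0 < ‖x - y‖ := norm_pos_iff.2 (sub_ne_zero.2 hxy)
            have hle : ‖x - y‖ ≤ r := by
              rw [← dist_eq_norm, dist_comm]; exact (Metric.mem_ball.1 hy).le
            have : ‖x - y‖ ^ ((N : ℝ) + 2 * s) ≤ r ^ ((N : ℝ) + 2 * s) := by gcongr
            simp only [gagliardoKernel]
            rw [← mul_div_assoc, le_div_iff₀ (by positivity)]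
            nlinarith [sq_nonneg (u x - u y)]
      _ = r ^ ((N : ℝ) + 2 * s) * ∫ y in B, gagliardoKernel s u u (x, y) := integral_const_mul _ _
      _ ≤ _ := by
          refine mul_le_mul_of_nonneg_left ?_ (by positivity)
          exact setIntegral_le_integral hx
            (Eventually.of_forall fun y => gagliardoKernel_self_nonneg _ _)
  rw [h2] at h1
  have h4 := mul_le_mul_of_nonneg_left h3 (measureReal_nonneg (μ := volume) (s := B))
  nlinarith [sq_nonneg (volume.real B * u x - 2 * ∫ y in B, u y)]

theorem ae_integrable_gagliardoKernel {u : RN N → ℝ} (hu : Integrable (gagliardoKernel s u u)) :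
    ∀ᵐ x, Integrable fun y => gagliardoKernel s u u (x, y) := by
  rw [Measure.volume_eq_prod] at hu
  exact hu.prod_right_ae

/-- If a function of controlled seminorm is not small in measure, then it has some mass in a
ball of radius one. -/
theorem exists_ball_mass (hs : 0 < s) {K δ η : ℝ} (hK : 0 < K) (hδ : 0 < δ) (hη : 0 < η) :
    ∃ c > 0, ∀ u : RN N → ℝ, MemLp u 2 volume → Integrable (gagliardoKernel s u u) →
      gagliardoForm s u u ≤ K → η ≤ volume.real {x | δ ≤ |u x|} →
      ∃ x, c ≤ ∫ y in Metric.ball x 1, u y ^ 2 := by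
  set ω := volume.real (Metric.ball (0 : RN N) 1) with hω
  have hωpos : 0 < ω := volume_real_ball_pos _ one_pos
  have hlim : Tendsto (fun r : ℝ => r ^ (2 * s)) (𝓝[>] 0) (𝓝 0) := by
    have := (Real.continuous_rpow_const (by positivity : 0 ≤ 2 * s)).tendsto 0
    rw [Real.zero_rpow (by positivity)] at this
    exact this.mono_left nhdsWithin_le_nhds
  -- A radius so small that the density `t` forced below on a set of measure `η` would have integral
  -- larger than `K`.
  obtain ⟨r, ⟨hrK, hr0, hr1⟩⟩ := ((hlim.eventually (gt_mem_nhds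
    (show 0 < η * (ω * δ ^ 2) / (4 * K) by positivity))).and
    (Ioo_mem_nhdsGT (zero_lt_one (α := ℝ)))).exists
  set m := r ^ (N : ℝ) * ω with hm
  have hrN : 0 < r ^ (N : ℝ) := by positivity
  have hmpos : 0 < m := by positivity
  refine ⟨δ ^ 2 * m / 4, by positivity, fun u hu huk huK hη' => ?_⟩
  by_contra! hcon
  set t := δ ^ 2 * ω / (4 * r ^ (2 * s)) with ht
  have htpos : 0 < t := by positivity
  -- If every unit ball carries little mass, the average of `u` near `x` cannot account for `|u x| ≥
  -- δ`; the oscillation must, so the density at `x` is at least `t`. Markov's inequality then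
  -- contradicts the choice of `r`.
  have hsub : ∀ᵐ x, x ∈ {x | δ ≤ |u x|} → x ∈ {x | t ≤ gagliardoDensity s u x} := by
    filter_upwards [ae_integrable_gagliardoKernel huk] with x hx hxδ
    have h1 := sq_volume_mul_le hs hu hx hr0
    have hBfin : volume (Metric.ball x r) ≠ ⊤ := measure_ball_lt_top.ne
    have huB : MemLp u 2 (volume.restrict (Metric.ball x r)) := hu.restrict _
    have : IsFiniteMeasure (volume.restrict (Metric.ball x r)) := ⟨by simpa using hBfin.lt_top⟩
    have h2 := sq_setIntegral_le hBfin (huB.integrable (by norm_num)) huB.integrable_sq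
    rw [volume_real_ball_eq x hr0, ← hω, ← hm] at h1 h2
    have h3 : ∫ y in Metric.ball x r, u y ^ 2 ≤ ∫ y in Metric.ball x 1, u y ^ 2 :=
      setIntegral_mono_set hu.integrable_sq.integrableOn
        (Eventually.of_forall fun y => sq_nonneg _)
        (Metric.ball_subset_ball hr1.le).eventuallyLE
    have h4 := hcon x
    have h5 : δ ^ 2 ≤ u x ^ 2 := by rw [← sq_abs (u x)]; gcongr
    have h6 : r ^ ((N : ℝ) + 2 * s) = r ^ (N : ℝ) * r ^ (2 * s) := Real.rpow_add hr0 _ _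
    have h7 : m * (m * δ ^ 2 / 2) ≤ m * (2 * (r ^ ((N : ℝ) + 2 * s) * gagliardoDensity s u x)) := by
      have : m * (∫ y in Metric.ball x r, u y ^ 2) ≤ m * (δ ^ 2 * m / 4) := by
        gcongr; exact h3.trans h4.le
      have : m ^ 2 * δ ^ 2 ≤ m ^ 2 * u x ^ 2 := by gcongr
      nlinarith
    have h8 := le_of_mul_le_mul_left h7 hmpos
    rw [h6, hm] at h8
    have h9 : r ^ (N : ℝ) * (ω * δ ^ 2 / 2)
        ≤ r ^ (N : ℝ) * (2 * (r ^ (2 * s) * gagliardoDensity s u x)) := by linarith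
    have h10 := le_of_mul_le_mul_left h9 hrN
    rw [ht, div_le_iff₀ (by positivity)]
    linarith
  have hint := integrable_gagliardoDensity huk
  have hmarkov := mul_meas_ge_le_integral_of_nonneg
    (Eventually.of_forall fun x => gagliardoDensity_nonneg u x) hint t
  rw [integral_gagliardoDensity huk] at hmarkov
  have hfin : volume {x | t ≤ gagliardoDensity s u x} ≠ ⊤ :=
    (hint.measure_ge_lt_top htpos).ne
  have h11 : volume.real {x | δ ≤ |u x|} ≤ volume.real {x | t ≤ gagliardoDensity s u x} :=
    ENNReal.toReal_mono hfin (measure_mono_ae hsub)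
  have h12 : t * η ≤ K := by
    have : t * η ≤ t * volume.real {x | t ≤ gagliardoDensity s u x} := by
      gcongr
      exact hη'.trans h11
    linarith
  rw [ht, div_mul_eq_mul_div, div_le_iff₀ (by positivity)] at h12
  rw [lt_div_iff₀ (by positivity)] at hrK
  linarith

end Density

/-! ### The fractional Sobolev inequality. -/

/-- Optimization over the radius in the proof of the fractional Sobolev inequality. -/
theorem rpow_le_of_forall_radius {n s a A d y : ℝ} (hs : 0 < s) (hn : 2 * s < n) (ha : 0 ≤ a)
    (hA : 0 < A) (hd : 0 ≤ d) (hy : 0 ≤ y)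
    (h : ∀ r : ℝ, 0 < r → y ^ 2 ≤ a * (r ^ (2 * s) * d + r ^ (2 * s - n) * A)) :
    y ^ (2 * n / (n - 2 * s)) ≤ (2 * a) ^ (n / (n - 2 * s)) * A ^ (2 * s / (n - 2 * s)) * d := by
  have hn0 : 0 < n := by linarith
  have hns : 0 < n - 2 * s := by linarith
  set K := (2 * a) ^ (n / (n - 2 * s)) * A ^ (2 * s / (n - 2 * s)) with hK
  -- The optimal radius `(A / d) ^ (1 / n)` degenerates for `d = 0`; hence `d' > d`, followed by a
  -- limit. With `d'` this radius makes the two terms equal.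
  have key : ∀ d' > d, y ^ (2 * n / (n - 2 * s)) ≤ K * d' := by
    intro d' hd'
    have hd'0 : 0 < d' := hd.trans_lt hd'
    have h1 := h ((A / d') ^ (1 / n)) (by positivity)
    have e1 : ((A / d') ^ (1 / n)) ^ (2 * s) * d'
        = A ^ (2 * s / n) * d' ^ ((n - 2 * s) / n) := by
      rw [← Real.rpow_mul (by positivity), Real.div_rpow hA.le hd'0.le]
      have : (n - 2 * s) / n = 1 - 1 / n * (2 * s) := by field_simp
      rw [this, Real.rpow_sub hd'0, Real.rpow_one]
      have : 1 / n * (2 * s) = 2 * s / n := by ring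
      rw [this]
      ring
    have e2 : ((A / d') ^ (1 / n)) ^ (2 * s - n) * A
        = A ^ (2 * s / n) * d' ^ ((n - 2 * s) / n) := by
      rw [← Real.rpow_mul (by positivity), Real.div_rpow hA.le hd'0.le]
      have : 1 / n * (2 * s - n) = - ((n - 2 * s) / n) := by field_simp; ring
      rw [this, Real.rpow_neg hd'0.le, div_inv_eq_mul]
      have : A ^ (2 * s / n) = A ^ (-((n - 2 * s) / n)) * A := by
        rw [← Real.rpow_add_one hA.ne']
        congr 1
        field_simp
        ring
      rw [this]
      ring
    have h2 : y ^ 2 ≤ 2 * a * (A ^ (2 * s / n) * d' ^ ((n - 2 * s) / n)) := by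
      rw [e2] at h1
      have : ((A / d') ^ (1 / n)) ^ (2 * s) * d ≤ A ^ (2 * s / n) * d' ^ ((n - 2 * s) / n) := by
        rw [← e1]; gcongr
      nlinarith
    have h3 := Real.rpow_le_rpow (by positivity) h2 (show 0 ≤ n / (n - 2 * s) by positivity)
    have e3 : (y ^ 2) ^ (n / (n - 2 * s)) = y ^ (2 * n / (n - 2 * s)) := by
      rw [← Real.rpow_natCast, ← Real.rpow_mul hy]
      congr 1
      push_cast
      ring
    have h2a : 0 ≤ 2 * a := by positivity
    have hAd : 0 ≤ A ^ (2 * s / n) * d' ^ ((n - 2 * s) / n) := by positivity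
    rw [e3, Real.mul_rpow h2a hAd, Real.mul_rpow (x := A ^ _) (by positivity) (by positivity), ← Real.rpow_mul hA.le,
      ← Real.rpow_mul hd'0.le] at h3
    have e4 : (n - 2 * s) / n * (n / (n - 2 * s)) = 1 := by field_simp
    have e5 : 2 * s / n * (n / (n - 2 * s)) = 2 * s / (n - 2 * s) := by field_simp
    rw [e4, e5, Real.rpow_one] at h3
    rw [hK]
    linarith
  have hlim : Tendsto (fun d' => K * d') (𝓝[>] d) (𝓝 (K * d)) :=
    ((continuous_const.mul continuous_id).tendsto d).mono_left nhdsWithin_le_nhds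
  exact ge_of_tendsto hlim (eventually_nhdsWithin_of_forall key)

section Sobolev

variable {N : ℕ} {s : ℝ}

theorem two_lt_criticalExponent (hs : 0 < s) (hN : 2 * s < (N : ℝ)) : 2 < criticalExponent N s := by
  rw [criticalExponent, lt_div_iff₀ (by linarith)]
  linarith

/-- The fractional Sobolev inequality for bounded functions. -/
theorem integral_rpow_le_of_bounded (hs : 0 < s) (hN : 2 * s < (N : ℝ)) {u : RN N → ℝ}
    (hu : MemLp u 2 volume) (huk : Integrable (gagliardoKernel s u u))
    {M : ℝ} (hM : ∀ x, |u x| ≤ M) :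
    Integrable (fun x => |u x| ^ criticalExponent N s) ∧
    ∫ x, |u x| ^ criticalExponent N s ≤
      ((2 * (2 * (volume.real (Metric.ball (0 : RN N) 1))⁻¹
          + 2 * (volume.real (Metric.ball (0 : RN N) 1)) ^ (-(2 / criticalExponent N s))))
        ^ ((N : ℝ) / (N - 2 * s)) * gagliardoForm s u u) ^ (criticalExponent N s / 2) := by
  set q := criticalExponent N s with hq
  have hq2 : 2 < q := two_lt_criticalExponent hs hN
  have hn0 : (0 : ℝ) < N := by linarith
  have hns : (0 : ℝ) < N - 2 * s := by linarith
  set ω := volume.real (Metric.ball (0 : RN N) 1) with hω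
  have hωpos : 0 < ω := volume_real_ball_pos _ one_pos
  have hM0 : 0 ≤ M := (abs_nonneg _).trans (hM 0)
  -- Boundedness is used only here: the `L^q` norm enters both sides of the final estimate and must
  -- be known to be finite before it can be absorbed.
  have hqint : Integrable (fun x => |u x| ^ q) := by
    refine (hu.integrable_sq.const_mul (M ^ (q - 2))).mono'
      ((Real.continuous_rpow_const (by linarith)).comp_aestronglyMeasurable
        (continuous_abs.comp_aestronglyMeasurable hu.1)) (Eventually.of_forall fun x => ?_)
    rw [Real.norm_of_nonneg (by positivity)]
    have : |u x| ^ q = |u x| ^ (q - 2) * u x ^ 2 := by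
      rw [← sq_abs (u x), ← Real.rpow_natCast, ← Real.rpow_add' (abs_nonneg _)]
      · congr 1; push_cast; ring
      · push_cast; linarith
    rw [this]
    have : |u x| ^ (q - 2) ≤ M ^ (q - 2) :=
      Real.rpow_le_rpow (abs_nonneg _) (hM x) (by linarith)
    gcongr
  refine ⟨hqint, ?_⟩
  set I := ∫ x, |u x| ^ q with hI
  set c := 2 * ω⁻¹ + 2 * ω ^ (-(2 / q)) with hc
  have hcpos : 0 < c := by positivity
  have hI0 : 0 ≤ I := integral_nonneg fun x => by positivity
  rcases hI0.eq_or_lt with hI0 | hIpos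
  · rw [← hI0]
    have := FracSobolev.gagliardoForm_self_nonneg u (s := s)
    positivity
  have hpoint : ∀ᵐ x, |u x| ^ q ≤ (2 * c) ^ ((N : ℝ) / (N - 2 * s)) *
      (I ^ (2 / q)) ^ (2 * s / (N - 2 * s)) * gagliardoDensity s u x := by
    filter_upwards [ae_integrable_gagliardoKernel huk] with x hx
    refine rpow_le_of_forall_radius hs hN hcpos.le (by positivity)
      (gagliardoDensity_nonneg u x) (abs_nonneg _) fun r hr => ?_
    have h1 := sq_volume_mul_le hs hu hx hr
    set B := Metric.ball x r
    have hBfin : volume B ≠ ⊤ := measure_ball_lt_top.ne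
    have : IsFiniteMeasure (volume.restrict B) := ⟨by simpa using hBfin.lt_top⟩
    have hm : volume.real B = r ^ (N : ℝ) * ω := volume_real_ball_eq x hr
    set m := volume.real B
    have hmpos : 0 < m := volume_real_ball_pos x hr
    have h2 := (integral_abs_rpow_mul_abs_le (μ := volume.restrict B) (q := q) (u := fun _ => 1)
      (by linarith) aestronglyMeasurable_const hu.1.restrict (by simp)
      hqint.integrableOn).2
    simp only [abs_one, Real.one_rpow, one_mul, integral_const, smul_eq_mul, mul_one,
      measureReal_restrict_apply_univ] at h2
    -- Measuring the average in `L^q` gives the negative power `r ^ (2 s - N)`, while the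
    -- oscillation gives `r ^ (2 s)`; the radius balances the two.
    have h3 : |∫ y in B, u y| ≤ m ^ (1 - 1 / q) * I ^ (1 / q) := by
      refine (abs_integral_le_integral_abs).trans (h2.trans ?_)
      gcongr
      exact setIntegral_le_integral hqint (Eventually.of_forall fun y => by positivity)
    have h4 : (∫ y in B, u y) ^ 2 ≤ m ^ 2 * (m ^ (-(2 / q)) * I ^ (2 / q)) := by
      rw [← sq_abs]
      calc |∫ y in B, u y| ^ 2 ≤ (m ^ (1 - 1 / q) * I ^ (1 / q)) ^ 2 := by gcongr
        _ = m ^ 2 * (m ^ (-(2 / q)) * I ^ (2 / q)) := by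
          rw [mul_pow, ← Real.rpow_natCast (m ^ _), ← Real.rpow_natCast (I ^ _),
            ← Real.rpow_mul hmpos.le, ← Real.rpow_mul hI0, ← mul_assoc,
            ← Real.rpow_natCast m 2, ← Real.rpow_add hmpos]
          congr 2 <;> push_cast <;> ring
    have h5 : m ^ 2 * |u x| ^ 2 ≤ m ^ 2 * (2 * (m⁻¹ * (r ^ ((N : ℝ) + 2 * s) *
        gagliardoDensity s u x)) + 2 * (m ^ (-(2 / q)) * I ^ (2 / q))) := by
      have : m ^ 2 * (2 * (m⁻¹ * (r ^ ((N : ℝ) + 2 * s) * gagliardoDensity s u x)))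
          = 2 * (m * (r ^ ((N : ℝ) + 2 * s) * gagliardoDensity s u x)) := by
        field_simp
      rw [sq_abs, mul_add, this]
      linarith
    have h6 := le_of_mul_le_mul_left h5 (by positivity)
    have e1 : m⁻¹ * r ^ ((N : ℝ) + 2 * s) = ω⁻¹ * r ^ (2 * s) := by
      rw [hm, Real.rpow_add hr]
      have : r ^ (N : ℝ) ≠ 0 := by positivity
      field_simp
    have e2 : m ^ (-(2 / q)) = ω ^ (-(2 / q)) * r ^ (2 * s - N) := by
      rw [hm, Real.mul_rpow (by positivity) hωpos.le, ← Real.rpow_mul hr.le, mul_comm]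
      congr 2
      rw [hq, criticalExponent]
      field_simp
      ring
    rw [← mul_assoc m⁻¹, e1, e2] at h6
    have hD := gagliardoDensity_nonneg (s := s) u x
    have p1 : 0 ≤ ω⁻¹ * (r ^ (2 * s - N) * I ^ (2 / q)) := by positivity
    have p2 : 0 ≤ ω ^ (-(2 / q)) * (r ^ (2 * s) * gagliardoDensity s u x) := by positivity
    calc |u x| ^ 2 ≤ _ := h6
      _ ≤ c * (r ^ (2 * s) * gagliardoDensity s u x + r ^ (2 * s - N) * I ^ (2 / q)) := by
        rw [hc]
        linarith
  have h7 : I ≤ (2 * c) ^ ((N : ℝ) / (N - 2 * s)) *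
      (I ^ (2 / q)) ^ (2 * s / (N - 2 * s)) * gagliardoForm s u u := by
    rw [← integral_gagliardoDensity huk, ← integral_const_mul]
    exact integral_mono_ae hqint ((integrable_gagliardoDensity huk).const_mul _) hpoint
  -- For the critical `q` the exponents add up to one, so dividing by the first factor leaves `I ^
  -- (2 / q)` bounded by the seminorm.
  have e3 : I = (I ^ (2 / q)) ^ (2 * s / (N - 2 * s)) * I ^ (2 / q) := by
    rw [← Real.rpow_mul hI0, ← Real.rpow_add hIpos]
    have : 2 / q * (2 * s / (N - 2 * s)) + 2 / q = 1 := by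
      rw [hq, criticalExponent]
      field_simp
      ring
    rw [this, Real.rpow_one]
  have h8 : I ^ (2 / q) ≤ (2 * c) ^ ((N : ℝ) / (N - 2 * s)) * gagliardoForm s u u := by
    refine le_of_mul_le_mul_left ?_
      (show 0 < (I ^ (2 / q)) ^ (2 * s / (N - 2 * s)) by positivity)
    rw [← e3]
    linarith
  have h9 := Real.rpow_le_rpow (by positivity) h8 (show 0 ≤ q / 2 by linarith)
  rw [← Real.rpow_mul hI0] at h9
  have : 2 / q * (q / 2) = 1 := by field_simp
  rwa [this, Real.rpow_one] at h9

theorem abs_min_abs_sub_le (a b M : ℝ) : |min |a| M - min |b| M| ≤ |a - b| :=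
  (abs_min_sub_min_le_max _ _ _ _).trans (by simpa using abs_abs_sub_abs_le a b)

/-- **Fractional Sobolev inequality.** -/
theorem exists_sobolev_const (hs : 0 < s) (hN : 2 * s < (N : ℝ)) :
    ∃ S > 0, ∀ u : RN N → ℝ, MemLp u 2 volume → Integrable (gagliardoKernel s u u) →
      Integrable (fun x => |u x| ^ criticalExponent N s) ∧
      ∫ x, |u x| ^ criticalExponent N s ≤ S * gagliardoForm s u u ^ (criticalExponent N s / 2) := by
  set q := criticalExponent N s with hq
  have hq2 : 2 < q := two_lt_criticalExponent hs hN
  have hns : (0 : ℝ) < N - 2 * s := by linarith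
  set K := (2 * (2 * (volume.real (Metric.ball (0 : RN N) 1))⁻¹
          + 2 * (volume.real (Metric.ball (0 : RN N) 1)) ^ (-(2 / q))))
        ^ ((N : ℝ) / (N - 2 * s)) with hK
  have hωpos : 0 < volume.real (Metric.ball (0 : RN N) 1) := volume_real_ball_pos _ one_pos
  have hKpos : 0 < K := by positivity
  refine ⟨K ^ (q / 2), by positivity, fun u hu huk => ?_⟩
  have hform := FracSobolev.gagliardoForm_self_nonneg u (s := s)
  rw [← Real.mul_rpow hKpos.le hform]
  set T := (K * gagliardoForm s u u) ^ (q / 2) with hT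
  have hT0 : 0 ≤ T := by positivity
  -- Truncations are bounded and, being `1`-Lipschitz images of `u`, do not increase the seminorm;
  -- Fatou's lemma removes the truncation.
  let w : ℕ → RN N → ℝ := fun n x => min |u x| n
  have hwm : ∀ n, AEStronglyMeasurable (w n) volume := fun n =>
    (continuous_abs.min continuous_const).comp_aestronglyMeasurable hu.1
  have hw0 : ∀ n x, 0 ≤ w n x := fun n x => by positivity
  have hw : ∀ n, MemLp (w n) 2 volume := fun n => hu.mono (hwm n)
    (Eventually.of_forall fun x => by
      rw [Real.norm_of_nonneg (hw0 n x)]; exact min_le_left _ _)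
  have hker : ∀ n p, gagliardoKernel s (w n) (w n) p ≤ gagliardoKernel s u u p := fun n p => by
    unfold gagliardoKernel
    gcongr ?_ / _
    rw [← sq, ← sq]
    exact sq_le_sq.2 (abs_min_abs_sub_le _ _ _)
  have hwk : ∀ n, Integrable (gagliardoKernel s (w n) (w n)) := fun n =>
    huk.mono' (gagliardoKernel_aestronglyMeasurable s (hwm n) (hwm n))
      (Eventually.of_forall fun p => by
        rw [Real.norm_of_nonneg (gagliardoKernel_self_nonneg _ _)]; exact hker n p)
  have hwT : ∀ n, ∫⁻ x, ENNReal.ofReal (|w n x| ^ q) ≤ ENNReal.ofReal T := fun n => by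
    obtain ⟨h1, h2⟩ := integral_rpow_le_of_bounded hs hN (hw n) (hwk n) (M := n)
      (fun x => by rw [abs_of_nonneg (hw0 n x)]; exact min_le_right _ _)
    rw [← ofReal_integral_eq_lintegral_ofReal h1 (Eventually.of_forall fun x => by positivity)]
    refine ENNReal.ofReal_le_ofReal (h2.trans ?_)
    have h3 : gagliardoForm s (w n) (w n) ≤ gagliardoForm s u u :=
      integral_mono (hwk n) huk (hker n)
    have := FracSobolev.gagliardoForm_self_nonneg (w n) (s := s)
    rw [hT]
    gcongr
  have hqm : AEStronglyMeasurable (fun x => |u x| ^ q) volume :=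
    (Real.continuous_rpow_const (by linarith)).comp_aestronglyMeasurable
        (continuous_abs.comp_aestronglyMeasurable hu.1)
  have hlim : ∀ x, liminf (fun n => ENNReal.ofReal (|w n x| ^ q)) atTop
      = ENNReal.ofReal (|u x| ^ q) := fun x => by
    refine Tendsto.liminf_eq (tendsto_const_nhds.congr' ?_)
    obtain ⟨n₀, hn₀⟩ := exists_nat_ge |u x|
    filter_upwards [eventually_ge_atTop n₀] with n hn
    have : |u x| ≤ n := hn₀.trans (by exact_mod_cast hn)
    simp [w, min_eq_left this]
  have hfatou : ∫⁻ x, ENNReal.ofReal (|u x| ^ q) ≤ ENNReal.ofReal T := by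
    calc ∫⁻ x, ENNReal.ofReal (|u x| ^ q)
        = ∫⁻ x, liminf (fun n => ENNReal.ofReal (|w n x| ^ q)) atTop := by simp only [hlim]
      _ ≤ liminf (fun n => ∫⁻ x, ENNReal.ofReal (|w n x| ^ q)) atTop :=
        lintegral_liminf_le' fun n => ((Real.continuous_rpow_const
          (by linarith)).comp_aestronglyMeasurable (continuous_abs.comp_aestronglyMeasurable
            (hwm n))).aemeasurable.ennreal_ofReal
      _ ≤ ENNReal.ofReal T := by
        refine (liminf_le_liminf (Eventually.of_forall hwT)).trans ?_
        simp
  have hint : Integrable (fun x => |u x| ^ q) :=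
    ⟨hqm, (hasFiniteIntegral_iff_ofReal (Eventually.of_forall fun x => by positivity)).2
      (hfatou.trans_lt ENNReal.ofReal_lt_top)⟩
  refine ⟨hint, ?_⟩
  rw [← ofReal_integral_eq_lintegral_ofReal hint (Eventually.of_forall fun x => by positivity)]
    at hfatou
  exact (ENNReal.ofReal_le_ofReal_iff hT0).1 hfatou

end Sobolev

/-! ### Completeness, translations and local compactness of `H^s`. -/

namespace FracSobolev

variable {N : ℕ} {s : ℝ}

/-- The element of `H^s` given by a square integrable function of finite seminorm. -/
noncomputable def ofFun (u : RN N → ℝ) (hu : MemLp u 2 volume)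
    (hk : Integrable (gagliardoKernel s u u)) : FracSobolev N s :=
  ⟨hu.toLp u, hk.congr (gagliardoKernel_congr s hu.coeFn_toLp hu.coeFn_toLp).symm⟩

theorem coe_ofFun (u : RN N → ℝ) (hu : MemLp u 2 volume)
    (hk : Integrable (gagliardoKernel s u u)) : ⇑(toL2 (ofFun u hu hk)) =ᵐ[volume] u :=
  hu.coeFn_toLp

theorem memLp (u : FracSobolev N s) : MemLp u 2 volume := Lp.memLp _

theorem aesm (u : FracSobolev N s) : AEStronglyMeasurable u volume := (memLp u).1

theorem coe_sub (u v : FracSobolev N s) : ⇑(toL2 (u - v)) =ᵐ[volume] ⇑(toL2 u) - ⇑(toL2 v) := by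
  rw [map_sub]; exact Lp.coeFn_sub _ _

theorem coe_add (u v : FracSobolev N s) : ⇑(toL2 (u + v)) =ᵐ[volume] ⇑(toL2 u) + ⇑(toL2 v) := by
  rw [map_add]; exact Lp.coeFn_add _ _

theorem coe_smul (c : ℝ) (u : FracSobolev N s) : ⇑(toL2 (c • u)) =ᵐ[volume] c • ⇑(toL2 u) := by
  rw [map_smul]; exact Lp.coeFn_smul _ _

theorem gagliardoForm_congr {u u' v v' : RN N → ℝ}
    (hu : u =ᵐ[volume] u') (hv : v =ᵐ[volume] v') :
    gagliardoForm s u v = gagliardoForm s u' v' :=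
  integral_congr_ae (gagliardoKernel_congr s hu hv)

theorem inner_eq (u v : FracSobolev N s) :
    inner ℝ u v = gagliardoForm s u v + ∫ x, u x * v x := rfl

theorem norm_sq_eq (u : FracSobolev N s) :
    ‖u‖ ^ 2 = gagliardoForm s u u + ∫ x, u x ^ 2 := by
  rw [norm_eq, Real.sq_sqrt]
  exact add_nonneg (gagliardoForm_self_nonneg _) (integral_nonneg fun x => sq_nonneg _)

theorem norm_toL2_sq (u : FracSobolev N s) : ‖toL2 u‖ ^ 2 = ∫ x, u x ^ 2 := by
  rw [← real_inner_self_eq_norm_sq, ← integral_mul_eq_inner]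
  simp only [sq]

theorem norm_sq_eq' (u : FracSobolev N s) :
    ‖u‖ ^ 2 = gagliardoForm s u u + ‖toL2 u‖ ^ 2 := by
  rw [norm_sq_eq, norm_toL2_sq]

theorem integral_sq_le (u : FracSobolev N s) : ∫ x, u x ^ 2 ≤ ‖u‖ ^ 2 := by
  have := gagliardoForm_self_nonneg (s := s) ⇑(toL2 u)
  rw [norm_sq_eq]; linarith

theorem gagliardoForm_le (u : FracSobolev N s) : gagliardoForm s u u ≤ ‖u‖ ^ 2 := by
  have : 0 ≤ ∫ x, u x ^ 2 := integral_nonneg fun x => sq_nonneg _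
  rw [norm_sq_eq]; linarith

theorem norm_toL2_le (u : FracSobolev N s) : ‖toL2 u‖ ≤ ‖u‖ := by
  have := integral_sq_le u
  rw [← norm_toL2_sq] at this
  exact le_of_sq_le_sq this (norm_nonneg _)

/-- The inclusion of `H^s` in `L²` as a continuous linear map. -/
noncomputable def toL2L : FracSobolev N s →L[ℝ] Lp ℝ 2 (volume : Measure (RN N)) :=
  LinearMap.mkContinuous toL2 1 fun u => by simpa using norm_toL2_le u

/-- Fatou's lemma for the Gagliardo seminorm. -/
theorem gagliardo_fatou {w : ℕ → RN N → ℝ} {v : RN N → ℝ} {C : ℝ} (hC : 0 ≤ C)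
    (hw : ∀ n, AEStronglyMeasurable (w n) volume) (hv : AEStronglyMeasurable v volume)
    (hwk : ∀ n, Integrable (gagliardoKernel s (w n) (w n)))
    (hlim : ∀ᵐ x, Tendsto (fun n => w n x) atTop (𝓝 (v x)))
    (hbd : ∀ᶠ n in atTop, gagliardoForm s (w n) (w n) ≤ C) :
    Integrable (gagliardoKernel s v v) ∧ gagliardoForm s v v ≤ C := by
  have hlim2 : ∀ᵐ p : RN N × RN N,
      Tendsto (fun n => gagliardoKernel s (w n) (w n) p) atTop (𝓝 (gagliardoKernel s v v p)) := by
    have h1 := (Measure.quasiMeasurePreserving_fst (μ := (volume : Measure (RN N)))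
      (ν := (volume : Measure (RN N)))).ae hlim
    have h2 := (Measure.quasiMeasurePreserving_snd (μ := (volume : Measure (RN N)))
      (ν := (volume : Measure (RN N)))).ae hlim
    rw [← Measure.volume_eq_prod] at h1 h2
    filter_upwards [h1, h2] with p p1 p2
    exact ((p1.sub p2).mul (p1.sub p2)).div_const _
  have hfatou : ∫⁻ p, ENNReal.ofReal (gagliardoKernel s v v p) ≤ ENNReal.ofReal C := by
    calc ∫⁻ p, ENNReal.ofReal (gagliardoKernel s v v p)
        = ∫⁻ p, liminf (fun n => ENNReal.ofReal (gagliardoKernel s (w n) (w n) p)) atTop := by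
          refine lintegral_congr_ae ?_
          filter_upwards [hlim2] with p hp
          exact ((ENNReal.continuous_ofReal.tendsto _).comp hp).liminf_eq.symm
      _ ≤ liminf (fun n => ∫⁻ p, ENNReal.ofReal (gagliardoKernel s (w n) (w n) p)) atTop :=
          lintegral_liminf_le' fun n =>
            (gagliardoKernel_aestronglyMeasurable s (hw n) (hw n)).aemeasurable.ennreal_ofReal
      _ ≤ liminf (fun _ : ℕ => ENNReal.ofReal C) atTop := by
          refine liminf_le_liminf ?_
          filter_upwards [hbd] with n hn
          rw [← ofReal_integral_eq_lintegral_ofReal (hwk n)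
            (Eventually.of_forall fun p => gagliardoKernel_self_nonneg _ _)]
          exact ENNReal.ofReal_le_ofReal hn
      _ = ENNReal.ofReal C := by simp
  have hint : Integrable (gagliardoKernel s v v) :=
    ⟨gagliardoKernel_aestronglyMeasurable s hv hv, (hasFiniteIntegral_iff_ofReal
      (Eventually.of_forall fun p => gagliardoKernel_self_nonneg _ _)).2
      (hfatou.trans_lt ENNReal.ofReal_lt_top)⟩
  refine ⟨hint, ?_⟩
  rw [← ofReal_integral_eq_lintegral_ofReal hint
    (Eventually.of_forall fun p => gagliardoKernel_self_nonneg _ _)] at hfatou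
  exact (ENNReal.ofReal_le_ofReal_iff hC).1 hfatou

/-- The limit is taken in `L²`. Along an almost everywhere convergent subsequence, Fatou's lemma
applied to `u (φ n) - u m` shows both that the limit has finite seminorm and that it is approached
in the seminorm. -/
instance : CompleteSpace (FracSobolev N s) := by
  refine Metric.complete_of_cauchySeq_tendsto fun u hu => ?_
  have hL2 : CauchySeq fun n => toL2 (u n) := hu.map toL2L.uniformContinuous
  obtain ⟨w, hw⟩ := cauchySeq_tendsto_of_complete hL2
  obtain ⟨φ, hφ, hae⟩ := (tendstoInMeasure_of_tendsto_Lp hw).exists_seq_tendsto_ae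
  have hwm : AEStronglyMeasurable w volume := Lp.aestronglyMeasurable w
  have hdiff : ∀ m, ∀ ε > 0, (∀ n ≥ m, dist (u n) (u m) ≤ ε) →
      Integrable (gagliardoKernel s (⇑w - ⇑(toL2 (u m))) (⇑w - ⇑(toL2 (u m)))) ∧
      gagliardoForm s (⇑w - ⇑(toL2 (u m))) (⇑w - ⇑(toL2 (u m))) ≤ ε ^ 2 := by
    intro m ε hε h
    refine gagliardo_fatou (w := fun n => toL2 (u (φ n) - u m)) (by positivity)
      (fun n => aesm _) (hwm.sub (aesm _)) (fun n => integrable_kernel _ _) ?_ ?_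
    · filter_upwards [hae, ae_all_iff.2 fun n => coe_sub (u (φ n)) (u m)] with x hx hx'
      simp only [hx', Pi.sub_apply]
      exact hx.sub tendsto_const_nhds
    · filter_upwards [eventually_ge_atTop m] with n hn
      have h1 := h (φ n) (hn.trans hφ.le_apply)
      rw [dist_eq_norm] at h1
      exact (gagliardoForm_le _).trans (by gcongr)
  obtain ⟨m₁, hm₁⟩ := Metric.cauchySeq_iff'.1 hu 1 one_pos
  have hwk : Integrable (gagliardoKernel s w w) := by
    have h1 := (hdiff m₁ 1 one_pos fun n hn => (hm₁ n hn).le).1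
    have h2 := (u m₁).property
    have hd : MemLp (⇑w - ⇑(toL2 (u m₁))) 2 volume := (Lp.memLp w).sub (memLp _)
    have h3 := (ofFun _ hd h1 + u m₁).property
    refine h3.congr (gagliardoKernel_congr s ?_ ?_) <;>
    · refine (coe_add _ _).trans ?_
      filter_upwards [coe_ofFun _ hd h1] with x hx
      simp [hx]
  let v : FracSobolev N s := ⟨w, hwk⟩
  have hv : toL2 v = w := rfl
  refine ⟨v, ?_⟩
  rw [Metric.tendsto_atTop]
  intro ε hε
  obtain ⟨m₀, hm₀⟩ := Metric.cauchySeq_iff.1 hu (ε / 2) (by positivity)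
  obtain ⟨m₂, hm₂⟩ := Metric.tendsto_atTop.1 hw (ε / 2) (by positivity)
  refine ⟨max m₀ m₂, fun m hm => ?_⟩
  have h1 := (hdiff m (ε / 2) (by positivity) fun n hn =>
    (hm₀ n (by omega) m (by omega)).le).2
  have h2 := hm₂ m (by omega)
  rw [dist_comm, dist_eq_norm] at h2 ⊢
  have h3 := norm_sq_eq' (v - u m)
  rw [gagliardoForm_congr (coe_sub v (u m)) (coe_sub v (u m)), map_sub, hv] at h3
  have h4 : ‖w - toL2 (u m)‖ ^ 2 ≤ (ε / 2) ^ 2 := by gcongr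
  refine lt_of_pow_lt_pow_left₀ 2 hε.le ?_
  nlinarith

/-- Translation `u ↦ u (· + z)`. -/
noncomputable def shift (z : RN N) (u : FracSobolev N s) : FracSobolev N s :=
  ofFun (fun x => u (x + z)) ((memLp u).comp_measurePreserving (measurePreserving_add_right _ z))
    (by
      have : (volume : Measure (RN N × RN N)).IsAddRightInvariant := by
        rw [Measure.volume_eq_prod]; infer_instance
      have h := (integrable_kernel u u).comp_add_right ((z, z) : RN N × RN N)
      refine h.congr (Eventually.of_forall fun p => ?_)
      simp [gagliardoKernel])

theorem coe_shift (z : RN N) (u : FracSobolev N s) :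
    ⇑(toL2 (shift z u)) =ᵐ[volume] fun x => u (x + z) := coe_ofFun _ _ _

theorem gagliardoForm_shift (z : RN N) (u v : FracSobolev N s) :
    gagliardoForm s (shift z u) (shift z v) = gagliardoForm s u v := by
  have : (volume : Measure (RN N × RN N)).IsAddRightInvariant := by
    rw [Measure.volume_eq_prod]; infer_instance
  rw [gagliardoForm_congr (coe_shift z u) (coe_shift z v)]
  unfold gagliardoForm
  rw [← integral_add_right_eq_self (gagliardoKernel s u v) ((z, z) : RN N × RN N)]
  simp [gagliardoKernel]

theorem norm_shift (z : RN N) (u : FracSobolev N s) : ‖shift z u‖ = ‖u‖ := by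
  have h : ∫ x, shift z u x ^ 2 = ∫ x, u x ^ 2 := by
    rw [← integral_add_right_eq_self (fun x => u x ^ 2) z]
    refine integral_congr_ae ?_
    filter_upwards [coe_shift z u] with x hx
    rw [hx]
  rw [norm_eq, norm_eq, gagliardoForm_shift, h]

theorem shift_shift_neg (z : RN N) (u : FracSobolev N s) :
    shift z (shift (-z) u) = u := by
  refine toL2_injective (Lp.ext ?_)
  have h := (measurePreserving_add_right (volume : Measure (RN N)) z).quasiMeasurePreserving.ae
    (coe_shift (-z) u)
  filter_upwards [coe_shift z (shift (-z) u), h] with x hx hx'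
  rw [hx, hx', add_neg_cancel_right]

/-- Local compactness: weakly null sequences of `H^s` tend to zero in `L²` of balls. -/
theorem tendsto_setIntegral_sq_of_weakly_null (hs : 0 < s) {u : ℕ → FracSobolev N s} {R : ℝ}
    (hb : ∀ n, ‖u n‖ ≤ R) (hw : ∀ v, Tendsto (fun n => inner ℝ (u n) v) atTop (𝓝 0)) (ρ : ℝ) :
    Tendsto (fun n => ∫ x in Metric.ball (0 : RN N) ρ, u n x ^ 2) atTop (𝓝 0) := by
  have hR : 0 ≤ R := (norm_nonneg _).trans (hb 0)
  set K := Metric.ball (0 : RN N) ρ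
  have hKfin : IsFiniteMeasure (volume.restrict K) :=
    ⟨by simpa using (measure_ball_lt_top (μ := (volume : Measure (RN N))) (x := 0) (r := ρ))⟩
  set ω := volume.real (Metric.ball (0 : RN N) 1) with hω
  have hωpos : 0 < ω := volume_real_ball_pos _ one_pos
  -- Testing with indicators of balls makes the averages tend to zero at each centre; Cauchy-Schwarz
  -- bounds them uniformly, so their squares have vanishing integral over `K`.
  have hweak : ∀ x r, Tendsto (fun n => ∫ y in Metric.ball x r, u n y) atTop (𝓝 0) := by
    intro x r
    let g : Lp ℝ 2 (volume : Measure (RN N)) :=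
      indicatorConstLp 2 (measurableSet_ball (x := x) (ε := r)) measure_ball_lt_top.ne 1
    let ℓ : StrongDual ℝ (FracSobolev N s) := (innerSL ℝ g).comp toL2L
    refine (hw ((InnerProductSpace.toDual ℝ _).symm ℓ)).congr fun n => ?_
    rw [real_inner_comm, InnerProductSpace.toDual_symm_apply]
    exact L2.inner_indicatorConstLp_one _ _ _
  have havg_meas : ∀ n r, StronglyMeasurable fun x => ∫ y in Metric.ball x r, u n y := by
    intro n r
    have h1 : StronglyMeasurable (Function.uncurry fun x y : RN N =>
        (Metric.ball x r).indicator (⇑(toL2 (u n))) y) := by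
      have : (Function.uncurry fun x y : RN N => (Metric.ball x r).indicator (⇑(toL2 (u n))) y)
          = {p : RN N × RN N | dist p.2 p.1 < r}.indicator (fun p => toL2 (u n) p.2) := by
        ext p
        simp [Function.uncurry, Set.indicator]
      rw [this]
      refine StronglyMeasurable.indicator ?_ ?_
      · exact (Lp.stronglyMeasurable (toL2 (u n))).comp_measurable measurable_snd
      · exact (isOpen_lt (by fun_prop) continuous_const).measurableSet
    have h2 := h1.integral_prod_right (ν := volume)
    simpa only [integral_indicator measurableSet_ball] using h2
  have hT : ∀ r, 0 < r →
      Tendsto (fun n => ∫ x in K, (∫ y in Metric.ball x r, u n y) ^ 2) atTop (𝓝 0) ∧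
      ∀ n, IntegrableOn (fun x => (∫ y in Metric.ball x r, u n y) ^ 2) K := by
    intro r hr
    have hbound : ∀ n x, ‖(∫ y in Metric.ball x r, u n y) ^ 2‖ ≤ r ^ (N : ℝ) * ω * R ^ 2 := by
      intro n x
      have hBfin : volume (Metric.ball x r) ≠ ⊤ := measure_ball_lt_top.ne
      have : IsFiniteMeasure (volume.restrict (Metric.ball x r)) :=
        ⟨by simpa using hBfin.lt_top⟩
      have huB : MemLp (u n) 2 (volume.restrict (Metric.ball x r)) := (memLp (u n)).restrict _
      have h1 := sq_setIntegral_le hBfin (huB.integrable (by norm_num)) huB.integrable_sq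
      rw [volume_real_ball_eq x hr] at h1
      rw [Real.norm_of_nonneg (sq_nonneg _)]
      refine h1.trans (mul_le_mul_of_nonneg_left ?_ (by positivity))
      have h2 := setIntegral_le_integral (s := Metric.ball x r) (memLp (u n)).integrable_sq
        (Eventually.of_forall fun y => sq_nonneg _)
      have h3 := integral_sq_le (u n)
      have h4 : ‖u n‖ ^ 2 ≤ R ^ 2 := by gcongr; exact hb n
      linarith
    have hm : ∀ n, AEStronglyMeasurable (fun x => (∫ y in Metric.ball x r, u n y) ^ 2)
        (volume.restrict K) := fun n => ((havg_meas n r).pow 2).aestronglyMeasurable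
    constructor
    · have := tendsto_integral_of_dominated_convergence (μ := volume.restrict K)
        (f := fun _ => (0 : ℝ)) (fun _ => r ^ (N : ℝ) * ω * R ^ 2) hm (integrable_const _)
        (fun n => Eventually.of_forall (hbound n))
        (Eventually.of_forall fun x => by simpa using (hweak x r).pow 2)
      simpa using this
    · exact fun n => (integrable_const _).mono' (hm n) (Eventually.of_forall (hbound n))
  -- The distance of `u n` from its averages at scale `r` is of order `r ^ s` in `L²`, uniformly in
  -- `n`. So `r` is fixed before `n` grows, as in Rellich's theorem.
  have hest : ∀ r, 0 < r → ∀ n, ∫ x in K, u n x ^ 2 ≤ 2 * (r ^ (2 * s) * R ^ 2) / ω +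
      2 / (r ^ (N : ℝ) * ω) ^ 2 * ∫ x in K, (∫ y in Metric.ball x r, u n y) ^ 2 := by
    intro r hr n
    set m := r ^ (N : ℝ) * ω with hm
    have hrN : 0 < r ^ (N : ℝ) := by positivity
    have hmpos : 0 < m := by positivity
    have hk := integrable_kernel (u n) (u n)
    have hDint := integrable_gagliardoDensity hk
    have h1 : ∀ᵐ x ∂(volume.restrict K), u n x ^ 2 ≤
        2 * r ^ (2 * s) / ω * gagliardoDensity s (u n) x
          + 2 / m ^ 2 * (∫ y in Metric.ball x r, u n y) ^ 2 := by
      refine ae_restrict_of_ae ?_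
      filter_upwards [ae_integrable_gagliardoKernel hk] with x hx
      have h2 := sq_volume_mul_le hs (memLp (u n)) hx hr
      rw [volume_real_ball_eq x hr, ← hω, ← hm, Real.rpow_add hr] at h2
      refine le_of_mul_le_mul_left ?_ (show 0 < m ^ 2 by positivity)
      have e : m ^ 2 * (2 * r ^ (2 * s) / ω * gagliardoDensity s (u n) x
          + 2 / m ^ 2 * (∫ y in Metric.ball x r, u n y) ^ 2)
          = 2 * (m * (r ^ (N : ℝ) * r ^ (2 * s) * gagliardoDensity s (u n) x)) +
            2 * (∫ y in Metric.ball x r, u n y) ^ 2 := by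
        rw [hm]; field_simp
      rw [e]
      linarith
    have h3 := integral_mono_ae (memLp (u n)).integrable_sq.integrableOn
      ((hDint.integrableOn.const_mul _).add (((hT r hr).2 n).const_mul _)) h1
    simp only [Pi.add_apply] at h3
    rw [integral_add (hDint.integrableOn.const_mul _) (((hT r hr).2 n).const_mul _),
      integral_const_mul, integral_const_mul] at h3
    have h4 : ∫ x in K, gagliardoDensity s (u n) x ≤ R ^ 2 := by
      have h5 := setIntegral_le_integral (s := K) hDint
        (Eventually.of_forall fun y => gagliardoDensity_nonneg (u n) y)
      rw [integral_gagliardoDensity hk] at h5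
      have h6 := gagliardoForm_le (u n)
      have h7 : ‖u n‖ ^ 2 ≤ R ^ 2 := by gcongr; exact hb n
      linarith
    have h8 : 2 * r ^ (2 * s) / ω * ∫ x in K, gagliardoDensity s (u n) x
        ≤ 2 * r ^ (2 * s) / ω * R ^ 2 := by gcongr
    have e : 2 * r ^ (2 * s) / ω * R ^ 2 = 2 * (r ^ (2 * s) * R ^ 2) / ω := by ring
    linarith
  rw [Metric.tendsto_atTop]
  intro ε hε
  have hlim : Tendsto (fun r : ℝ => 2 * (r ^ (2 * s) * R ^ 2) / ω) (𝓝[>] 0) (𝓝 0) := by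
    have hc : Continuous fun r : ℝ => 2 * (r ^ (2 * s) * R ^ 2) / ω := by
      have := Real.continuous_rpow_const (by positivity : 0 ≤ 2 * s)
      fun_prop
    have := hc.tendsto 0
    simp only [Real.zero_rpow (by positivity : 2 * s ≠ 0), zero_mul, mul_zero, zero_div] at this
    exact this.mono_left nhdsWithin_le_nhds
  obtain ⟨r, hr1, hr0⟩ := ((hlim.eventually (gt_mem_nhds (half_pos hε))).and
    self_mem_nhdsWithin).exists
  have h1 := ((hT r hr0).1.const_mul (2 / (r ^ (N : ℝ) * ω) ^ 2))
  rw [mul_zero] at h1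
  obtain ⟨n₀, hn₀⟩ := eventually_atTop.1 (h1.eventually (gt_mem_nhds (half_pos hε)))
  refine ⟨n₀, fun n hn => ?_⟩
  have h2 := hest r hr0 n
  have h3 := hn₀ n hn
  rw [Real.dist_eq, sub_zero, abs_of_nonneg (integral_nonneg fun x => sq_nonneg _)]
  linarith

end FracSobolev

/-! ### Nonzero elements and superlevel sets. -/

namespace FracSobolev

variable {N : ℕ} {s : ℝ}

/-- In polar coordinates the integrand is `r ^ (1 - 2 s)` near zero, integrable because `s < 1`, and
`r ^ (-1 - 2 s)` at infinity, integrable because `s > 0`. -/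
theorem integrable_min_sq_div_rpow (hs0 : 0 < s) (hs1 : s < 1) (hN : 0 < N) :
    Integrable (fun z : RN N => min (‖z‖ ^ 2) 1 / ‖z‖ ^ ((N : ℝ) + 2 * s)) := by
  have : Nontrivial (RN N) := by
    have : Nonempty (Fin N) := ⟨⟨0, hN⟩⟩
    infer_instance
  rw [integrable_fun_norm_addHaar volume
    (f := fun r : ℝ => min (r ^ 2) 1 / r ^ ((N : ℝ) + 2 * s)), finrank_euclideanSpace_fin,
    ← Set.Ioo_union_Ici_eq_Ioi (zero_lt_one (α := ℝ))]
  have hpow : ∀ r : ℝ, 0 < r → r ^ (N - 1) = r ^ ((N : ℝ) - 1) := fun r _ => by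
    rw [← Real.rpow_natCast, Nat.cast_sub hN, Nat.cast_one]
  refine IntegrableOn.union ?_ ?_
  · refine ((intervalIntegral.integrableOn_Ioo_rpow_iff one_pos).2
      (by linarith : -1 < 1 - 2 * s)).congr_fun (fun r hr => ?_) measurableSet_Ioo
    have h0 : 0 < r := hr.1
    have h1 : r ^ 2 ≤ 1 := by nlinarith [hr.2]
    simp only [smul_eq_mul, min_eq_left h1]
    rw [hpow r h0, ← Real.rpow_natCast r 2, ← Real.rpow_sub h0, ← Real.rpow_add h0]
    congr 1
    push_cast
    ring
  · rw [integrableOn_Ici_iff_integrableOn_Ioi]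
    refine (integrableOn_Ioi_rpow_of_lt (by linarith : -1 - 2 * s < -1) one_pos).congr_fun
      (fun r hr => ?_) measurableSet_Ioi
    have h0 : 0 < r := one_pos.trans hr
    have h1 : 1 ≤ r ^ 2 := by nlinarith [Set.mem_Ioi.1 hr]
    simp only [smul_eq_mul, min_eq_right h1]
    rw [hpow r h0, one_div, ← Real.rpow_neg h0.le, ← Real.rpow_add h0]
    congr 1
    ring

/-- A ray is needed for the mountain pass. The tent function is Lipschitz, bounded and supported in
the unit ball, so its kernel is dominated by `h (x - y)` restricted to pairs with a point in that
ball. -/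
theorem exists_ne_zero (hs0 : 0 < s) (hs1 : s < 1) (hN : 0 < N) :
    ∃ u : FracSobolev N s, u ≠ 0 := by
  let u : RN N → ℝ := fun x => max 0 (1 - ‖x‖)
  have huc : Continuous u := by fun_prop
  have hu0 : ∀ x, 0 ≤ u x := fun x => le_max_left _ _
  have hu1 : ∀ x, u x ≤ 1 := fun x => max_le zero_le_one (by linarith [norm_nonneg x])
  set B := Metric.closedBall (0 : RN N) 1
  have huB : ∀ x, x ∉ B → u x = 0 := fun x hx => by
    have : 1 < ‖x‖ := by simpa [B] using hx
    exact max_eq_left (by linarith)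
  have hcs : HasCompactSupport u :=
    HasCompactSupport.intro (isCompact_closedBall _ _) huB
  have hu2 : MemLp u 2 volume := huc.memLp_of_hasCompactSupport hcs
  set h : RN N → ℝ := fun z => min (‖z‖ ^ 2) 1 / ‖z‖ ^ ((N : ℝ) + 2 * s) with hh
  have hh0 : ∀ z, 0 ≤ h z := fun z => by positivity
  have hint : Integrable h := integrable_min_sq_div_rpow hs0 hs1 hN
  have hBint : Integrable (B.indicator fun _ => (1 : ℝ)) :=
    (integrable_indicator_iff measurableSet_closedBall).2
      (integrableOn_const (hs := measure_closedBall_lt_top.ne))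
  have h1 := hBint.convolution_integrand (ContinuousLinearMap.mul ℝ ℝ) hint
  have h2 := h1.swap
  rw [← Measure.volume_eq_prod] at h1 h2
  have hk : Integrable (gagliardoKernel s u u) := by
    refine (h1.add h2).mono' (gagliardoKernel_aestronglyMeasurable s
      huc.aestronglyMeasurable huc.aestronglyMeasurable) (Eventually.of_forall fun p => ?_)
    obtain ⟨x, y⟩ := p
    rw [Real.norm_of_nonneg (gagliardoKernel_self_nonneg _ _)]
    simp only [Pi.add_apply, Function.comp_apply, Prod.swap, ContinuousLinearMap.mul_apply']
    have hsym : h (y - x) = h (x - y) := by simp only [hh, norm_sub_rev y x]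
    have hB0 : ∀ z, 0 ≤ B.indicator (fun _ => (1 : ℝ)) z := fun z =>
      Set.indicator_nonneg (fun _ _ => zero_le_one) z
    rw [hsym]
    by_cases hxy : x ∈ B ∨ y ∈ B
    · have hle : 1 ≤ B.indicator (fun _ => (1 : ℝ)) y + B.indicator (fun _ => (1 : ℝ)) x := by
        rcases hxy with hx | hy
        · rw [Set.indicator_of_mem hx]; linarith [hB0 y]
        · rw [Set.indicator_of_mem hy]; linarith [hB0 x]
      have hkh : gagliardoKernel s u u (x, y) ≤ h (x - y) := by
        simp only [gagliardoKernel, hh]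
        gcongr
        refine le_min ?_ ?_
        · rw [← sq, sq_le_sq, abs_norm]
          have := abs_max_sub_max_le_max 0 (1 - ‖x‖) 0 (1 - ‖y‖)
          refine this.trans ?_
          rw [sub_self, abs_zero, max_eq_right (abs_nonneg _)]
          have e : 1 - ‖x‖ - (1 - ‖y‖) = ‖y‖ - ‖x‖ := by ring
          rw [e, norm_sub_rev]
          exact abs_norm_sub_norm_le _ _
        · rw [← sq, sq_le_one_iff_abs_le_one, abs_le]
          constructor <;> linarith [hu0 x, hu0 y, hu1 x, hu1 y]
      nlinarith [hh0 (x - y)]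
    · push Not at hxy
      simp [gagliardoKernel, huB _ hxy.1, huB _ hxy.2, hxy.1, hxy.2]
  refine ⟨ofFun u hu2 hk, fun h0 => ?_⟩
  have hae : u =ᵐ[volume] 0 := by
    refine (coe_ofFun u hu2 hk).symm.trans ?_
    rw [h0, map_zero]
    exact Lp.coeFn_zero _ _ _
  have : u = 0 := huc.ae_eq_iff_eq volume continuous_zero |>.1 hae
  have : u 0 = 0 := congrFun this 0
  simp [u] at this

theorem measure_superlevel_ne_top (u : FracSobolev N s) {δ : ℝ} (hδ : 0 < δ) :
    volume {x | δ ≤ |u x|} ≠ ⊤ := by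
  have h1 := (memLp u).integrable_sq.measure_ge_lt_top (show 0 < δ ^ 2 by positivity)
  refine (lt_of_le_of_lt (measure_mono fun x hx => ?_) h1).ne
  simp only [Set.mem_ofPred_eq] at hx ⊢
  rw [← sq_abs (u x)]
  gcongr

theorem exists_measure_pos {u : FracSobolev N s} (hu : u ≠ 0) :
    ∃ δ > 0, ∃ η > 0, η ≤ volume.real {x | δ ≤ |u x|} := by
  by_contra! hcon
  apply hu
  refine toL2_injective (Lp.ext ?_)
  rw [map_zero]
  refine EventuallyEq.trans ?_ (Lp.coeFn_zero _ _ _).symm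
  have hzero : ∀ n : ℕ, ∀ᵐ x, |u x| < 1 / ((n : ℝ) + 1) := fun n => by
    have hδ : (0 : ℝ) < 1 / ((n : ℝ) + 1) := by positivity
    have h1 : volume.real {x | 1 / ((n : ℝ) + 1) ≤ |u x|} ≤ 0 := by
      by_contra! h2
      exact absurd (hcon _ hδ _ h2) (lt_irrefl _)
    have h3 := (measureReal_eq_zero_iff (measure_superlevel_ne_top u hδ)).1 (le_antisymm h1 measureReal_nonneg)
    rw [ae_iff]
    simpa using h3
  filter_upwards [ae_all_iff.2 hzero] with x hx
  by_contra hne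
  obtain ⟨n, hn⟩ := exists_nat_one_div_lt (abs_pos.2 hne)
  exact absurd (hx n) (not_lt.2 hn.le)

end FracSobolev

/-! ### Lattice translations and reduction to a compact cell. -/

section Lattice

variable {N : ℕ}

/-- The point of `ℝ^N` with the given integer coordinates. -/
noncomputable def latticePoint (k : Fin N → ℤ) : RN N := WithLp.toLp 2 fun i => (k i : ℝ)

theorem latticePoint_eq_sum (k : Fin N → ℤ) :
    latticePoint k = ∑ i, k i • (EuclideanSpace.single i (1 : ℝ) : RN N) := by
  ext j
  simp [latticePoint, Finset.sum_apply, Pi.single_apply]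

/-- The periods form a subgroup, and the coordinate vectors generate the lattice. -/
theorem IsOnePeriodic.add_latticePoint {β : Type*} {g : RN N → β} (hg : IsOnePeriodic g)
    (k : Fin N → ℤ) (x : RN N) : g (x + latticePoint k) = g x := by
  let P : AddSubgroup (RN N) :=
    { carrier := {z | ∀ x, g (x + z) = g x}
      zero_mem' := fun x => by rw [add_zero]
      add_mem' := fun {a b} ha hb x => by rw [← add_assoc, hb, ha]
      neg_mem' := fun {a} ha x => by rw [← ha (x + -a), neg_add_cancel_right] }
  have hmem : latticePoint k ∈ P := by
    rw [latticePoint_eq_sum]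
    exact P.sum_mem fun i _ => P.zsmul_mem (show EuclideanSpace.single i 1 ∈ P from hg i) _
  exact hmem x

/-- Through this, estimates uniform in `x` follow from compactness of one ball. -/
theorem exists_add_latticePoint_mem (x : RN N) :
    ∃ k : Fin N → ℤ, x + latticePoint k ∈ Metric.closedBall (0 : RN N) (√N) := by
  refine ⟨fun i => -⌊x i⌋, ?_⟩
  rw [mem_closedBall_zero_iff, EuclideanSpace.norm_eq]
  refine Real.sqrt_le_sqrt ?_
  calc ∑ i, ‖(x + latticePoint fun i => -⌊x i⌋) i‖ ^ 2 ≤ ∑ _i : Fin N, (1 : ℝ) := by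
        refine Finset.sum_le_sum fun i _ => ?_
        have : (x + latticePoint fun i => -⌊x i⌋) i = Int.fract (x i) := by
          simp only [latticePoint, PiLp.add_apply, Int.cast_neg]
          exact (sub_eq_add_neg _ _).symm
        rw [this, Real.norm_of_nonneg (Int.fract_nonneg _)]
        exact pow_le_one₀ (Int.fract_nonneg _) (Int.fract_lt_one _).le
    _ = N := by simp

end Lattice

/-! ### Growth, approximate Lipschitz continuity and superquadraticity of the nonlinearity. -/

/-- A continuous periodic nonlinearity that is `o(t)` at zero and `o(|t| ^ (q - 1))` at
infinity. -/
structure IsSubcritical {N : ℕ} (q : ℝ) (f : RN N → ℝ → ℝ) : Prop where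
  cont : Continuous (fun p : RN N × ℝ => f p.1 p.2)
  periodic : IsOnePeriodic f
  small : ∀ ε > 0, ∃ δ > 0, ∀ x t, |t| ≤ δ → |f x t| ≤ ε * |t|
  large : ∀ ε > 0, ∃ M > 0, ∀ x t, M ≤ |t| → |f x t| ≤ ε * |t| ^ (q - 1)

section Primitive

variable {N : ℕ} {f : RN N → ℝ → ℝ}

theorem primitiveF_continuous (hf : Continuous (fun p : RN N × ℝ => f p.1 p.2)) :
    Continuous (fun p : RN N × ℝ => primitiveF f p.1 p.2) :=
  intervalIntegral.continuous_parametric_intervalIntegral_of_continuous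
    (f := fun (p : RN N × ℝ) τ => f p.1 τ) (by fun_prop) continuous_snd

theorem continuous_slice (hf : Continuous (fun p : RN N × ℝ => f p.1 p.2)) (x : RN N) :
    Continuous (f x) := by
  have : f x = (fun p : RN N × ℝ => f p.1 p.2) ∘ fun t => (x, t) := rfl
  rw [this]; fun_prop

theorem primitiveF_zero (x : RN N) : primitiveF f x 0 = 0 := by simp [primitiveF]

theorem primitiveF_hasDerivAt (hf : Continuous (fun p : RN N × ℝ => f p.1 p.2)) (x : RN N) (t : ℝ) :
    HasDerivAt (primitiveF f x) (f x t) t :=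
  intervalIntegral.integral_hasDerivAt_right ((continuous_slice hf x).intervalIntegrable _ _)
    ((continuous_slice hf x).stronglyMeasurableAtFilter _ _) (continuous_slice hf x).continuousAt

/-- Serves with `c = 0` for growth bounds and with `c = f x a` for Taylor expansions. -/
theorem abs_primitiveF_sub_le (hf : Continuous (fun p : RN N × ℝ => f p.1 p.2)) (x : RN N)
    {a b c K : ℝ} (h : ∀ τ ∈ Set.uIcc a b, |f x τ - c| ≤ K) :
    |primitiveF f x b - primitiveF f x a - c * (b - a)| ≤ K * |b - a| := by
  have hc := continuous_slice hf x
  have e : primitiveF f x b - primitiveF f x a - c * (b - a) = ∫ τ in a..b, (f x τ - c) := by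
    rw [intervalIntegral.integral_sub (hc.intervalIntegrable _ _) (by simp),
      intervalIntegral.integral_const, primitiveF, primitiveF,
      intervalIntegral.integral_interval_sub_left (hc.intervalIntegrable _ _)
        (hc.intervalIntegrable _ _), smul_eq_mul, mul_comm c]
  rw [e]
  exact intervalIntegral.norm_integral_le_of_norm_le_const
    (f := fun τ => f x τ - c) (C := K) fun τ hτ => h τ (Set.uIoc_subset_uIcc hτ)

theorem abs_le_max_of_mem_uIcc {a b τ : ℝ} (h : τ ∈ Set.uIcc a b) : |τ| ≤ max |a| |b| := by
  rcases Set.mem_uIcc.1 h with h | h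
  · exact abs_le_max_abs_abs h.1 h.2
  · rw [max_comm]; exact abs_le_max_abs_abs h.1 h.2

theorem abs_primitiveF_le (hf : Continuous (fun p : RN N × ℝ => f p.1 p.2)) (x : RN N)
    {t K : ℝ} (h : ∀ τ, |τ| ≤ |t| → |f x τ| ≤ K) : |primitiveF f x t| ≤ K * |t| := by
  have := abs_primitiveF_sub_le hf x (a := 0) (b := t) (c := 0) (K := K) fun τ hτ => by
    rw [sub_zero]
    refine h τ ((abs_le_max_of_mem_uIcc hτ).trans ?_)
    simp
  simpa [primitiveF_zero] using this

end Primitive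

namespace IsSubcritical

variable {N : ℕ} {q : ℝ} {f : RN N → ℝ → ℝ}

theorem exists_bound (hf : IsSubcritical q f) (M : ℝ) :
    ∃ C ≥ 0, ∀ x t, |t| ≤ M → |f x t| ≤ C := by
  obtain ⟨C, hC⟩ := ((isCompact_closedBall (0 : RN N) (√N)).prod
    (isCompact_Icc (a := -M) (b := M))).exists_bound_of_continuousOn hf.cont.continuousOn
  refine ⟨max C 0, le_max_right _ _, fun x t ht => ?_⟩
  obtain ⟨k, hk⟩ := exists_add_latticePoint_mem x
  rw [← hf.periodic.add_latticePoint k x]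
  exact (hC (x + latticePoint k, t) ⟨hk, abs_le.1 ht⟩).trans (le_max_left _ _)

theorem exists_modulus (hf : IsSubcritical q f) (M : ℝ) {ε : ℝ} (hε : 0 < ε) :
    ∃ ρ > 0, ∀ x a b, |a| ≤ M → |b| ≤ M → |b - a| ≤ ρ → |f x b - f x a| ≤ ε := by
  have hu := ((isCompact_closedBall (0 : RN N) (√N)).prod
    (isCompact_Icc (a := -M) (b := M))).uniformContinuousOn_of_continuous hf.cont.continuousOn
  obtain ⟨ρ, hρ, h⟩ := Metric.uniformContinuousOn_iff.1 hu ε hε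
  refine ⟨ρ / 2, by positivity, fun x a b ha hb hab => ?_⟩
  obtain ⟨k, hk⟩ := exists_add_latticePoint_mem x
  rw [← hf.periodic.add_latticePoint k x]
  have := h (x + latticePoint k, b) ⟨hk, abs_le.1 hb⟩ (x + latticePoint k, a) ⟨hk, abs_le.1 ha⟩
    (by rw [Prod.dist_eq, dist_self, max_eq_right dist_nonneg, Real.dist_eq]; linarith)
  rw [Real.dist_eq] at this
  exact this.le

theorem exists_growth_add (hf : IsSubcritical q f) {ε : ℝ} (hε : 0 < ε) :
    ∃ δ > 0, ∃ C ≥ 0, (∀ x t, |t| ≤ δ → |f x t| ≤ ε * |t|) ∧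
      ∀ x t, |f x t| ≤ ε * |t| ^ (q - 1) + C := by
  obtain ⟨δ, hδ, h1⟩ := hf.small ε hε
  obtain ⟨M, hM, h2⟩ := hf.large ε hε
  obtain ⟨C, hC, h3⟩ := hf.exists_bound M
  refine ⟨δ, hδ, C, hC, h1, fun x t => ?_⟩
  have : 0 ≤ ε * |t| ^ (q - 1) := by positivity
  rcases le_total M |t| with h | h
  · linarith [h2 x t h]
  · linarith [h3 x t h]

/-- The nonlinearity is Lipschitz up to a small critical error. -/
theorem exists_approx_lipschitz (hf : IsSubcritical q f) {ε : ℝ} (hε : 0 < ε) :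
    ∃ C ≥ 0, ∀ x a b, |f x b - f x a| ≤
      ε * (|a| + |b|) + ε * (|a| ^ (q - 1) + |b| ^ (q - 1)) + C * |b - a| := by
  obtain ⟨δ, hδ, h1⟩ := hf.small ε hε
  obtain ⟨M, hM, h2⟩ := hf.large ε hε
  obtain ⟨C, hC, h3⟩ := hf.exists_bound M
  obtain ⟨ρ', hρ', h4⟩ := hf.exists_modulus (M + 1) (show 0 < ε * δ by positivity)
  set ρ := min ρ' 1 with hρ
  have hρ0 : 0 < ρ := by positivity
  have hall : ∀ x t, |f x t| ≤ ε * |t| ^ (q - 1) + C := fun x t => by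
    have : 0 ≤ ε * |t| ^ (q - 1) := by positivity
    rcases le_total M |t| with h | h
    · linarith [h2 x t h]
    · linarith [h3 x t h]
  -- For `|b - a| > ρ` the bounded parts of both values sum to at most `2 * C`, which the Lipschitz
  -- term absorbs. For closer points, either both arguments lie where `f` is already small relative
  -- to its growth, or one lies between `δ` and `M`; then both are below `M + 1` and the modulus `ε
  -- * δ` is at most `ε * (|a| + |b|)`.
  refine ⟨2 * C / ρ, by positivity, fun x a b => ?_⟩
  have pa : 0 ≤ ε * |a| := by positivity
  have pb : 0 ≤ ε * |b| := by positivity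
  have qa : 0 ≤ ε * |a| ^ (q - 1) := by positivity
  have qb : 0 ≤ ε * |b| ^ (q - 1) := by positivity
  have hab : 0 ≤ 2 * C / ρ * |b - a| := by positivity
  have htri := abs_sub (f x b) (f x a)
  rcases le_or_gt |b - a| ρ with h | h
  · have hba : |b| ≤ |a| + ρ := by
      have := abs_sub_abs_le_abs_sub b a; linarith
    have hba' : |a| ≤ |b| + ρ := by
      have := abs_sub_abs_le_abs_sub a b; rw [abs_sub_comm] at this; linarith
    have hρ1 : ρ ≤ 1 := min_le_right _ _
    have hρρ : ρ ≤ ρ' := min_le_left _ _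
    have hmid : ∀ c, δ ≤ c → c ≤ |a| + |b| → ε * δ ≤ ε * |a| + ε * |b| := fun c h1 h2 => by
      rw [← mul_add]; gcongr; linarith
    have hgood : ∀ t, (|t| ≤ δ ∨ M ≤ |t|) → |f x t| ≤ ε * |t| + ε * |t| ^ (q - 1) := by
      intro t ht
      have : 0 ≤ ε * |t| ^ (q - 1) := by positivity
      have : 0 ≤ ε * |t| := by positivity
      rcases ht with ht | ht
      · linarith [h1 x t ht]
      · linarith [h2 x t ht]
    by_cases ha : |a| ≤ δ ∨ M ≤ |a|
    · by_cases hb : |b| ≤ δ ∨ M ≤ |b|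
      · linarith [hgood a ha, hgood b hb]
      · push Not at hb
        have := h4 x a b (by linarith) (by linarith) (by linarith)
        linarith [hmid |b| hb.1.le (by linarith [abs_nonneg a])]
    · push Not at ha
      have := h4 x a b (by linarith) (by linarith) (by linarith)
      linarith [hmid |a| ha.1.le (by linarith [abs_nonneg b])]
  · have : 2 * C ≤ 2 * C / ρ * |b - a| := by
      rw [div_mul_eq_mul_div, le_div_iff₀ hρ0]
      gcongr
    linarith [hall x a, hall x b]

theorem exists_growth (hf : IsSubcritical q f) (hq : 2 < q) {ε : ℝ} (hε : 0 < ε) :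
    ∃ C ≥ 0, (∀ x t, |f x t| ≤ ε * |t| + C * |t| ^ (q - 1)) ∧
      ∀ x t, |primitiveF f x t| ≤ ε * t ^ 2 + C * |t| ^ q := by
  obtain ⟨δ, hδ, C, hC, h1, h2⟩ := hf.exists_growth_add hε
  have key : ∀ x t, |f x t| ≤ ε * |t| + (ε + C / δ ^ (q - 1)) * |t| ^ (q - 1) := by
    intro x t
    have p1 : 0 ≤ ε * |t| := by positivity
    have p2 : 0 ≤ (ε + C / δ ^ (q - 1)) * |t| ^ (q - 1) := by positivity
    rcases le_total |t| δ with h | h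
    · linarith [h1 x t h]
    · have : C ≤ C / δ ^ (q - 1) * |t| ^ (q - 1) := by
        rw [div_mul_eq_mul_div, le_div_iff₀ (by positivity)]
        gcongr
        linarith
      linarith [h2 x t]
  refine ⟨ε + C / δ ^ (q - 1), by positivity, key, fun x t => ?_⟩
  set C' := ε + C / δ ^ (q - 1) with hC'
  have hC'0 : 0 ≤ C' := by positivity
  have := abs_primitiveF_le hf.cont x (t := t) (K := ε * |t| + C' * |t| ^ (q - 1)) fun τ hτ => by
    refine (key x τ).trans ?_
    gcongr
    linarith
  refine this.trans (le_of_eq ?_)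
  have e : |t| ^ q = |t| ^ (q - 1) * |t| := by
    rw [← Real.rpow_add_one' (abs_nonneg t) (by linarith)]; congr 1; ring
  rw [e, ← sq_abs]
  ring

/-- `f(x, t) t` and `F(x, t)` are small up to a bounded error away from `t = 0`. -/
theorem exists_growth_cut (hf : IsSubcritical q f) (hq : 2 < q) {ε : ℝ} (hε : 0 < ε) :
    ∃ δ > 0, ∃ C ≥ 0, ∀ x t,
      |f x t * t| ≤ ε * (t ^ 2 + |t| ^ q) + (if δ ≤ |t| then C else 0) ∧
      |primitiveF f x t| ≤ ε * (t ^ 2 + |t| ^ q) + (if δ ≤ |t| then C else 0) := by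
  obtain ⟨δ, hδ, C, hC, h1, h2⟩ := hf.exists_growth_add hε
  -- The constant comes from Young's inequality `C |t| ≤ ε t² + C² / (4 ε)`.
  refine ⟨δ, hδ, C ^ 2 / (4 * ε), by positivity, fun x t => ?_⟩
  have e : |t| ^ q = |t| ^ (q - 1) * |t| := by
    rw [← Real.rpow_add_one' (abs_nonneg t) (by linarith)]; congr 1; ring
  have hq0 : 0 ≤ |t| ^ q := by positivity
  by_cases h : δ ≤ |t|
  · simp only [if_pos h]
    have hyoung : C * |t| ≤ ε * t ^ 2 + C ^ 2 / (4 * ε) := by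
      rw [← sq_abs t]
      have : ε * |t| ^ 2 + C ^ 2 / (4 * ε) - C * |t| = (2 * ε * |t| - C) ^ 2 / (4 * ε) := by
        field_simp; ring
      have : 0 ≤ (2 * ε * |t| - C) ^ 2 / (4 * ε) := by positivity
      linarith
    have hgoal : (ε * |t| ^ (q - 1) + C) * |t| ≤ ε * (t ^ 2 + |t| ^ q) + C ^ 2 / (4 * ε) := by
      rw [e]; linarith
    constructor
    · rw [abs_mul]
      exact (mul_le_mul_of_nonneg_right (h2 x t) (abs_nonneg t)).trans hgoal
    · refine (abs_primitiveF_le hf.cont x fun τ hτ => (h2 x τ).trans ?_).trans hgoal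
      gcongr
      linarith
  · simp only [if_neg h, add_zero]
    push Not at h
    have hgoal : ε * |t| * |t| ≤ ε * (t ^ 2 + |t| ^ q) := by
      rw [← sq_abs t]; nlinarith
    constructor
    · rw [abs_mul]
      exact (mul_le_mul_of_nonneg_right (h1 x t h.le) (abs_nonneg t)).trans hgoal
    · refine (abs_primitiveF_le hf.cont x fun τ hτ => (h1 x τ (hτ.trans h.le)).trans ?_).trans hgoal
      gcongr

theorem exists_taylor (hf : IsSubcritical q f) (hq : 2 < q) {ε : ℝ} (hε : 0 < ε) :
    ∃ C ≥ 0, ∀ x a b, |primitiveF f x b - primitiveF f x a - f x a * (b - a)| ≤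
      (ε * (2 * |a| + |b|) + ε * (2 * |a| ^ (q - 1) + |b| ^ (q - 1)) + C * |b - a|) * |b - a| := by
  obtain ⟨C, hC, h⟩ := hf.exists_approx_lipschitz hε
  refine ⟨C, hC, fun x a b => abs_primitiveF_sub_le hf.cont x fun τ hτ => (h x a τ).trans ?_⟩
  have h1 := abs_le_max_of_mem_uIcc hτ
  have h2 : |τ| ≤ |a| + |b| := h1.trans (max_le_add_of_nonneg (abs_nonneg _) (abs_nonneg _))
  have h3 : |τ| ^ (q - 1) ≤ |a| ^ (q - 1) + |b| ^ (q - 1) := by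
    have pa : 0 ≤ |a| ^ (q - 1) := by positivity
    have pb : 0 ≤ |b| ^ (q - 1) := by positivity
    rcases le_max_iff.1 h1 with h4 | h4
    · have := Real.rpow_le_rpow (abs_nonneg τ) h4 (by linarith : 0 ≤ q - 1); linarith
    · have := Real.rpow_le_rpow (abs_nonneg τ) h4 (by linarith : 0 ≤ q - 1); linarith
  have h5 : |τ - a| ≤ |b - a| := Set.abs_sub_left_of_mem_uIcc hτ
  have := mul_le_mul_of_nonneg_left h2 hε.le
  have := mul_le_mul_of_nonneg_left h3 hε.le
  have := mul_le_mul_of_nonneg_left h5 hC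
  linarith

theorem primitiveF_periodic (hf : IsSubcritical q f) : IsOnePeriodic (primitiveF f) := by
  intro i x
  funext t
  simp only [primitiveF, hf.periodic i x]

/-- `r ↦ F(x, r t) / r²` is monotone if `G ≥ 0`. -/
theorem primitiveF_mul_sq_le (hf : IsSubcritical q f) (hG : ∀ x t, 0 ≤ jeanjeanG f x t)
    (x : RN N) (t : ℝ) {a b : ℝ} (ha : 0 < a) (hab : a ≤ b) :
    primitiveF f x (a * t) * b ^ 2 ≤ primitiveF f x (b * t) * a ^ 2 := by
  have hb : 0 < b := ha.trans_le hab
  -- `G` is exactly the numerator in the derivative of `F(x, r t) / r²`.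
  have hd : ∀ r : ℝ, 0 < r → HasDerivAt (fun r => primitiveF f x (r * t) / r ^ 2)
      (jeanjeanG f x (r * t) / r ^ 3) r := by
    intro r hr
    have h1 : HasDerivAt (fun r => primitiveF f x (r * t)) (f x (r * t) * t) r := by
      have := (primitiveF_hasDerivAt hf.cont x (r * t)).comp r ((hasDerivAt_id r).mul_const t)
      simpa [Function.comp_def] using this
    have h2 := h1.div (hasDerivAt_pow 2 r) (by positivity)
    refine h2.congr_deriv ?_
    simp only [jeanjeanG]
    field_simp
    ring
  have hmono : MonotoneOn (fun r => primitiveF f x (r * t) / r ^ 2) (Set.Ioi 0) := by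
    refine monotoneOn_of_deriv_nonneg (convex_Ioi 0)
      (fun r hr => (hd r hr).continuousAt.continuousWithinAt)
      (fun r hr => ?_) fun r hr => ?_
    · rw [interior_Ioi] at hr
      exact (hd r hr).differentiableAt.differentiableWithinAt
    · rw [interior_Ioi] at hr
      rw [(hd r hr).deriv]
      have : (0 : ℝ) < r := hr
      have := hG x (r * t)
      positivity
  have := hmono (Set.mem_Ioi.2 ha) (Set.mem_Ioi.2 hb) hab
  simp only at this
  rwa [div_le_div_iff₀ (by positivity) (by positivity)] at this

/-- By monotonicity `F(x, t) ≥ F(x, r t) / r²` for `r ≤ 1`, and the right side tends to zero with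
`r` because `f` is `o(t)` at zero. -/
theorem primitiveF_nonneg (hf : IsSubcritical q f) (hG : ∀ x t, 0 ≤ jeanjeanG f x t)
    (x : RN N) (t : ℝ) : 0 ≤ primitiveF f x t := by
  refine le_of_forall_pos_le_add fun ε hε => ?_
  obtain ⟨δ, hδ, h⟩ := hf.small (ε / (1 + t ^ 2)) (by positivity)
  set r := min 1 (δ / (1 + |t|)) with hr
  have hr0 : 0 < r := by positivity
  have h1 := hf.primitiveF_mul_sq_le hG x t hr0 (min_le_left _ _)
  have hrt : |r * t| ≤ δ := by
    rw [abs_mul, abs_of_pos hr0]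
    calc r * |t| ≤ δ / (1 + |t|) * (1 + |t|) := by
          gcongr
          · exact min_le_right _ _
          · linarith
      _ = δ := by field_simp
  have h2 := abs_primitiveF_le hf.cont x (t := r * t) fun τ hτ =>
    (h x τ (hτ.trans hrt)).trans (mul_le_mul_of_nonneg_left hτ (by positivity))
  have h3 := neg_le_of_abs_le h2
  have h4 : ε / (1 + t ^ 2) * |r * t| * |r * t| ≤ ε * r ^ 2 := by
    rw [mul_assoc, abs_mul_abs_self, div_mul_eq_mul_div, div_le_iff₀ (by positivity)]
    have : 0 ≤ ε * r ^ 2 := by positivity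
    nlinarith
  rw [one_pow, mul_one, one_mul] at h1
  have h5 : 0 ≤ (primitiveF f x t + ε) * r ^ 2 := by linarith
  have h6 := nonneg_of_mul_nonneg_left h5 (by positivity)
  linarith

/-- Superquadraticity at infinity is uniform in `x`, by Dini's argument. -/
theorem exists_superquadratic (hf : IsSubcritical q f) (hG : ∀ x t, 0 ≤ jeanjeanG f x t)
    (hf3 : ∀ x : RN N, Tendsto (fun t : ℝ => primitiveF f x t / |t| ^ 2) (cocompact ℝ) atTop)
    (M : ℝ) : ∃ T > 0, ∀ x t, T ≤ |t| → M * t ^ 2 ≤ primitiveF f x t := by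
  have hFc := primitiveF_continuous hf.cont
  have hloc : ∃ T > 0, ∀ x ∈ Metric.closedBall (0 : RN N) (√N), ∀ t, T ≤ |t| →
      M * t ^ 2 ≤ primitiveF f x t := by
    refine (isCompact_closedBall (0 : RN N) (√N)).induction_on
      (p := fun S => ∃ T > 0, ∀ x ∈ S, ∀ t, T ≤ |t| → M * t ^ 2 ≤ primitiveF f x t) ?_ ?_ ?_ ?_
    · exact ⟨1, one_pos, fun x hx => hx.elim⟩
    · rintro S S' hSS ⟨T, hT, h⟩
      exact ⟨T, hT, fun x hx => h x (hSS hx)⟩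
    · rintro S S' ⟨T, hT, h⟩ ⟨T', hT', h'⟩
      refine ⟨max T T', by positivity, fun x hx t ht => ?_⟩
      rcases hx with hx | hx
      · exact h x hx t ((le_max_left _ _).trans ht)
      · exact h' x hx t ((le_max_right _ _).trans ht)
    · intro x₀ _
      have h1 := (hf3 x₀).eventually (eventually_gt_atTop M)
      rw [← Metric.cobounded_eq_cocompact, ← comap_norm_atTop, eventually_comap] at h1
      obtain ⟨T, hT⟩ := eventually_atTop.1 h1
      set T' := max T 1 with hT'
      have hT'0 : 0 < T' := by positivity
      -- The strict inequality at the two values `±T'` persists for `x` near `x₀` by continuity, and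
      -- monotonicity carries it to every `|t| ≥ T'`.
      have h2 : ∀ σ : ℝ, |σ| = 1 → ∀ᶠ x in 𝓝 x₀, M * T' ^ 2 < primitiveF f x (T' * σ) := by
        intro σ hσ
        have hn : ‖T' * σ‖ = T' := by rw [norm_mul, Real.norm_eq_abs σ, hσ, mul_one,
          Real.norm_of_nonneg hT'0.le]
        have h3 := hT T' (le_max_left _ _) (T' * σ) hn
        rw [← Real.norm_eq_abs, hn, lt_div_iff₀ (by positivity)] at h3
        have hc : Continuous fun x => primitiveF f x (T' * σ) :=
          hFc.comp (by fun_prop : Continuous fun x : RN N => (x, T' * σ))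
        exact hc.continuousAt.eventually (lt_mem_nhds h3)
      refine ⟨{x | M * T' ^ 2 < primitiveF f x (T' * 1) ∧ M * T' ^ 2 < primitiveF f x (T' * (-1))},
        mem_nhdsWithin_of_mem_nhds ((h2 1 (by simp)).and (h2 (-1) (by simp))),
        T', hT'0, fun x hx t ht => ?_⟩
      obtain ⟨σ, hσt, hσ⟩ : ∃ σ : ℝ, t = |t| * σ ∧ M * T' ^ 2 < primitiveF f x (T' * σ) := by
        rcases le_total 0 t with h0 | h0
        · exact ⟨1, by rw [abs_of_nonneg h0, mul_one], hx.1⟩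
        · exact ⟨-1, by rw [abs_of_nonpos h0]; ring, hx.2⟩
      have h4 := hf.primitiveF_mul_sq_le hG x σ hT'0 ht
      rw [← hσt, sq_abs] at h4
      have h5 : M * T' ^ 2 * t ^ 2 ≤ primitiveF f x (T' * σ) * t ^ 2 := by gcongr
      have h6 : (M * t ^ 2) * T' ^ 2 ≤ primitiveF f x t * T' ^ 2 := by linarith
      exact le_of_mul_le_mul_right h6 (by positivity)
  obtain ⟨T, hT, h⟩ := hloc
  refine ⟨T, hT, fun x t ht => ?_⟩
  obtain ⟨k, hk⟩ := exists_add_latticePoint_mem x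
  rw [← hf.primitiveF_periodic.add_latticePoint k x]
  exact h _ hk t ht

end IsSubcritical

/-- The case `θ = 0` of (f4). -/
theorem jeanjeanG_nonneg {N : ℕ} {f : RN N → ℝ → ℝ} {lam : ℝ} (hlam : 1 ≤ lam)
    (h : ∀ (x : RN N) (t θ : ℝ), 0 ≤ θ → θ ≤ 1 → jeanjeanG f x (θ * t) ≤ lam * jeanjeanG f x t)
    (x : RN N) (t : ℝ) : 0 ≤ jeanjeanG f x t := by
  have h0 := h x t 0 le_rfl zero_le_one
  have : jeanjeanG f x 0 = 0 := by simp [jeanjeanG, primitiveF_zero]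
  rw [zero_mul, this] at h0
  exact nonneg_of_mul_nonneg_right h0 (by linarith)

theorem isSubcritical_of_tendstoUniformly {N : ℕ} {q : ℝ} {f : RN N → ℝ → ℝ}
    (hfcont : Continuous (fun p : RN N × ℝ => f p.1 p.2)) (hfper : IsOnePeriodic f)
    (hf1 : TendstoUniformly (fun (t : ℝ) (x : RN N) => f x t / |t| ^ (q - 1))
      (fun _ => 0) (cocompact ℝ))
    (hf2 : TendstoUniformly (fun (t : ℝ) (x : RN N) => f x t / t) (fun _ => 0) (𝓝[≠] 0)) :
    IsSubcritical q f := by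
  refine ⟨hfcont, hfper, fun ε hε => ?_, fun ε hε => ?_⟩
  · have h := Metric.tendstoUniformly_iff.1 hf2 ε hε
    rw [eventually_nhdsWithin_iff, Metric.eventually_nhds_iff] at h
    obtain ⟨δ, hδ, h⟩ := h
    have hne : ∀ x t, t ≠ 0 → |t| < δ → |f x t| ≤ ε * |t| := fun x t ht0 ht => by
      have := h (y := t) (by simpa using ht) ht0 x
      rw [dist_zero_left, norm_div, Real.norm_eq_abs, Real.norm_eq_abs,
        div_lt_iff₀ (abs_pos.2 ht0)] at this
      exact this.le
    refine ⟨δ / 2, by positivity, fun x t ht => ?_⟩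
    rcases eq_or_ne t 0 with rfl | ht0
    -- The punctured limit says nothing at `t = 0`, where the bound demands `f x 0 = 0`; continuity
    -- supplies it.
    · have hc := continuous_slice hfcont x
      have h1 : Tendsto (fun t => |f x t|) (𝓝[≠] 0) (𝓝 |f x 0|) :=
        (hc.abs.tendsto 0).mono_left nhdsWithin_le_nhds
      have h2 : Tendsto (fun t : ℝ => ε * |t|) (𝓝[≠] 0) (𝓝 (ε * |0|)) :=
        ((continuous_const.mul continuous_abs).tendsto 0).mono_left nhdsWithin_le_nhds
      refine le_of_tendsto_of_tendsto h1 h2 ?_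
      filter_upwards [self_mem_nhdsWithin, mem_nhdsWithin_of_mem_nhds (Metric.ball_mem_nhds 0 hδ)]
        with t ht0 ht
      exact hne x t ht0 (by simpa using ht)
    · exact hne x t ht0 (by linarith)
  · have h := Metric.tendstoUniformly_iff.1 hf1 ε hε
    rw [← Metric.cobounded_eq_cocompact, ← comap_norm_atTop, eventually_comap] at h
    obtain ⟨M, hM⟩ := eventually_atTop.1 h
    refine ⟨max M 1, by positivity, fun x t ht => ?_⟩
    have ht0 : 0 < |t| := lt_of_lt_of_le (by positivity) ht
    have := hM |t| ((le_max_left _ _).trans ht) t rfl x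
    rw [dist_zero_left, norm_div, Real.norm_eq_abs,
      Real.norm_of_nonneg (by positivity), div_lt_iff₀ (by positivity)] at this
    exact this.le

/-- The standing assumptions on the potential and the nonlinearity, with the bounds of the
potential normalized so that `α ≤ 1 ≤ β`. -/
structure IsAdmissible {N : ℕ} (s α β : ℝ) (V : RN N → ℝ) (f : RN N → ℝ → ℝ) : Prop where
  s_pos : 0 < s
  s_lt_one : s < 1
  lt_dim : 2 * s < (N : ℝ)
  α_pos : 0 < α
  α_le_one : α ≤ 1
  one_le_β : 1 ≤ β
  V_cont : Continuous V
  le_V : ∀ x, α ≤ V x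
  V_le : ∀ x, V x ≤ β
  V_periodic : IsOnePeriodic V
  subcritical : IsSubcritical (criticalExponent N s) f

/-! ### Sobolev and Hölder estimates for elements of `H^s`. -/

namespace FracSobolev

variable {N : ℕ} {s : ℝ}

theorem exists_integral_rpow_le (hs : 0 < s) (hN : 2 * s < (N : ℝ)) :
    ∃ S > 0, ∀ u : FracSobolev N s, Integrable (fun x => |u x| ^ criticalExponent N s) ∧
      ∫ x, |u x| ^ criticalExponent N s ≤ (S * ‖u‖) ^ criticalExponent N s := by
  have hq := two_lt_criticalExponent hs hN
  set q := criticalExponent N s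
  obtain ⟨S, hS, h⟩ := exists_sobolev_const hs hN
  refine ⟨S ^ (1 / q), by positivity, fun u => ?_⟩
  obtain ⟨h1, h2⟩ := h u (memLp u) (integrable_kernel u u)
  refine ⟨h1, h2.trans ?_⟩
  rw [Real.mul_rpow (by positivity) (norm_nonneg _), ← Real.rpow_mul hS.le,
    one_div_mul_cancel (by linarith), Real.rpow_one]
  gcongr
  have h3 := Real.rpow_le_rpow (gagliardoForm_self_nonneg _) (gagliardoForm_le u)
    (show 0 ≤ q / 2 by linarith)
  refine h3.trans (le_of_eq ?_)
  rw [← Real.rpow_natCast, ← Real.rpow_mul (norm_nonneg _)]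
  congr 1
  push_cast
  ring

theorem integrable_abs_mul_abs (u v : FracSobolev N s) : Integrable fun x => |u x| * |v x| :=
  (memLp u).abs.integrable_mul (memLp v).abs

theorem integral_abs_mul_abs_le (u v : FracSobolev N s) : ∫ x, |u x| * |v x| ≤ ‖u‖ * ‖v‖ := by
  have hI : ∀ w : FracSobolev N s, Integrable fun x => |w x| ^ (2 : ℝ) := fun w => by
    simpa using (memLp w).integrable_sq
  have h := (integral_abs_rpow_mul_abs_le (q := 2) one_lt_two (aesm u) (aesm v) (hI u) (hI v)).2
  have e : ∀ w : FracSobolev N s, (∫ x, |w x| ^ (2 : ℝ)) ^ (1 / 2 : ℝ) ≤ ‖w‖ := fun w => by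
    rw [← Real.sqrt_eq_rpow, Real.sqrt_le_left (norm_nonneg _)]
    simpa using integral_sq_le w
  have e1 : (2 : ℝ) - 1 = 1 := by norm_num
  have e2 : (1 : ℝ) - 1 / 2 = 1 / 2 := by norm_num
  simp only [e1, e2, Real.rpow_one] at h
  have p : 0 ≤ (∫ x, |v x| ^ (2 : ℝ)) ^ (1 / 2 : ℝ) :=
    Real.rpow_nonneg (integral_nonneg fun x => by positivity) _
  exact h.trans (mul_le_mul (e u) (e v) p (norm_nonneg _))

theorem integrable_mul (u v : FracSobolev N s) : Integrable fun x => u x * v x :=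
  (memLp u).integrable_mul (memLp v)

/-- Hölder's inequality with the critical exponent, for a Sobolev constant `S`. -/
theorem integral_rpow_mul_le (hs : 0 < s) (hN : 2 * s < (N : ℝ)) {S : ℝ} (hS : 0 < S)
    (h : ∀ u : FracSobolev N s, Integrable (fun x => |u x| ^ criticalExponent N s) ∧
      ∫ x, |u x| ^ criticalExponent N s ≤ (S * ‖u‖) ^ criticalExponent N s)
    (u v : FracSobolev N s) :
    Integrable (fun x => |u x| ^ (criticalExponent N s - 1) * |v x|) ∧
      ∫ x, |u x| ^ (criticalExponent N s - 1) * |v x|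
        ≤ (S * ‖u‖) ^ (criticalExponent N s - 1) * (S * ‖v‖) := by
  have hq := two_lt_criticalExponent hs hN
  set q := criticalExponent N s
  obtain ⟨h1, h2⟩ := integral_abs_rpow_mul_abs_le (by linarith : 1 < q) (aesm u) (aesm v)
    (h u).1 (h v).1
  have hI : ∀ w : FracSobolev N s, 0 ≤ ∫ x, |w x| ^ q := fun w =>
    integral_nonneg fun x => by positivity
  have hq1 : 1 / q ≤ 1 := by rw [div_le_one (by linarith)]; linarith
  refine ⟨h1, h2.trans (mul_le_mul ?_ ?_ (Real.rpow_nonneg (hI v) _) (by positivity))⟩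
  · refine (Real.rpow_le_rpow (hI u) (h u).2 (by linarith)).trans (le_of_eq ?_)
    rw [← Real.rpow_mul (by positivity)]
    congr 1
    field_simp
  · refine (Real.rpow_le_rpow (hI v) (h v).2 (by positivity)).trans (le_of_eq ?_)
    rw [← Real.rpow_mul (by positivity), mul_one_div_cancel (by linarith), Real.rpow_one]

/-- The bilinear form `∬ (u x - u y) (v x - v y) / |x - y| ^ (N + 2 s) + ∫ V u v`. -/
noncomputable def quadForm (V : RN N → ℝ) (u v : FracSobolev N s) : ℝ :=
  gagliardoForm s u v + ∫ x, V x * u x * v x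

/-- The candidate derivative of the energy at `u` in the direction `v`. -/
noncomputable def energyDeriv (V : RN N → ℝ) (f : RN N → ℝ → ℝ) (u v : FracSobolev N s) : ℝ :=
  quadForm V u v - ∫ x, f x (u x) * v x

theorem quadForm_comm (V : RN N → ℝ) (u v : FracSobolev N s) :
    quadForm V u v = quadForm V v u := by
  unfold quadForm
  rw [gagliardoForm_comm]
  simp only [mul_assoc, mul_comm (toL2 u _)]

end FracSobolev

open FracSobolev

/-! ### The quadratic form and the nonlinear integrals. -/

namespace IsAdmissible

variable {N : ℕ} {s α β : ℝ} {V : RN N → ℝ} {f : RN N → ℝ → ℝ}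

theorem two_lt (h : IsAdmissible s α β V f) : 2 < criticalExponent N s :=
  two_lt_criticalExponent h.s_pos h.lt_dim

theorem exists_sobolev (h : IsAdmissible s α β V f) :
    ∃ S > 0, ∀ u : FracSobolev N s, Integrable (fun x => |u x| ^ criticalExponent N s) ∧
      ∫ x, |u x| ^ criticalExponent N s ≤ (S * ‖u‖) ^ criticalExponent N s :=
  exists_integral_rpow_le h.s_pos h.lt_dim

theorem integrable_V_mul (h : IsAdmissible s α β V f) (u v : FracSobolev N s) :
    Integrable fun x => V x * u x * v x := by
  simp only [mul_assoc]
  refine (integrable_mul u v).bdd_mul (c := β) h.V_cont.aestronglyMeasurable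
    (Eventually.of_forall fun x => ?_)
  rw [Real.norm_of_nonneg (h.α_pos.le.trans (h.le_V x))]
  exact h.V_le x

theorem quadForm_add_left (h : IsAdmissible s α β V f) (u v w : FracSobolev N s) :
    quadForm V (u + v) w = quadForm V u w + quadForm V v w := by
  unfold quadForm
  have e : ∫ x, V x * (u + v) x * w x = (∫ x, V x * u x * w x) + ∫ x, V x * v x * w x := by
    rw [← integral_add (h.integrable_V_mul u w) (h.integrable_V_mul v w)]
    refine integral_congr_ae ?_
    filter_upwards [coe_add u v] with x hx
    rw [hx, Pi.add_apply]; ring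
  rw [gagliardoForm_add_left, e]
  ring

theorem quadForm_smul_left (V : RN N → ℝ) (c : ℝ) (u w : FracSobolev N s) :
    quadForm V (c • u) w = c * quadForm V u w := by
  unfold quadForm
  have e : ∫ x, V x * (c • u) x * w x = c * ∫ x, V x * u x * w x := by
    rw [← integral_const_mul]
    refine integral_congr_ae ?_
    filter_upwards [coe_smul c u] with x hx
    rw [hx, Pi.smul_apply, smul_eq_mul]; ring
  rw [gagliardoForm_smul_left, e]
  ring

theorem quadForm_self (V : RN N → ℝ) (u : FracSobolev N s) :
    quadForm V u u = gagliardoForm s u u + ∫ x, V x * u x ^ 2 := by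
  simp only [quadForm, mul_assoc, sq]

/-- The seminorm has coefficient one in the form, hence the normalization `α ≤ 1`. -/
theorem le_quadForm (h : IsAdmissible s α β V f) (u : FracSobolev N s) :
    α * ‖u‖ ^ 2 ≤ quadForm V u u := by
  have h1 : α * ∫ x, u x ^ 2 ≤ ∫ x, V x * u x * u x := by
    rw [← integral_const_mul]
    refine integral_mono ((memLp u).integrable_sq.const_mul _) (h.integrable_V_mul u u) fun x => ?_
    simp only [mul_assoc, ← sq]
    exact mul_le_mul_of_nonneg_right (h.le_V x) (sq_nonneg _)
  have h2 : α * gagliardoForm s u u ≤ gagliardoForm s u u :=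
    mul_le_of_le_one_left (gagliardoForm_self_nonneg _) h.α_le_one
  rw [norm_sq_eq, quadForm]
  linarith

theorem quadForm_le (h : IsAdmissible s α β V f) (u : FracSobolev N s) :
    quadForm V u u ≤ β * ‖u‖ ^ 2 := by
  have h1 : ∫ x, V x * u x * u x ≤ β * ∫ x, u x ^ 2 := by
    rw [← integral_const_mul]
    refine integral_mono (h.integrable_V_mul u u) ((memLp u).integrable_sq.const_mul _) fun x => ?_
    simp only [mul_assoc, ← sq]
    exact mul_le_mul_of_nonneg_right (h.V_le x) (sq_nonneg _)
  have h2 : gagliardoForm s u u ≤ β * gagliardoForm s u u :=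
    le_mul_of_one_le_left (gagliardoForm_self_nonneg _) h.one_le_β
  rw [norm_sq_eq, quadForm]
  linarith

/-- The form is the inner product of `H^s` plus a perturbation with weight `V - 1`, and `|V - 1| ≤
β`. -/
theorem abs_quadForm_le (h : IsAdmissible s α β V f) (u v : FracSobolev N s) :
    |quadForm V u v| ≤ (1 + β) * (‖u‖ * ‖v‖) := by
  have e : quadForm V u v = inner ℝ u v + ∫ x, (V x - 1) * (u x * v x) := by
    have : ∀ x, (V x - 1) * (u x * v x) = V x * u x * v x - u x * v x := fun x => by ring
    simp only [this]
    rw [integral_sub (h.integrable_V_mul u v) (integrable_mul u v), inner_eq, quadForm]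
    ring
  have h1 : |∫ x, (V x - 1) * (u x * v x)| ≤ β * ∫ x, |u x| * |v x| := by
    rw [← integral_const_mul, ← Real.norm_eq_abs]
    refine norm_integral_le_of_norm_le ((integrable_abs_mul_abs u v).const_mul _)
      (Eventually.of_forall fun x => ?_)
    rw [Real.norm_eq_abs, abs_mul, abs_mul]
    gcongr
    have := h.le_V x
    have := h.V_le x
    have := h.α_pos
    have := h.one_le_β
    exact abs_le.2 ⟨by linarith, by linarith⟩
  have h2 : β * ∫ x, |u x| * |v x| ≤ β * (‖u‖ * ‖v‖) := by
    have := h.one_le_β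
    gcongr
    exact integral_abs_mul_abs_le u v
  rw [e]
  linarith [abs_add_le (inner ℝ u v) (∫ x, (V x - 1) * (u x * v x)), abs_real_inner_le_norm u v]

theorem aesm_comp (h : IsAdmissible s α β V f) (u : FracSobolev N s) :
    AEStronglyMeasurable (fun x => f x (u x)) volume :=
  h.subcritical.cont.comp_aestronglyMeasurable (aestronglyMeasurable_id.prodMk (aesm u))

theorem aesm_primitive (h : IsAdmissible s α β V f) (u : FracSobolev N s) :
    AEStronglyMeasurable (fun x => primitiveF f x (u x)) volume :=
  (primitiveF_continuous h.subcritical.cont).comp_aestronglyMeasurable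
    (aestronglyMeasurable_id.prodMk (aesm u))

/-- `f(x, u) v` is integrable, with a bound linear in `‖v‖`. -/
theorem exists_integral_f_mul_le (h : IsAdmissible s α β V f) (u : FracSobolev N s) :
    ∃ C, ∀ v : FracSobolev N s, Integrable (fun x => f x (u x) * v x) ∧
      |∫ x, f x (u x) * v x| ≤ C * ‖v‖ := by
  obtain ⟨S, hS, hSob⟩ := h.exists_sobolev
  obtain ⟨C, hC, hg, -⟩ := h.subcritical.exists_growth h.two_lt one_pos
  set q := criticalExponent N s
  refine ⟨‖u‖ + C * ((S * ‖u‖) ^ (q - 1) * S), fun v => ?_⟩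
  obtain ⟨hi, hle⟩ := integral_rpow_mul_le h.s_pos h.lt_dim hS hSob u v
  have hbound : Integrable fun x => |u x| * |v x| + C * (|u x| ^ (q - 1) * |v x|) :=
    (integrable_abs_mul_abs u v).add (hi.const_mul C)
  have hpt : ∀ x, ‖f x (u x) * v x‖ ≤ |u x| * |v x| + C * (|u x| ^ (q - 1) * |v x|) := fun x => by
    rw [Real.norm_eq_abs, abs_mul]
    calc |f x (u x)| * |v x| ≤ (1 * |u x| + C * |u x| ^ (q - 1)) * |v x| := by
          gcongr; exact hg x _
      _ = _ := by ring
  refine ⟨hbound.mono' ((h.aesm_comp u).mul (aesm v)) (Eventually.of_forall hpt), ?_⟩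
  rw [← Real.norm_eq_abs]
  refine (norm_integral_le_of_norm_le hbound (Eventually.of_forall hpt)).trans ?_
  rw [integral_add (integrable_abs_mul_abs u v) (hi.const_mul C), integral_const_mul]
  have := integral_abs_mul_abs_le u v
  have := mul_le_mul_of_nonneg_left hle hC
  linarith

theorem integrable_f_mul (h : IsAdmissible s α β V f) (u v : FracSobolev N s) :
    Integrable (fun x => f x (u x) * v x) :=
  ((h.exists_integral_f_mul_le u).choose_spec v).1

theorem exists_integral_growth (h : IsAdmissible s α β V f) {ε : ℝ} (hε : 0 < ε) :
    ∃ C ≥ 0, ∀ u : FracSobolev N s, Integrable (fun x => primitiveF f x (u x)) ∧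
      |∫ x, primitiveF f x (u x)| ≤ ε * ‖u‖ ^ 2 + C * ‖u‖ ^ criticalExponent N s ∧
      |∫ x, f x (u x) * u x| ≤ ε * ‖u‖ ^ 2 + C * ‖u‖ ^ criticalExponent N s := by
  obtain ⟨S, hS, hSob⟩ := h.exists_sobolev
  obtain ⟨C, hC, hf, hF⟩ := h.subcritical.exists_growth h.two_lt hε
  have hq := h.two_lt
  set q := criticalExponent N s
  refine ⟨C * S ^ q, by positivity, fun u => ?_⟩
  have hbound : Integrable fun x => ε * u x ^ 2 + C * |u x| ^ q :=
    ((memLp u).integrable_sq.const_mul _).add ((hSob u).1.const_mul C)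
  have hint : ∫ x, (ε * u x ^ 2 + C * |u x| ^ q) ≤ ε * ‖u‖ ^ 2 + C * S ^ q * ‖u‖ ^ q := by
    rw [integral_add ((memLp u).integrable_sq.const_mul _) ((hSob u).1.const_mul C),
      integral_const_mul, integral_const_mul, mul_assoc, ← Real.mul_rpow hS.le (norm_nonneg _)]
    have := integral_sq_le u
    have := (hSob u).2
    gcongr
  have hpt : ∀ x, ‖f x (u x) * u x‖ ≤ ε * u x ^ 2 + C * |u x| ^ q := fun x => by
    rw [Real.norm_eq_abs, abs_mul]
    have e : |u x| ^ q = |u x| ^ (q - 1) * |u x| := by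
      rw [← Real.rpow_add_one' (abs_nonneg _) (by linarith)]; congr 1; ring
    calc |f x (u x)| * |u x| ≤ (ε * |u x| + C * |u x| ^ (q - 1)) * |u x| := by
          gcongr; exact hf x _
      _ = _ := by rw [e, ← sq_abs]; ring
  exact ⟨hbound.mono' (h.aesm_primitive u) (Eventually.of_forall fun x => hF x _),
    (norm_integral_le_of_norm_le (f := fun x => primitiveF f x (u x)) hbound
      (Eventually.of_forall fun x => hF x _)).trans hint,
    (norm_integral_le_of_norm_le (f := fun x => f x (u x) * u x) hbound
      (Eventually.of_forall hpt)).trans hint⟩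

theorem integrable_primitive (h : IsAdmissible s α β V f) (u : FracSobolev N s) :
    Integrable (fun x => primitiveF f x (u x)) :=
  ((h.exists_integral_growth one_pos).choose_spec.2 u).1

/-- `f(x, u) u` and `F(x, u)` have small integrals when `u` is small in measure. -/
theorem exists_integral_cut (h : IsAdmissible s α β V f) (K : ℝ) {ε : ℝ} (hε : 0 < ε) :
    ∃ δ > 0, ∃ C ≥ 0, ∀ u : FracSobolev N s, ‖u‖ ≤ K →
      |∫ x, primitiveF f x (u x)| ≤ ε + C * volume.real {x | δ ≤ |u x|} ∧
      |∫ x, f x (u x) * u x| ≤ ε + C * volume.real {x | δ ≤ |u x|} := by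
  obtain ⟨S, hS, hSob⟩ := h.exists_sobolev
  have hq := h.two_lt
  set q := criticalExponent N s
  -- The divisor bounds `∫ u² + ∫ |u| ^ q` on the ball of radius `K`; the absolute value is there
  -- because `K` has no assumed sign.
  obtain ⟨δ, hδ, C, hC, hcut⟩ := h.subcritical.exists_growth_cut hq
    (show 0 < ε / (K ^ 2 + (S * |K|) ^ q + 1) by positivity)
  set ε' := ε / (K ^ 2 + (S * |K|) ^ q + 1) with hε'
  refine ⟨δ, hδ, C, hC, fun u hu => ?_⟩
  have hKabs : ‖u‖ ≤ |K| := hu.trans (le_abs_self K)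
  set A := {x | δ ≤ |u x|} with hA
  have hAfin : volume A ≠ ⊤ := measure_superlevel_ne_top u hδ
  have hAm : MeasurableSet A :=
    (isClosed_le continuous_const continuous_abs).measurableSet.preimage
      (Lp.stronglyMeasurable (toL2 u)).measurable
  have hite : ∀ x, (if δ ≤ |u x| then C else 0) = A.indicator (fun _ => C) x := fun x => by
    simp [Set.indicator, hA]
  replace hcut := fun x => hcut x (u x)
  simp only [hite] at hcut
  have hi1 : Integrable fun x => ε' * (u x ^ 2 + |u x| ^ q) :=
    ((memLp u).integrable_sq.add (hSob u).1).const_mul _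
  have hi2 : Integrable (A.indicator fun _ => C) :=
    (integrable_indicator_iff hAm).2 (integrableOn_const (hs := hAfin))
  have hint : ∫ x, (ε' * (u x ^ 2 + |u x| ^ q) + A.indicator (fun _ => C) x)
      ≤ ε + C * volume.real A := by
    rw [integral_add hi1 hi2, integral_const_mul,
      integral_add (memLp u).integrable_sq (hSob u).1, integral_indicator hAm,
      setIntegral_const, smul_eq_mul, mul_comm C]
    have h1 : ∫ x, u x ^ 2 ≤ K ^ 2 := by
      rw [← sq_abs K]
      exact (integral_sq_le u).trans (by gcongr)
    have h2 : ∫ x, |u x| ^ q ≤ (S * |K|) ^ q := (hSob u).2.trans (by gcongr)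
    have h3 : ε' * (K ^ 2 + (S * |K|) ^ q + 1) = ε := by
      rw [hε']; field_simp
    have h4 : ε' * ((∫ x, u x ^ 2) + ∫ x, |u x| ^ q) ≤ ε' * (K ^ 2 + (S * |K|) ^ q) := by
      gcongr
    have : 0 < ε' := by positivity
    gcongr
    linarith
  exact ⟨(norm_integral_le_of_norm_le (f := fun x => primitiveF f x (u x)) (hi1.add hi2)
      (Eventually.of_forall fun x => (hcut x).2)).trans hint,
    (norm_integral_le_of_norm_le (f := fun x => f x (u x) * u x) (hi1.add hi2)
      (Eventually.of_forall fun x => (hcut x).1)).trans hint⟩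

end IsAdmissible

/-! ### Differentiability of the energy and invariance under lattice translations. -/

namespace IsAdmissible

variable {N : ℕ} {s α β : ℝ} {V : RN N → ℝ} {f : RN N → ℝ → ℝ}

theorem energyDeriv_add (h : IsAdmissible s α β V f) (u v w : FracSobolev N s) :
    energyDeriv V f u (v + w) = energyDeriv V f u v + energyDeriv V f u w := by
  unfold energyDeriv
  have e : ∫ x, f x (u x) * (v + w) x
      = (∫ x, f x (u x) * v x) + ∫ x, f x (u x) * w x := by
    rw [← integral_add (h.integrable_f_mul u v) (h.integrable_f_mul u w)]
    refine integral_congr_ae ?_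
    filter_upwards [coe_add v w] with x hx
    rw [hx, Pi.add_apply]; ring
  rw [quadForm_comm, h.quadForm_add_left, quadForm_comm V v, quadForm_comm V w, e]
  ring

theorem energyDeriv_smul (V : RN N → ℝ) (f : RN N → ℝ → ℝ) (c : ℝ) (u v : FracSobolev N s) :
    energyDeriv V f u (c • v) = c * energyDeriv V f u v := by
  unfold energyDeriv
  have e : ∫ x, f x (u x) * (c • v) x = c * ∫ x, f x (u x) * v x := by
    rw [← integral_const_mul]
    refine integral_congr_ae ?_
    filter_upwards [coe_smul c v] with x hx
    rw [hx, Pi.smul_apply, smul_eq_mul]; ring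
  rw [quadForm_comm, quadForm_smul_left, quadForm_comm V v, e]
  ring

/-- The derivative of the energy is represented by a gradient. -/
theorem exists_gradient (h : IsAdmissible s α β V f) :
    ∃ g : FracSobolev N s → FracSobolev N s, ∀ u v, inner ℝ (g u) v = energyDeriv V f u v := by
  have hex : ∀ u : FracSobolev N s, ∃ w : FracSobolev N s, ∀ v,
      inner ℝ w v = energyDeriv V f u v := by
    intro u
    obtain ⟨C, hC⟩ := h.exists_integral_f_mul_le u
    let ℓ : FracSobolev N s →ₗ[ℝ] ℝ :=
      { toFun := energyDeriv V f u
        map_add' := h.energyDeriv_add u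
        map_smul' := fun c v => energyDeriv_smul V f c u v }
    let L : StrongDual ℝ (FracSobolev N s) := ℓ.mkContinuous ((1 + β) * ‖u‖ + C) fun v => by
      have h1 := h.abs_quadForm_le u v
      have h2 := (hC v).2
      have h3 := abs_sub (quadForm V u v) (∫ x, f x (u x) * v x)
      change |quadForm V u v - ∫ x, f x (u x) * v x| ≤ _
      linarith
    exact ⟨(InnerProductSpace.toDual ℝ _).symm L, fun v =>
      InnerProductSpace.toDual_symm_apply⟩
  choose g hg using hex
  exact ⟨g, hg⟩

/-- Fixes the pointwise error so that Hölder's constants still leave `ε`; the factors `2` and `3`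
count the terms in `exists_approx_lipschitz` and `exists_taylor`, and `q` stands for the critical
exponent minus one. -/
theorem exists_critical_const (K S q : ℝ) (hS : 0 < S) {ε : ℝ} (hε : 0 < ε) :
    ∃ ε' > 0, ε' * (2 * |K| + 2 * ((S * |K|) ^ q * S)) ≤ ε ∧
      ε' * (3 * |K| + 3 * ((S * |K|) ^ q * S)) ≤ ε := by
  have p1 : 0 ≤ (S * |K|) ^ q := by positivity
  refine ⟨ε / (3 * |K| + 3 * ((S * |K|) ^ q * S) + 1), by positivity, ?_, ?_⟩
  all_goals
    rw [div_mul_eq_mul_div, div_le_iff₀ (by positivity)]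
    have : 0 ≤ (S * |K|) ^ q * S := by positivity
    refine mul_le_mul_of_nonneg_left ?_ hε.le
    linarith [abs_nonneg K]

/-- Local Lipschitz continuity of `u ↦ f(·, u)` up to a small error. -/
theorem exists_f_lipschitz (h : IsAdmissible s α β V f) (K : ℝ) {ε : ℝ} (hε : 0 < ε) :
    ∃ C ≥ 0, ∀ u w : FracSobolev N s, ‖u‖ ≤ K → ‖w‖ ≤ K → ∀ v : FracSobolev N s,
      |(∫ x, f x (u x) * v x) - ∫ x, f x (w x) * v x|
        ≤ ε * ‖v‖ + C * ∫ x, |u x - w x| * |v x| := by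
  obtain ⟨S, hS, hSob⟩ := h.exists_sobolev
  have hq := h.two_lt
  obtain ⟨ε', hε', hε'ε, -⟩ := exists_critical_const K S (criticalExponent N s - 1) hS hε
  obtain ⟨C, hC, hL⟩ := h.subcritical.exists_approx_lipschitz hε'
  refine ⟨C, hC, fun u w hu hw v => ?_⟩
  have hH := fun u => integral_rpow_mul_le h.s_pos h.lt_dim hS hSob u v
  set q := criticalExponent N s
  have i1 : Integrable fun x => |w x| * |v x| + |u x| * |v x| :=
    (integrable_abs_mul_abs w v).add (integrable_abs_mul_abs u v)
  have i2 : Integrable fun x => |w x| ^ (q - 1) * |v x| + |u x| ^ (q - 1) * |v x| :=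
    (hH w).1.add (hH u).1
  have i3 : Integrable fun x => |u x - w x| * |v x| :=
    ((memLp u).sub (memLp w)).abs.integrable_mul (memLp v).abs
  have i12 : Integrable fun x => ε' * (|w x| * |v x| + |u x| * |v x|)
      + ε' * (|w x| ^ (q - 1) * |v x| + |u x| ^ (q - 1) * |v x|) :=
    (i1.const_mul ε').add (i2.const_mul ε')
  have i123 := i12.add (i3.const_mul C)
  rw [← integral_sub (h.integrable_f_mul u v) (h.integrable_f_mul w v), ← Real.norm_eq_abs]
  refine (norm_integral_le_of_norm_le i123 (Eventually.of_forall fun x => ?_)).trans ?_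
  · rw [← sub_mul, Real.norm_eq_abs, abs_mul]
    refine (mul_le_mul_of_nonneg_right (hL x (w x) (u x)) (abs_nonneg _)).trans (le_of_eq ?_)
    simp only [Pi.add_apply]
    ring
  · simp only [Pi.add_apply]
    rw [integral_add i12 (i3.const_mul C), integral_add (i1.const_mul ε') (i2.const_mul ε'),
      integral_const_mul, integral_const_mul, integral_const_mul,
      integral_add (integrable_abs_mul_abs w v) (integrable_abs_mul_abs u v),
      integral_add (hH w).1 (hH u).1]
    have hKu : ‖u‖ ≤ |K| := hu.trans (le_abs_self K)
    have hKw : ‖w‖ ≤ |K| := hw.trans (le_abs_self K)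
    have b1 : ∫ x, |w x| * |v x| ≤ |K| * ‖v‖ :=
      (integral_abs_mul_abs_le w v).trans (by gcongr)
    have b2 : ∫ x, |u x| * |v x| ≤ |K| * ‖v‖ :=
      (integral_abs_mul_abs_le u v).trans (by gcongr)
    have b3 : ∫ x, |w x| ^ (q - 1) * |v x| ≤ (S * |K|) ^ (q - 1) * (S * ‖v‖) :=
      (hH w).2.trans (by gcongr; linarith)
    have b4 : ∫ x, |u x| ^ (q - 1) * |v x| ≤ (S * |K|) ^ (q - 1) * (S * ‖v‖) :=
      (hH u).2.trans (by gcongr; linarith)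
    have b5 := mul_le_mul_of_nonneg_left (add_le_add b1 b2) hε'.le
    have b6 := mul_le_mul_of_nonneg_left (add_le_add b3 b4) hε'.le
    have b7 := mul_le_mul_of_nonneg_right hε'ε (norm_nonneg v)
    linarith

/-- Although `f` has no derivative, the linear error has an arbitrarily small coefficient, which is
all that Fréchet differentiability requires. -/
theorem exists_energy_taylor (h : IsAdmissible s α β V f) (K : ℝ) {ε : ℝ} (hε : 0 < ε) :
    ∃ C ≥ 0, ∀ u w : FracSobolev N s, ‖u‖ ≤ K → ‖w‖ ≤ K →
      |(∫ x, primitiveF f x (w x)) - (∫ x, primitiveF f x (u x)) - ∫ x, f x (u x) * (w - u) x|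
        ≤ ε * ‖w - u‖ + C * ‖w - u‖ ^ 2 := by
  obtain ⟨S, hS, hSob⟩ := h.exists_sobolev
  have hq := h.two_lt
  obtain ⟨ε', hε', -, hε'ε⟩ := exists_critical_const K S (criticalExponent N s - 1) hS hε
  obtain ⟨C, hC, hL⟩ := h.subcritical.exists_taylor hq hε'
  refine ⟨C, hC, fun u w hu hw => ?_⟩
  set v := w - u with hv
  have hH := fun u => integral_rpow_mul_le h.s_pos h.lt_dim hS hSob u v
  set q := criticalExponent N s
  have i1 : Integrable fun x => 2 * (|u x| * |v x|) + |w x| * |v x| :=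
    ((integrable_abs_mul_abs u v).const_mul 2).add (integrable_abs_mul_abs w v)
  have i2 : Integrable fun x => 2 * (|u x| ^ (q - 1) * |v x|) + |w x| ^ (q - 1) * |v x| :=
    ((hH u).1.const_mul 2).add (hH w).1
  have i3 : Integrable fun x => |v x| * |v x| := integrable_abs_mul_abs v v
  have i12 : Integrable fun x => ε' * (2 * (|u x| * |v x|) + |w x| * |v x|)
      + ε' * (2 * (|u x| ^ (q - 1) * |v x|) + |w x| ^ (q - 1) * |v x|) :=
    (i1.const_mul ε').add (i2.const_mul ε')
  have i123 := i12.add (i3.const_mul C)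
  have iF : Integrable fun x => primitiveF f x (w x) - primitiveF f x (u x) :=
    (h.integrable_primitive w).sub (h.integrable_primitive u)
  rw [← integral_sub (h.integrable_primitive w) (h.integrable_primitive u),
    ← integral_sub iF (h.integrable_f_mul u v), ← Real.norm_eq_abs]
  refine (norm_integral_le_of_norm_le i123 ?_).trans ?_
  · filter_upwards [coe_sub w u] with x hx
    rw [hv, hx, Pi.sub_apply, Real.norm_eq_abs]
    refine (hL x (u x) (w x)).trans (le_of_eq ?_)
    simp only [Pi.add_apply]
    rw [hx, Pi.sub_apply]
    ring
  · simp only [Pi.add_apply]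
    rw [integral_add i12 (i3.const_mul C), integral_add (i1.const_mul ε') (i2.const_mul ε'),
      integral_const_mul, integral_const_mul, integral_const_mul,
      integral_add ((integrable_abs_mul_abs u v).const_mul 2) (integrable_abs_mul_abs w v),
      integral_add ((hH u).1.const_mul 2) (hH w).1, integral_const_mul, integral_const_mul]
    have hKu : ‖u‖ ≤ |K| := hu.trans (le_abs_self K)
    have hKw : ‖w‖ ≤ |K| := hw.trans (le_abs_self K)
    have b1 : ∫ x, |w x| * |v x| ≤ |K| * ‖v‖ :=
      (integral_abs_mul_abs_le w v).trans (by gcongr)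
    have b2 : ∫ x, |u x| * |v x| ≤ |K| * ‖v‖ :=
      (integral_abs_mul_abs_le u v).trans (by gcongr)
    have b3 : ∫ x, |w x| ^ (q - 1) * |v x| ≤ (S * |K|) ^ (q - 1) * (S * ‖v‖) :=
      (hH w).2.trans (by gcongr; linarith)
    have b4 : ∫ x, |u x| ^ (q - 1) * |v x| ≤ (S * |K|) ^ (q - 1) * (S * ‖v‖) :=
      (hH u).2.trans (by gcongr; linarith)
    have b5 := mul_le_mul_of_nonneg_left
      (add_le_add (mul_le_mul_of_nonneg_left b2 zero_le_two) b1) hε'.le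
    have b6 := mul_le_mul_of_nonneg_left
      (add_le_add (mul_le_mul_of_nonneg_left b4 zero_le_two) b3) hε'.le
    have b7 := mul_le_mul_of_nonneg_right hε'ε (norm_nonneg v)
    have b8 := mul_le_mul_of_nonneg_left (integral_abs_mul_abs_le v v) hC
    linarith

theorem energyJ_eq (V : RN N → ℝ) (f : RN N → ℝ → ℝ) (u : FracSobolev N s) :
    energyJ V f u = (1 / 2) * quadForm V u u - ∫ x, primitiveF f x (u x) := by
  rw [energyJ, quadForm_self]

theorem energyJ_zero (V : RN N → ℝ) (f : RN N → ℝ → ℝ) :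
    energyJ V f (0 : FracSobolev N s) = 0 := by
  have h1 : quadForm V (0 : FracSobolev N s) 0 = 0 := by
    have := quadForm_smul_left V 0 (0 : FracSobolev N s) 0
    simpa using this
  have h2 : ∫ x, primitiveF f x ((0 : FracSobolev N s) x) = 0 := by
    rw [← integral_zero (RN N) ℝ (μ := volume)]
    refine integral_congr_ae ?_
    have := Lp.coeFn_zero ℝ 2 (volume : Measure (RN N))
    rw [← map_zero (toL2 (N := N) (s := s))] at this
    filter_upwards [this] with x hx
    rw [hx, Pi.zero_apply, primitiveF_zero]
  rw [energyJ_eq, h1, h2]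
  simp

/-- The energy is Fréchet differentiable, with the expected derivative. -/
theorem hasFDerivAt_energyJ (h : IsAdmissible s α β V f) {g : FracSobolev N s → FracSobolev N s}
    (hg : ∀ u v, inner ℝ (g u) v = energyDeriv V f u v) (u : FracSobolev N s) :
    HasFDerivAt (energyJ V f) (innerSL ℝ (g u)) u := by
  rw [hasFDerivAt_iff_isLittleO, Asymptotics.isLittleO_iff]
  intro ε hε
  obtain ⟨C, hC, hT⟩ := h.exists_energy_taylor (‖u‖ + 1) (half_pos hε)
  have hβ := h.one_le_β
  set ρ := min 1 (ε / 2 / (β + C)) with hρ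
  have hρ0 : 0 < ρ := by positivity
  filter_upwards [Metric.ball_mem_nhds u hρ0] with w hw
  rw [Metric.mem_ball, dist_eq_norm] at hw
  have hw1 : ‖w - u‖ ≤ 1 := hw.le.trans (min_le_left _ _)
  have hwn : ‖w‖ ≤ ‖u‖ + 1 := by
    have := norm_le_norm_add_norm_sub' w u; linarith
  have h1 := hT u w (by linarith) hwn
  have h2 := h.quadForm_le (w - u)
  have h2' := h.le_quadForm (w - u)
  have h2'' : 0 ≤ quadForm V (w - u) (w - u) := by
    refine le_trans ?_ h2'
    have := h.α_pos
    positivity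
  have h3 : quadForm V w w = quadForm V u u + 2 * quadForm V u (w - u)
      + quadForm V (w - u) (w - u) := by
    obtain ⟨v, rfl⟩ : ∃ v, w = u + v := ⟨w - u, by abel⟩
    rw [add_sub_cancel_left, h.quadForm_add_left, quadForm_comm V u (u + v),
      quadForm_comm V v (u + v), h.quadForm_add_left, h.quadForm_add_left, quadForm_comm V v u]
    ring
  have h4 : (β + C) * ‖w - u‖ ≤ ε / 2 := by
    have := hw.le.trans (min_le_right _ _)
    rw [le_div_iff₀ (by positivity)] at this
    linarith
  have h5 : (β + C) * ‖w - u‖ ^ 2 ≤ ε / 2 * ‖w - u‖ := by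
    have := mul_le_mul_of_nonneg_right h4 (norm_nonneg (w - u))
    nlinarith
  rw [innerSL_apply_apply, hg, energyDeriv, energyJ_eq, energyJ_eq, h3, Real.norm_eq_abs]
  have h6 := abs_le.1 h1
  have h7 : β * ‖w - u‖ ^ 2 ≥ 0 := by positivity
  rw [abs_le]
  constructor <;> linarith [h6.1, h6.2]

/-- The difference of two gradients is tested against itself, and one factor of its norm is
cancelled. -/
theorem uniformContinuousOnBounded_gradient (h : IsAdmissible s α β V f)
    {g : FracSobolev N s → FracSobolev N s} (hg : ∀ u v, inner ℝ (g u) v = energyDeriv V f u v) :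
    UniformContinuousOnBounded g := by
  intro K ε hε
  obtain ⟨C, hC, hL⟩ := h.exists_f_lipschitz K (half_pos hε)
  have hβ := h.one_le_β
  refine ⟨ε / 2 / (1 + β + C), by positivity, fun u w hu hw huw => ?_⟩
  rw [le_div_iff₀ (by positivity)] at huw
  set v := g u - g w with hv
  have h1 : ‖v‖ ^ 2 = quadForm V (u - w) v
      - ((∫ x, f x (u x) * v x) - ∫ x, f x (w x) * v x) := by
    rw [← real_inner_self_eq_norm_sq]
    nth_rewrite 1 [hv]
    have h2 : quadForm V u v = quadForm V (u - w) v + quadForm V w v := by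
      rw [← h.quadForm_add_left, sub_add_cancel]
    rw [inner_sub_left, hg, hg, energyDeriv, energyDeriv, h2]
    ring
  have h2 := h.abs_quadForm_le (u - w) v
  have h3 := hL u w hu hw v
  have h4 : ∫ x, |u x - w x| * |v x| ≤ ‖u - w‖ * ‖v‖ := by
    refine le_trans (le_of_eq ?_) (integral_abs_mul_abs_le (u - w) v)
    refine integral_congr_ae ?_
    filter_upwards [coe_sub u w] with x hx
    rw [hx, Pi.sub_apply]
  have h5 := mul_le_mul_of_nonneg_left h4 hC
  have h6 := mul_le_mul_of_nonneg_right huw (norm_nonneg v)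
  have h7 : ‖v‖ ^ 2 ≤ ε * ‖v‖ := by
    have := le_abs_self (quadForm V (u - w) v)
    have := neg_abs_le ((∫ x, f x (u x) * v x) - ∫ x, f x (w x) * v x)
    linarith
  rcases (norm_nonneg v).eq_or_lt with h0 | h0
  · rw [← h0]; exact hε.le
  · rw [sq] at h7
    exact le_of_mul_le_mul_right h7 h0

theorem isCriticalPointJ_iff (h : IsAdmissible s α β V f) {u : FracSobolev N s} :
    IsCriticalPointJ V f u ↔ ∀ v, energyDeriv V f u v = 0 := by
  obtain ⟨g, hg⟩ := h.exists_gradient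
  have hd := h.hasFDerivAt_energyJ hg u
  constructor
  · intro hc v
    have := hd.unique hc
    rw [← hg, ← innerSL_apply_apply ℝ, this]
    rfl
  · intro hv
    have hz : innerSL ℝ (g u) = 0 := by
      ext v
      rw [innerSL_apply_apply, hg, hv]
      rfl
    rw [hz] at hd
    exact hd

theorem isWeakSolution_of_forall (h : IsAdmissible s α β V f) {u : FracSobolev N s}
    (hu : ∀ v, energyDeriv V f u v = 0) : IsWeakSolution V f u := fun v =>
  ⟨h.integrable_f_mul u v, sub_eq_zero.1 (hu v)⟩

theorem integral_f_shift (h : IsAdmissible s α β V f) (k : Fin N → ℤ)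
    (u v : FracSobolev N s) :
    ∫ x, f x (shift (latticePoint k) u x) * shift (latticePoint k) v x
      = ∫ x, f x (u x) * v x := by
  rw [← integral_add_right_eq_self (fun x => f x (u x) * v x) (latticePoint k)]
  refine integral_congr_ae ?_
  filter_upwards [coe_shift (latticePoint k) u, coe_shift (latticePoint k) v] with x hx hx'
  rw [hx, hx', h.subcritical.periodic.add_latticePoint]

theorem quadForm_shift (h : IsAdmissible s α β V f) (k : Fin N → ℤ)
    (u v : FracSobolev N s) :
    quadForm V (shift (latticePoint k) u) (shift (latticePoint k) v) = quadForm V u v := by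
  unfold quadForm
  rw [gagliardoForm_shift,
    ← integral_add_right_eq_self (fun x => V x * u x * v x) (latticePoint k)]
  congr 1
  refine integral_congr_ae ?_
  filter_upwards [coe_shift (latticePoint k) u, coe_shift (latticePoint k) v] with x hx hx'
  rw [hx, hx', h.V_periodic.add_latticePoint]

theorem energyDeriv_shift (h : IsAdmissible s α β V f) (k : Fin N → ℤ)
    (u v : FracSobolev N s) :
    energyDeriv V f (shift (latticePoint k) u) (shift (latticePoint k) v)
      = energyDeriv V f u v := by
  rw [energyDeriv, h.quadForm_shift, h.integral_f_shift, energyDeriv]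

theorem energyJ_shift (h : IsAdmissible s α β V f) (k : Fin N → ℤ) (u : FracSobolev N s) :
    energyJ V f (shift (latticePoint k) u) = energyJ V f u := by
  rw [energyJ_eq, h.quadForm_shift, energyJ_eq,
    ← integral_add_right_eq_self (fun x => primitiveF f x (u x)) (latticePoint k)]
  congr 1
  refine integral_congr_ae ?_
  filter_upwards [coe_shift (latticePoint k) u] with x hx
  rw [hx, h.subcritical.primitiveF_periodic.add_latticePoint]

theorem integrable_jeanjeanG (h : IsAdmissible s α β V f) (u : FracSobolev N s) :
    Integrable fun x => jeanjeanG f x (u x) :=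
  (h.integrable_f_mul u u).sub ((h.integrable_primitive u).const_mul 2)

/-- At a critical point the energy is therefore half the integral of a nonnegative function when `G
≥ 0`: such energies are nonnegative, and Fatou's lemma gives semicontinuity. -/
theorem integral_jeanjeanG (h : IsAdmissible s α β V f) (u : FracSobolev N s) :
    ∫ x, jeanjeanG f x (u x) = 2 * energyJ V f u - energyDeriv V f u u := by
  have : ∫ x, jeanjeanG f x (u x)
      = (∫ x, f x (u x) * u x) - 2 * ∫ x, primitiveF f x (u x) := by
    rw [← integral_const_mul]
    exact integral_sub (h.integrable_f_mul u u) ((h.integrable_primitive u).const_mul 2)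
  rw [this, energyJ_eq, energyDeriv]
  ring

end IsAdmissible

/-! ### Scaling of superlevel sets and testing against fixed functions. -/

namespace FracSobolev

variable {N : ℕ} {s : ℝ}

theorem measure_superlevel_smul (u : FracSobolev N s) (δ : ℝ) {t : ℝ} (ht : 0 < t) :
    volume.real {x | t * δ ≤ |(t • u) x|} = volume.real {x | δ ≤ |u x|} := by
  refine measureReal_congr ?_
  filter_upwards [coe_smul t u] with x hx
  refine propext ?_
  change t * δ ≤ |(t • u) x| ↔ δ ≤ |u x|
  rw [hx, Pi.smul_apply, smul_eq_mul, abs_mul, abs_of_pos ht, mul_le_mul_iff_right₀ ht]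

/-- A bounded sequence that tends to zero in `L²` of balls is null when tested against a fixed
function. -/
theorem tendsto_integral_abs_mul {y : ℕ → FracSobolev N s} {K : ℝ} (hK : ∀ n, ‖y n‖ ≤ K)
    (hy : ∀ ρ, Tendsto (fun n => ∫ x in Metric.ball (0 : RN N) ρ, y n x ^ 2) atTop (𝓝 0))
    (v : FracSobolev N s) : Tendsto (fun n => ∫ x, |y n x| * |v x|) atTop (𝓝 0) := by
  rw [Metric.tendsto_atTop]
  intro ε hε
  set a := ∫ x, v x ^ 2 with ha
  have ha0 : 0 ≤ a := integral_nonneg fun x => sq_nonneg _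
  -- Young weights: inside the ball `τ` makes the part of `v` small and `y n` tends to zero;
  -- outside, `σ` makes the bounded part of `y n` small and the tail of `v` is small. Each of the
  -- four terms is at most `ε / 8`.
  set σ := ε / (4 * (K ^ 2 + 1)) with hσ
  set τ := ε / (4 * (a + 1)) with hτ
  have hσ0 : 0 < σ := by positivity
  have hτ0 : 0 < τ := by positivity
  have hcover := (aecover_ball (μ := (volume : Measure (RN N))) (x := 0)
    tendsto_natCast_atTop_atTop).integral_tendsto_of_countably_generated (memLp v).integrable_sq
  obtain ⟨R, hR⟩ := (hcover.eventually (lt_mem_nhds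
    (show a - ε * σ / 4 < a by linarith [mul_pos hε hσ0]))).exists
  set B := Metric.ball (0 : RN N) R with hB
  have hBm : MeasurableSet B := measurableSet_ball
  obtain ⟨n₀, hn₀⟩ := eventually_atTop.1 ((hy R).eventually (gt_mem_nhds
    (show 0 < ε * τ / 4 by positivity)))
  refine ⟨n₀, fun n hn => ?_⟩
  rw [Real.dist_eq, sub_zero, abs_of_nonneg (integral_nonneg fun x => by positivity)]
  have hyi := (memLp (y n)).integrable_sq
  have hvi := (memLp v).integrable_sq
  have hi := integrable_abs_mul_abs (y n) v
  have hsplit := integral_add_compl hBm hi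
  have hsplit2 := integral_add_compl hBm hvi
  have young : ∀ c > 0, ∀ p q : ℝ, |p| * |q| ≤ 1 / (2 * c) * p ^ 2 + c / 2 * q ^ 2 := by
    intro c hc p q
    rw [← sq_abs p, ← sq_abs q]
    have : 1 / (2 * c) * |p| ^ 2 + c / 2 * |q| ^ 2 - |p| * |q|
        = (|p| - c * |q|) ^ 2 / (2 * c) := by field_simp; ring
    have : 0 ≤ (|p| - c * |q|) ^ 2 / (2 * c) := by positivity
    linarith
  have b1 : ∫ x in B, |y n x| * |v x|
      ≤ 1 / (2 * τ) * (∫ x in B, y n x ^ 2) + τ / 2 * ∫ x in B, v x ^ 2 := by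
    rw [← integral_const_mul, ← integral_const_mul, ← integral_add
      (hyi.integrableOn.const_mul _) (hvi.integrableOn.const_mul _)]
    exact integral_mono hi.integrableOn
      ((hyi.integrableOn.const_mul _).add (hvi.integrableOn.const_mul _))
      fun x => young τ hτ0 _ _
  have b2 : ∫ x in Bᶜ, |y n x| * |v x|
      ≤ σ / 2 * (∫ x in Bᶜ, y n x ^ 2) + 1 / (2 * σ) * ∫ x in Bᶜ, v x ^ 2 := by
    rw [← integral_const_mul, ← integral_const_mul, ← integral_add
      (hyi.integrableOn.const_mul _) (hvi.integrableOn.const_mul _)]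
    exact integral_mono hi.integrableOn
      ((hyi.integrableOn.const_mul _).add (hvi.integrableOn.const_mul _))
      fun x => by
        have := young σ hσ0 (v x) (y n x)
        simp only
        linarith [mul_comm |v x| |y n x|]
  have c1 : 1 / (2 * τ) * (∫ x in B, y n x ^ 2) ≤ ε / 8 := by
    calc 1 / (2 * τ) * (∫ x in B, y n x ^ 2) ≤ 1 / (2 * τ) * (ε * τ / 4) := by
          gcongr; exact (hn₀ n hn).le
      _ = ε / 8 := by field_simp; norm_num
  have c2 : τ / 2 * ∫ x in B, v x ^ 2 ≤ ε / 8 := by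
    have : ∫ x in B, v x ^ 2 ≤ a + 1 :=
      (setIntegral_le_integral hvi (Eventually.of_forall fun x => sq_nonneg _)).trans
        (by linarith)
    calc τ / 2 * ∫ x in B, v x ^ 2 ≤ τ / 2 * (a + 1) := by gcongr
      _ = ε / 8 := by rw [hτ]; field_simp; norm_num
  have c3 : σ / 2 * (∫ x in Bᶜ, y n x ^ 2) ≤ ε / 8 := by
    have h1 : ∫ x in Bᶜ, y n x ^ 2 ≤ ‖y n‖ ^ 2 :=
      (setIntegral_le_integral hyi (Eventually.of_forall fun x => sq_nonneg _)).trans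
        (integral_sq_le _)
    have h2 : ‖y n‖ ^ 2 ≤ K ^ 2 := by gcongr; exact hK n
    calc σ / 2 * (∫ x in Bᶜ, y n x ^ 2) ≤ σ / 2 * (K ^ 2 + 1) := by gcongr; linarith
      _ = ε / 8 := by rw [hσ]; field_simp; norm_num
  have c4 : 1 / (2 * σ) * ∫ x in Bᶜ, v x ^ 2 ≤ ε / 8 := by
    calc 1 / (2 * σ) * ∫ x in Bᶜ, v x ^ 2 ≤ 1 / (2 * σ) * (ε * σ / 4) := by
          gcongr; linarith
      _ = ε / 8 := by field_simp; norm_num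
  linarith

end FracSobolev

/-! ### Mountain pass geometry and boundedness of Cerami sequences. -/

namespace IsAdmissible

variable {N : ℕ} {s α β : ℝ} {V : RN N → ℝ} {f : RN N → ℝ → ℝ}

/-- Almost critical functions bounded away from zero do not vanish. -/
theorem exists_measure_lower_bound (h : IsAdmissible s α β V f) (K : ℝ) {r : ℝ} (hr : 0 < r) :
    ∃ δ > 0, ∃ η > 0, ∀ u : FracSobolev N s, ‖u‖ ≤ K → r ≤ ‖u‖ →
      |energyDeriv V f u u| ≤ α * r ^ 2 / 4 → η ≤ volume.real {x | δ ≤ |u x|} := by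
  have hα := h.α_pos
  obtain ⟨δ, hδ, C, hC, hcut⟩ := h.exists_integral_cut K (show 0 < α * r ^ 2 / 4 by positivity)
  -- Of `α r² ≤ J'(u) u + ∫ f(x, u) u` the derivative and the small part take a quarter each, so `C`
  -- times the measure is at least `α r² / 2`.
  refine ⟨δ, hδ, α * r ^ 2 / (2 * (C + 1)), by positivity, fun u hu hru hD => ?_⟩
  have h1 := (hcut u hu).2
  have h2 := h.le_quadForm u
  have h3 : α * r ^ 2 ≤ α * ‖u‖ ^ 2 := by gcongr
  have h4 := (abs_le.1 hD).2
  have h5 := (abs_le.1 h1).2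
  rw [energyDeriv] at h4
  have h6 : 0 ≤ volume.real {x | δ ≤ |u x|} := measureReal_nonneg
  rw [div_le_iff₀ (by positivity)]
  linarith

/-- Near zero the quadratic part of the energy dominates. -/
theorem exists_radius (h : IsAdmissible s α β V f) :
    ∃ r > 0, ∀ u : FracSobolev N s, ‖u‖ ≤ r →
      α / 8 * ‖u‖ ^ 2 ≤ energyJ V f u ∧ α / 2 * ‖u‖ ^ 2 ≤ energyDeriv V f u u := by
  have hα := h.α_pos
  have hq := h.two_lt
  obtain ⟨C, hC, hgr⟩ := h.exists_integral_growth (show 0 < α / 4 by positivity)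
  set q := criticalExponent N s
  have hlim : Tendsto (fun r : ℝ => C * r ^ (q - 2)) (𝓝[>] 0) (𝓝 0) := by
    have hc : Continuous fun r : ℝ => C * r ^ (q - 2) :=
      continuous_const.mul (Real.continuous_rpow_const (by linarith))
    have := hc.tendsto 0
    simp only [Real.zero_rpow (by linarith : q - 2 ≠ 0), mul_zero] at this
    exact this.mono_left nhdsWithin_le_nhds
  obtain ⟨r, hr, hr0⟩ := ((hlim.eventually (gt_mem_nhds
    (show 0 < α / 8 by positivity))).and self_mem_nhdsWithin).exists
  refine ⟨r, hr0, fun u hu => ?_⟩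
  obtain ⟨-, h1, h2⟩ := hgr u
  have h3 : C * ‖u‖ ^ q ≤ α / 8 * ‖u‖ ^ 2 := by
    have e : ‖u‖ ^ q = ‖u‖ ^ (q - 2) * ‖u‖ ^ 2 := by
      rw [← Real.rpow_natCast, ← Real.rpow_add' (norm_nonneg _)]
      · congr 1; push_cast; ring
      · push_cast; linarith
    rw [e, ← mul_assoc]
    refine mul_le_mul_of_nonneg_right (le_trans ?_ hr.le) (sq_nonneg _)
    gcongr
  have h4 := h.le_quadForm u
  have h5 : 0 ≤ α * ‖u‖ ^ 2 := by positivity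
  rw [energyJ_eq, energyDeriv]
  constructor
  · linarith [(abs_le.1 h1).2]
  · linarith [(abs_le.1 h2).2]

/-- Markov's inequality for the nonnegative function `F(x, u)`. -/
theorem le_integral_primitive (h : IsAdmissible s α β V f) (hG : ∀ x t, 0 ≤ jeanjeanG f x t)
    {M T δ : ℝ} (hM : 0 < M) (hT : 0 < T) (hTF : ∀ x t, T ≤ |t| → M * t ^ 2 ≤ primitiveF f x t)
    (hδ : T ≤ δ) (u : FracSobolev N s) :
    M * δ ^ 2 * volume.real {x | δ ≤ |u x|} ≤ ∫ x, primitiveF f x (u x) := by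
  have hδ0 : 0 < δ := hT.trans_le hδ
  have h1 := mul_meas_ge_le_integral_of_nonneg
    (Eventually.of_forall fun x => h.subcritical.primitiveF_nonneg hG x (u x))
    (h.integrable_primitive u) (M * δ ^ 2)
  refine le_trans (mul_le_mul_of_nonneg_left ?_ (by positivity)) h1
  refine measureReal_mono (fun x hx => ?_)
    ((h.integrable_primitive u).measure_ge_lt_top (by positivity)).ne
  have hx' : δ ≤ |u x| := hx
  change M * δ ^ 2 ≤ primitiveF f x (u x)
  refine le_trans ?_ (hTF x (u x) (hδ.trans hx'))
  rw [← sq_abs (u x)]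
  gcongr

/-- The energy is nonpositive far out on a ray. -/
theorem exists_energyJ_nonpos (h : IsAdmissible s α β V f) (hG : ∀ x t, 0 ≤ jeanjeanG f x t)
    (hf3 : ∀ x : RN N, Tendsto (fun t : ℝ => primitiveF f x t / |t| ^ 2) (cocompact ℝ) atTop)
    (r : ℝ) : ∃ e : FracSobolev N s, r ≤ ‖e‖ ∧ energyJ V f e ≤ 0 := by
  have hβ := h.one_le_β
  have hN : 0 < N := by
    have h1 := h.lt_dim
    have h2 := h.s_pos
    have : (0 : ℝ) < N := by linarith
    exact_mod_cast this
  obtain ⟨u, hu⟩ := exists_ne_zero h.s_pos h.s_lt_one hN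
  obtain ⟨δ, hδ, η, hη, hmeas⟩ := exists_measure_pos hu
  have hu0 : 0 < ‖u‖ := norm_pos_iff.2 hu
  have hM : 0 < β * ‖u‖ ^ 2 / (2 * (δ ^ 2 * η)) := by positivity
  obtain ⟨T, hT, hTF⟩ := h.subcritical.exists_superquadratic hG hf3
    (β * ‖u‖ ^ 2 / (2 * (δ ^ 2 * η)))
  -- The first entry puts `t * δ` beyond the threshold `T`, the second makes the norm at least `r`.
  -- The factor in the superquadratic bound is tuned so that `∫ F` reaches the upper bound `β ‖t u‖²
  -- / 2` of the quadratic part.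
  set t := max (T / δ) (|r| / ‖u‖) with ht
  have ht0 : 0 < t := lt_of_lt_of_le (by positivity) (le_max_left _ _)
  have hTt : T ≤ t * δ := by
    have := le_max_left (T / δ) (|r| / ‖u‖)
    rwa [div_le_iff₀ hδ] at this
  refine ⟨t • u, ?_, ?_⟩
  · rw [norm_smul, Real.norm_of_nonneg ht0.le]
    have := le_max_right (T / δ) (|r| / ‖u‖)
    rw [div_le_iff₀ hu0] at this
    exact (le_abs_self r).trans this
  · have h1 := h.le_integral_primitive hG hM hT hTF hTt (t • u)
    rw [measure_superlevel_smul u δ ht0] at h1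
    have h2 := h.quadForm_le (t • u)
    rw [norm_smul, Real.norm_of_nonneg ht0.le] at h2
    have h3 : β * ‖u‖ ^ 2 / (2 * (δ ^ 2 * η)) * (t * δ) ^ 2 * η
        ≤ β * ‖u‖ ^ 2 / (2 * (δ ^ 2 * η)) * (t * δ) ^ 2 * volume.real {x | δ ≤ |u x|} := by
      gcongr
    have h4 : β * ‖u‖ ^ 2 / (2 * (δ ^ 2 * η)) * (t * δ) ^ 2 * η = β * (t * ‖u‖) ^ 2 / 2 := by
      field_simp
    rw [energyJ_eq]
    linarith

/-- If the energy along the segment `[0, u]` exceeds its values at both ends, then it is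
controlled by the energy at `u` through the Jeanjean condition. -/
theorem energyJ_smul_le (h : IsAdmissible s α β V f) {lam : ℝ}
    (hf4 : ∀ (x : RN N) (t θ : ℝ), 0 ≤ θ → θ ≤ 1 →
      jeanjeanG f x (θ * t) ≤ lam * jeanjeanG f x t)
    {u : FracSobolev N s} {t : ℝ} (ht0 : 0 ≤ t) (ht1 : t ≤ 1) (h0 : 0 < energyJ V f (t • u))
    (h1 : energyJ V f u < energyJ V f (t • u)) :
    2 * energyJ V f (t • u) ≤ lam * (2 * energyJ V f u - energyDeriv V f u u) := by
  obtain ⟨g, hg⟩ := h.exists_gradient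
  have hd : ∀ r : ℝ, HasDerivAt (fun r : ℝ => energyJ V f (r • u))
      (energyDeriv V f (r • u) u) r := by
    intro r
    have h2 : HasDerivAt (fun r : ℝ => r • u) u r := by
      simpa using (hasDerivAt_id r).smul_const u
    have h3 := (h.hasFDerivAt_energyJ hg (r • u)).comp_hasDerivAt r h2
    rw [innerSL_apply_apply, hg] at h3
    exact h3
  have hc : Continuous fun r : ℝ => energyJ V f (r • u) :=
    continuous_iff_continuousAt.2 fun r => (hd r).continuousAt
  -- The maximum on the segment is interior, so the radial derivative vanishes there and `2 J(r u) =
  -- ∫ G(x, r u)`, which (f4) compares with `∫ G(x, u)`.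
  obtain ⟨r, hr, hmax⟩ := isCompact_Icc.exists_isMaxOn (Set.nonempty_Icc.2 zero_le_one)
    (hc.continuousOn (s := Set.Icc (0 : ℝ) 1))
  have hrt : energyJ V f (t • u) ≤ energyJ V f (r • u) := hmax ⟨ht0, ht1⟩
  have hr0 : 0 < r := by
    refine lt_of_le_of_ne hr.1 fun h0' => ?_
    rw [← h0', zero_smul, energyJ_zero] at hrt
    linarith
  have hr1 : r < 1 := by
    refine lt_of_le_of_ne hr.2 fun h0' => ?_
    rw [h0', one_smul] at hrt
    linarith
  have hcrit := (hmax.isLocalMax (Icc_mem_nhds hr0 hr1)).hasDerivAt_eq_zero (hd r)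
  have hD : energyDeriv V f (r • u) (r • u) = 0 := by rw [energyDeriv_smul, hcrit, mul_zero]
  have h2 := h.integral_jeanjeanG (r • u)
  rw [hD, sub_zero] at h2
  have h3 : ∫ x, jeanjeanG f x ((r • u) x) ≤ lam * ∫ x, jeanjeanG f x (u x) := by
    rw [← integral_const_mul]
    refine integral_mono_ae (h.integrable_jeanjeanG _) ((h.integrable_jeanjeanG u).const_mul _) ?_
    filter_upwards [coe_smul r u] with x hx
    rw [hx]
    exact hf4 x (u x) r hr.1 hr.2
  rw [h.integral_jeanjeanG u] at h3
  linarith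

/-- Cerami sequences are bounded. -/
theorem exists_norm_bound (h : IsAdmissible s α β V f) {lam : ℝ} (hlam : 1 ≤ lam)
    (hf3 : ∀ x : RN N, Tendsto (fun t : ℝ => primitiveF f x t / |t| ^ 2) (cocompact ℝ) atTop)
    (hf4 : ∀ (x : RN N) (t θ : ℝ), 0 ≤ θ → θ ≤ 1 →
      jeanjeanG f x (θ * t) ≤ lam * jeanjeanG f x t) {E : ℝ} (hE : 0 ≤ E) :
    ∃ K, ∀ u : FracSobolev N s, |energyJ V f u| ≤ E → |energyDeriv V f u u| ≤ 1 → ‖u‖ ≤ K := by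
  have hα := h.α_pos
  have hβ := h.one_le_β
  have hG := jeanjeanG_nonneg hlam hf4
  -- `L` exceeds both `E` and `lam * (E + 1)`, the most that `energyJ_smul_le` allows. `R` makes the
  -- quadratic part at least `L + 2`, since the cut estimate costs at most `1 + C * η ≤ 2`.
  set L := lam * (E + 1) + E + 1 with hL
  have hL0 : 0 < L := by positivity
  set R := √(2 * (L + 2) / α) with hR
  have hRpos : 0 < R := Real.sqrt_pos.2 (by positivity)
  have hR2 : α / 2 * R ^ 2 = L + 2 := by
    rw [hR, Real.sq_sqrt (by positivity)]; field_simp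
  obtain ⟨δ, hδ, C, hC, hcut⟩ := h.exists_integral_cut R one_pos
  set η := 1 / (C + 1) with hη
  have hη0 : 0 < η := by positivity
  have hM : 0 < (β / 2 + 1) * R ^ 2 / (δ ^ 2 * η) := by positivity
  obtain ⟨T, hT, hTF⟩ := h.subcritical.exists_superquadratic hG hf3
    ((β / 2 + 1) * R ^ 2 / (δ ^ 2 * η))
  refine ⟨max R (T * R / δ) + E + 1, fun u hJ hD => ?_⟩
  by_contra! hu
  have hm1 := le_max_left R (T * R / δ)
  have hm2 := le_max_right R (T * R / δ)
  have huR : R < ‖u‖ := by linarith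
  have hu0 : 0 < ‖u‖ := hRpos.trans huR
  set t := R / ‖u‖ with ht
  have ht0 : 0 < t := by positivity
  have ht1 : t ≤ 1 := by rw [ht, div_le_one hu0]; exact huR.le
  have hnorm : ‖t • u‖ = R := by
    rw [norm_smul, Real.norm_of_nonneg ht0.le, ht]; field_simp
  have hJ' := abs_le.1 hJ
  have hD' := abs_le.1 hD
  -- Small in measure: the energy at `t • u` reaches `L`, contradicting (f4). Otherwise `u` itself
  -- exceeds `δ / t ≥ T` on a set of measure `η`, and superquadraticity forces `J u ≤ -‖u‖²`.
  rcases le_or_gt (volume.real {x | δ ≤ |(t • u) x|}) η with hv | hv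
  · have h1 := (abs_le.1 (hcut (t • u) hnorm.le).1).2
    have h2 := h.le_quadForm (t • u)
    rw [hnorm] at h2
    have h3 : C * volume.real {x | δ ≤ |(t • u) x|} ≤ 1 := by
      calc C * volume.real {x | δ ≤ |(t • u) x|} ≤ C * η := by gcongr
        _ ≤ 1 := by rw [hη, mul_one_div, div_le_one (by positivity)]; linarith
    have h4 : L ≤ energyJ V f (t • u) := by
      rw [energyJ_eq]; linarith
    have hl : 0 ≤ lam * (E + 1) := by positivity
    have h5 := h.energyJ_smul_le hf4 ht0.le ht1 (by linarith) (by linarith)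
    have h6 : lam * (2 * energyJ V f u - energyDeriv V f u u) ≤ lam * (2 * (E + 1)) := by
      gcongr
      linarith
    linarith
  · have e1 : {x | δ ≤ |(t • u) x|} = {x | t * (δ / t) ≤ |(t • u) x|} := by
      rw [mul_div_cancel₀ _ ht0.ne']
    rw [e1, measure_superlevel_smul u _ ht0] at hv
    have hTδ : T ≤ δ / t := by
      rw [ht, div_div_eq_mul_div, le_div_iff₀ hRpos]
      have : T * R / δ ≤ ‖u‖ := by linarith
      rw [div_le_iff₀ hδ] at this
      linarith
    have h1 := h.le_integral_primitive hG hM hT hTF hTδ u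
    have h2 : (β / 2 + 1) * R ^ 2 / (δ ^ 2 * η) * (δ / t) ^ 2 * η ≤
        (β / 2 + 1) * R ^ 2 / (δ ^ 2 * η) * (δ / t) ^ 2 * volume.real {x | δ / t ≤ |u x|} := by
      gcongr
    have h3 : (β / 2 + 1) * R ^ 2 / (δ ^ 2 * η) * (δ / t) ^ 2 * η = (β / 2 + 1) * ‖u‖ ^ 2 := by
      rw [ht]; field_simp
    have h4 := h.quadForm_le u
    have h5 : energyJ V f u ≤ -‖u‖ ^ 2 := by
      rw [energyJ_eq]; linarith
    have h6 : E < ‖u‖ ^ 2 := by nlinarith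
    linarith [hJ'.1]

end IsAdmissible

/-! ### Weak limits of almost critical sequences and the ground state. -/

namespace IsAdmissible

variable {N : ℕ} {s α β : ℝ} {V : RN N → ℝ} {f : RN N → ℝ → ℝ}

/-- A function with mass in a unit ball can be moved by a lattice vector so that the mass lies in
a fixed ball around the origin. -/
theorem exists_shift_mass (u : FracSobolev N s) {x : RN N} {c : ℝ}
    (hx : c ≤ ∫ y in Metric.ball x 1, u y ^ 2) :
    ∃ k : Fin N → ℤ, c ≤ ∫ y in Metric.ball (0 : RN N) (√N + 1), shift (latticePoint k) u y ^ 2 := by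
  obtain ⟨k, hk⟩ := exists_add_latticePoint_mem x
  have hneg : latticePoint (-k) = -latticePoint k := by
    ext i
    simp [latticePoint]
  -- The sign is reversed because `shift z u` is `u (· + z)`, which moves mass by `-z`.
  refine ⟨-k, hx.trans ?_⟩
  set z := latticePoint k
  have hsub : Metric.ball (x + z) 1 ⊆ Metric.ball (0 : RN N) (√N + 1) :=
    Metric.ball_subset_ball' (by
      have := Metric.mem_closedBall.1 hk
      linarith)
  have e : ∫ y in Metric.ball x 1, u y ^ 2
      = ∫ y in Metric.ball (x + z) 1, shift (latticePoint (-k)) u y ^ 2 := by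
    rw [← integral_indicator measurableSet_ball, ← integral_indicator measurableSet_ball,
      ← integral_add_right_eq_self _ (-z)]
    refine integral_congr_ae ?_
    filter_upwards [coe_shift (latticePoint (-k)) u] with y hy
    have hmem : y + -z ∈ Metric.ball x 1 ↔ y ∈ Metric.ball (x + z) 1 := by
      rw [Metric.mem_ball, Metric.mem_ball, dist_eq_norm, dist_eq_norm]
      have : y + -z - x = y - (x + z) := by abel
      rw [this]
    by_cases hb : y ∈ Metric.ball (x + z) 1
    · rw [Set.indicator_of_mem (hmem.2 hb), Set.indicator_of_mem hb, hy, hneg]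
    · rw [Set.indicator_of_notMem (fun h => hb (hmem.1 h)), Set.indicator_of_notMem hb]
  rw [e]
  exact setIntegral_mono_set (memLp _).integrable_sq.integrableOn
    (Eventually.of_forall fun y => sq_nonneg _) hsub.eventuallyLE

theorem tendsto_quadForm_of_weakly_null (h : IsAdmissible s α β V f) {y : ℕ → FracSobolev N s}
    (hy : ∀ v, Tendsto (fun n => inner ℝ (y n) v) atTop (𝓝 0)) (v : FracSobolev N s) :
    Tendsto (fun n => quadForm V (y n) v) atTop (𝓝 0) := by
  let ℓ : FracSobolev N s →ₗ[ℝ] ℝ :=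
    { toFun := fun u => quadForm V u v
      map_add' := fun u w => h.quadForm_add_left u w v
      map_smul' := fun c u => quadForm_smul_left V c u v }
  let L : StrongDual ℝ (FracSobolev N s) := ℓ.mkContinuous ((1 + β) * ‖v‖) fun u => by
    have h1 := h.abs_quadForm_le u v
    change |quadForm V u v| ≤ _
    linarith
  refine (hy ((InnerProductSpace.toDual ℝ _).symm L)).congr fun n => ?_
  rw [real_inner_comm, InnerProductSpace.toDual_symm_apply]
  rfl

/-- Fatou's lemma for `∫ G(x, u)` along sequences converging in `L²` of balls. -/
theorem integral_jeanjeanG_le_of_tendsto (h : IsAdmissible s α β V f)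
    (hG : ∀ x t, 0 ≤ jeanjeanG f x t) {w : ℕ → FracSobolev N s} {v : FracSobolev N s} {m : ℝ}
    (hwv : ∀ ρ, Tendsto (fun n => ∫ x in Metric.ball (0 : RN N) ρ, (w n - v) x ^ 2) atTop (𝓝 0))
    (hm : Tendsto (fun n => ∫ x, jeanjeanG f x (w n x)) atTop (𝓝 m)) :
    ∫ x, jeanjeanG f x (v x) ≤ m := by
  have hm0 : 0 ≤ m := ge_of_tendsto' hm fun n => integral_nonneg fun x => hG x _
  have hGc : Continuous fun p : RN N × ℝ => jeanjeanG f p.1 p.2 :=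
    (h.subcritical.cont.mul continuous_snd).sub
      ((primitiveF_continuous h.subcritical.cont).const_mul 2)
  -- Convergence holds only on balls, so Fatou's lemma is applied on each along an almost everywhere
  -- convergent subsequence; the balls exhaust the space.
  have hball : ∀ R : ℝ, ∫ x in Metric.ball (0 : RN N) R, jeanjeanG f x (v x) ≤ m := by
    intro R
    set μ := volume.restrict (Metric.ball (0 : RN N) R) with hμ
    have hmeas : TendstoInMeasure μ (fun n x => (w n - v) x ^ 2) atTop (fun _ => (0 : ℝ)) := by
      refine tendstoInMeasure_of_tendsto_eLpNorm (p := 1) one_ne_zero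
        (fun n => ((aesm (w n - v)).restrict.pow 2)) aestronglyMeasurable_const ?_
      have e : ∀ n, eLpNorm ((fun x => (w n - v) x ^ 2) - fun _ => (0 : ℝ)) 1 μ
          = ENNReal.ofReal (∫ x, (w n - v) x ^ 2 ∂μ) := fun n => by
        rw [eLpNorm_one_eq_lintegral_enorm, ofReal_integral_eq_lintegral_ofReal
          (memLp (w n - v)).integrable_sq.integrableOn (Eventually.of_forall fun x => sq_nonneg _)]
        refine lintegral_congr fun x => ?_
        rw [Pi.sub_apply, sub_zero, Real.enorm_of_nonneg (sq_nonneg _)]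
      simp only [e]
      rw [← ENNReal.ofReal_zero]
      exact (ENNReal.continuous_ofReal.tendsto 0).comp (hwv R)
    obtain ⟨φ, hφ, hae⟩ := hmeas.exists_seq_tendsto_ae
    have hptw : ∀ᵐ x ∂μ, Tendsto (fun n => jeanjeanG f x (w (φ n) x)) atTop
        (𝓝 (jeanjeanG f x (v x))) := by
      filter_upwards [hae, ae_all_iff.2 fun n => ae_restrict_of_ae (coe_sub (w (φ n)) v)]
        with x hx hx'
      have h1 : Tendsto (fun n => w (φ n) x - v x) atTop (𝓝 0) := by
        rw [tendsto_zero_iff_abs_tendsto_zero]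
        have := (Real.continuous_sqrt.tendsto 0).comp hx
        rw [Real.sqrt_zero] at this
        refine this.congr fun n => ?_
        simp only [Function.comp_apply]
        rw [hx' n, Real.sqrt_sq_eq_abs, Pi.sub_apply]
      have h2 : Tendsto (fun n => w (φ n) x) atTop (𝓝 (v x)) := by
        simpa using h1.add_const (v x)
      have hc : Continuous fun t => jeanjeanG f x t :=
        hGc.comp (by fun_prop : Continuous fun t : ℝ => (x, t))
      exact (hc.tendsto _).comp h2
    have hfatou : ∫⁻ x, ENNReal.ofReal (jeanjeanG f x (v x)) ∂μ ≤ ENNReal.ofReal m := by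
      calc ∫⁻ x, ENNReal.ofReal (jeanjeanG f x (v x)) ∂μ
          = ∫⁻ x, liminf (fun n => ENNReal.ofReal (jeanjeanG f x (w (φ n) x))) atTop ∂μ := by
            refine lintegral_congr_ae ?_
            filter_upwards [hptw] with x hx
            exact ((ENNReal.continuous_ofReal.tendsto _).comp hx).liminf_eq.symm
        _ ≤ liminf (fun n => ∫⁻ x, ENNReal.ofReal (jeanjeanG f x (w (φ n) x)) ∂μ) atTop :=
            lintegral_liminf_le' fun n =>
              (h.integrable_jeanjeanG (w (φ n))).1.restrict.aemeasurable.ennreal_ofReal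
        _ ≤ liminf (fun n => ENNReal.ofReal (∫ x, jeanjeanG f x (w (φ n) x))) atTop := by
            refine liminf_le_liminf (Eventually.of_forall fun n => ?_)
            rw [ofReal_integral_eq_lintegral_ofReal (h.integrable_jeanjeanG _)
              (Eventually.of_forall fun x => hG x _)]
            exact lintegral_mono' Measure.restrict_le_self le_rfl
        _ = ENNReal.ofReal m :=
            ((ENNReal.continuous_ofReal.tendsto m).comp
              (hm.comp hφ.tendsto_atTop)).liminf_eq
    rw [← ofReal_integral_eq_lintegral_ofReal (h.integrable_jeanjeanG v).integrableOn
      (Eventually.of_forall fun x => hG x _)] at hfatou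
    exact (ENNReal.ofReal_le_ofReal_iff hm0).1 hfatou
  exact le_of_tendsto' ((aecover_ball (μ := (volume : Measure (RN N))) (x := 0)
    tendsto_natCast_atTop_atTop).integral_tendsto_of_countably_generated
    (h.integrable_jeanjeanG v)) fun n => hball n

/-- A bounded sequence of almost critical functions, bounded away from zero, produces a nonzero
critical point whose energy does not exceed the limit of the energies. -/
theorem exists_critical_of_seq (h : IsAdmissible s α β V f) (hG : ∀ x t, 0 ≤ jeanjeanG f x t)
    {u : ℕ → FracSobolev N s} {ε : ℕ → ℝ} {K r m : ℝ} (hr : 0 < r) (hK : ∀ n, ‖u n‖ ≤ K)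
    (hru : ∀ n, r ≤ ‖u n‖) (hε : Tendsto ε atTop (𝓝 0))
    (hD : ∀ n v, |energyDeriv V f (u n) v| ≤ ε n * ‖v‖)
    (hm : Tendsto (fun n => energyJ V f (u n)) atTop (𝓝 m)) :
    ∃ w : FracSobolev N s, w ≠ 0 ∧ (∀ v, energyDeriv V f w v = 0) ∧ energyJ V f w ≤ m := by
  have hα := h.α_pos
  have hK0 : 0 < K := (hr.trans_le (hru 0)).trans_le (hK 0)
  obtain ⟨δ, hδ, η, hη, hmeas⟩ := h.exists_measure_lower_bound K hr
  obtain ⟨c, hc, hmass⟩ := exists_ball_mass (N := N) h.s_pos (show 0 < K ^ 2 by positivity) hδ hη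
  set B := Metric.ball (0 : RN N) (√N + 1)
  have hεK : Tendsto (fun n => |ε n| * K) atTop (𝓝 0) := by
    simpa using hε.abs.mul_const K
  have hDself : ∀ᶠ n in atTop, |energyDeriv V f (u n) (u n)| ≤ α * r ^ 2 / 4 := by
    filter_upwards [hεK.eventually (gt_mem_nhds (show 0 < α * r ^ 2 / 4 by positivity))] with n hn
    refine (hD n (u n)).trans (le_trans ?_ hn.le)
    gcongr
    · exact le_abs_self _
    · exact hK n
  -- The mass bound is available only once `J'(u n) (u n)` is small; earlier terms are left
  -- unshifted so that the sequence is defined for all `n`.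
  have hshift : ∀ n, ∃ w : FracSobolev N s, ‖w‖ ≤ K ∧ energyJ V f w = energyJ V f (u n) ∧
      (∀ v, |energyDeriv V f w v| ≤ ε n * ‖v‖) ∧
      (|energyDeriv V f (u n) (u n)| ≤ α * r ^ 2 / 4 → c ≤ ∫ y in B, w y ^ 2) := by
    intro n
    by_cases hn : |energyDeriv V f (u n) (u n)| ≤ α * r ^ 2 / 4
    · have hvol := hmeas (u n) (hK n) (hru n) hn
      obtain ⟨x, hx⟩ := hmass (u n) (memLp _) (integrable_kernel _ _)
        ((gagliardoForm_le _).trans (by gcongr; exact hK n)) hvol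
      obtain ⟨k, hk⟩ := exists_shift_mass (u n) hx
      refine ⟨shift (latticePoint k) (u n), by rw [norm_shift]; exact hK n,
        h.energyJ_shift k _, fun v => ?_, fun _ => hk⟩
      have h1 := h.energyDeriv_shift k (u n) (shift (-latticePoint k) v)
      rw [shift_shift_neg] at h1
      rw [h1, ← norm_shift (-latticePoint k) v]
      exact hD n _
    · exact ⟨u n, hK n, rfl, hD n, fun h' => absurd h' hn⟩
  choose w hwK hwJ hwD hwc using hshift
  obtain ⟨w₀, φ, hφ, hweak⟩ := exists_subseq_weakly_tendsto hwK
  have hnull : ∀ v, Tendsto (fun n => inner ℝ (w (φ n) - w₀) v) atTop (𝓝 0) := fun v => by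
    simpa [inner_sub_left] using (hweak v).sub_const (inner ℝ w₀ v)
  have hyK : ∀ n, ‖w (φ n) - w₀‖ ≤ K + ‖w₀‖ := fun n =>
    (norm_sub_le _ _).trans (by linarith [hwK (φ n)])
  have hloc := tendsto_setIntegral_sq_of_weakly_null h.s_pos hyK hnull
  -- Local compactness would make the mass in `B` vanish if the weak limit were zero.
  have hne : w₀ ≠ 0 := by
    rintro rfl
    have h1 := hloc (√N + 1)
    simp only [sub_zero] at h1
    have h2 : ∀ᶠ n in atTop, c ≤ ∫ y in B, w (φ n) y ^ 2 := by
      filter_upwards [hφ.tendsto_atTop.eventually hDself] with n hn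
      exact hwc _ hn
    exact absurd (ge_of_tendsto h1 h2) (not_le.2 hc)
  have hcrit : ∀ v, energyDeriv V f w₀ v = 0 := by
    intro v
    have hK' : ∀ n, ‖w (φ n)‖ ≤ K + ‖w₀‖ := fun n => by linarith [hwK (φ n), norm_nonneg w₀]
    have hf0 : Tendsto (fun n => (∫ x, f x (w (φ n) x) * v x) - ∫ x, f x (w₀ x) * v x) atTop
        (𝓝 0) := by
      rw [Metric.tendsto_atTop]
      intro e he
      obtain ⟨C, hC, hL⟩ := h.exists_f_lipschitz (K + ‖w₀‖)
        (show 0 < e / (2 * (‖v‖ + 1)) by positivity)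
      have h1 := (tendsto_integral_abs_mul hyK hloc v).const_mul C
      rw [mul_zero] at h1
      obtain ⟨n₀, hn₀⟩ := eventually_atTop.1 (h1.eventually (gt_mem_nhds (half_pos he)))
      refine ⟨n₀, fun n hn => ?_⟩
      rw [Real.dist_eq, sub_zero]
      have h2 := hL (w (φ n)) w₀ (hK' n) (by linarith) v
      have h3 : ∫ x, |w (φ n) x - w₀ x| * |v x| = ∫ x, |(w (φ n) - w₀) x| * |v x| := by
        refine integral_congr_ae ?_
        filter_upwards [coe_sub (w (φ n)) w₀] with x hx
        rw [hx, Pi.sub_apply]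
      rw [h3] at h2
      have h4 : e / (2 * (‖v‖ + 1)) * ‖v‖ ≤ e / 2 := by
        rw [div_mul_eq_mul_div, div_le_div_iff₀ (by positivity) two_pos]
        nlinarith [norm_nonneg v]
      linarith [hn₀ n hn]
    have hq0 := h.tendsto_quadForm_of_weakly_null hnull v
    have hsum : Tendsto (fun n => energyDeriv V f (w (φ n)) v) atTop
        (𝓝 (energyDeriv V f w₀ v)) := by
      have h1 := (hq0.sub hf0).add_const (energyDeriv V f w₀ v)
      rw [sub_zero, zero_add] at h1
      refine h1.congr fun n => ?_
      have h2 : quadForm V (w (φ n)) v = quadForm V (w (φ n) - w₀) v + quadForm V w₀ v := by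
        rw [← h.quadForm_add_left, sub_add_cancel]
      rw [energyDeriv, energyDeriv, h2]
      ring
    have hz : Tendsto (fun n => energyDeriv V f (w (φ n)) v) atTop (𝓝 0) := by
      refine squeeze_zero_norm (fun n => hwD (φ n) v) ?_
      simpa using (hε.comp hφ.tendsto_atTop).mul_const ‖v‖
    exact tendsto_nhds_unique hsum hz
  refine ⟨w₀, hne, hcrit, ?_⟩
  -- The energy itself need not be weakly lower semicontinuous, but `∫ G` is along this sequence,
  -- and it equals twice the energy in the limit.
  have hGlim : Tendsto (fun n => ∫ x, jeanjeanG f x (w (φ n) x)) atTop (𝓝 (2 * m)) := by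
    have hJ : Tendsto (fun n => energyJ V f (w (φ n))) atTop (𝓝 m) := by
      simp only [hwJ]
      exact hm.comp hφ.tendsto_atTop
    have hDz : Tendsto (fun n => energyDeriv V f (w (φ n)) (w (φ n))) atTop (𝓝 0) := by
      refine squeeze_zero_norm (fun n => ?_) (hεK.comp hφ.tendsto_atTop)
      refine (hwD (φ n) _).trans ?_
      simp only [Function.comp_apply]
      gcongr
      · exact le_abs_self _
      · exact hwK _
    simp only [h.integral_jeanjeanG]
    simpa using (hJ.const_mul 2).sub hDz
  have h1 := h.integral_jeanjeanG_le_of_tendsto hG hloc hGlim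
  rw [h.integral_jeanjeanG, hcrit, sub_zero] at h1
  linarith

/-- The mountain pass geometry yields a nonzero critical point. -/
theorem exists_critical (h : IsAdmissible s α β V f) {lam : ℝ} (hlam : 1 ≤ lam)
    (hf3 : ∀ x : RN N, Tendsto (fun t : ℝ => primitiveF f x t / |t| ^ 2) (cocompact ℝ) atTop)
    (hf4 : ∀ (x : RN N) (t θ : ℝ), 0 ≤ θ → θ ≤ 1 →
      jeanjeanG f x (θ * t) ≤ lam * jeanjeanG f x t) :
    ∃ w : FracSobolev N s, w ≠ 0 ∧ ∀ v, energyDeriv V f w v = 0 := by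
  have hα := h.α_pos
  have hG := jeanjeanG_nonneg hlam hf4
  obtain ⟨g, hg⟩ := h.exists_gradient
  have hd := h.hasFDerivAt_energyJ hg
  obtain ⟨r, hr, hgeom⟩ := h.exists_radius
  obtain ⟨e, hre, hJe⟩ := h.exists_energyJ_nonpos hG hf3 r
  obtain ⟨c, hc, hcer⟩ := exists_cerami_level hd (h.uniformContinuousOnBounded_gradient hg) hr.le
    (show 0 < α / 8 * r ^ 2 by positivity) (energyJ_zero V f).le
    (fun u hu => by rw [← hu]; exact (hgeom u hu.le).1) hre hJe
  have hc0 : 0 < c := lt_of_lt_of_le (by positivity) hc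
  -- The cap `c / 2` keeps every energy at least `c / 2`, which bounds the sequence away from `0`,
  -- where the energy vanishes.
  set ε : ℕ → ℝ := fun n => min (1 / ((n : ℝ) + 1)) (c / 2) with hεdef
  have hε0 : ∀ n, 0 < ε n := fun n => by positivity
  have hε1 : ∀ n, ε n ≤ 1 / ((n : ℝ) + 1) := fun n => min_le_left _ _
  have hεlim : Tendsto ε atTop (𝓝 0) :=
    squeeze_zero (fun n => (hε0 n).le) hε1 tendsto_one_div_add_atTop_nhds_zero_nat
  choose u huJ hug using fun n => hcer (ε n) (hε0 n)
  have hgn : ∀ n, ‖g (u n)‖ ≤ ε n := fun n => by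
    refine le_trans ?_ (hug n)
    nlinarith [norm_nonneg (u n), norm_nonneg (g (u n))]
  have hD : ∀ n v, |energyDeriv V f (u n) v| ≤ ε n * ‖v‖ := fun n v => by
    rw [← hg]
    exact (abs_real_inner_le_norm _ _).trans (by gcongr; exact hgn n)
  -- The Cerami weight is needed here: a small gradient alone would not control `J'(u) u` before `u`
  -- is known to be bounded.
  have hDself : ∀ n, |energyDeriv V f (u n) (u n)| ≤ 1 := fun n => by
    rw [← hg]
    refine (abs_real_inner_le_norm _ _).trans ?_
    have h1 : ε n ≤ 1 := (hε1 n).trans (by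
      rw [div_le_one (by positivity)]
      have : (0 : ℝ) ≤ n := n.cast_nonneg
      linarith)
    nlinarith [hug n, norm_nonneg (g (u n))]
  have huJ' : ∀ n, |energyJ V f (u n)| ≤ 2 * c := fun n => by
    have h1 := abs_le.1 (huJ n)
    have h2 : ε n ≤ c / 2 := min_le_right _ _
    exact abs_le.2 ⟨by linarith, by linarith⟩
  obtain ⟨K, hK⟩ := h.exists_norm_bound hlam hf3 hf4 (show 0 ≤ 2 * c by positivity)
  have hJlim : Tendsto (fun n => energyJ V f (u n)) atTop (𝓝 c) := by
    rw [tendsto_iff_dist_tendsto_zero]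
    exact squeeze_zero (fun n => dist_nonneg) (fun n => by rw [Real.dist_eq]; exact huJ n) hεlim
  have hcont : ContinuousAt (energyJ V f) (0 : FracSobolev N s) := (hd 0).continuousAt
  obtain ⟨ρ, hρ, hsmall⟩ := Metric.continuousAt_iff.1 hcont (c / 2) (by positivity)
  have hlow : ∀ n, ρ ≤ ‖u n‖ := fun n => by
    by_contra! hlt
    have h1 := hsmall (x := u n) (by simpa using hlt)
    rw [energyJ_zero, Real.dist_eq, sub_zero] at h1
    have h2 := abs_le.1 (huJ n)
    have h3 : ε n ≤ c / 2 := min_le_right _ _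
    linarith [le_abs_self (energyJ V f (u n))]
  obtain ⟨w, hw, hcrit, -⟩ := h.exists_critical_of_seq hG hρ
    (fun n => hK (u n) (huJ' n) (hDself n)) hlow hεlim hD hJlim
  exact ⟨w, hw, hcrit⟩

/-- A minimizing sequence of critical points has exact derivative zero, is bounded by
`exists_norm_bound`, and stays away from zero because `J'(u) u > 0` for small nonzero `u`; its
shifted weak limit attains the infimum. -/
theorem exists_groundState (h : IsAdmissible s α β V f) {lam : ℝ} (hlam : 1 ≤ lam)
    (hf3 : ∀ x : RN N, Tendsto (fun t : ℝ => primitiveF f x t / |t| ^ 2) (cocompact ℝ) atTop)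
    (hf4 : ∀ (x : RN N) (t θ : ℝ), 0 ≤ θ → θ ≤ 1 →
      jeanjeanG f x (θ * t) ≤ lam * jeanjeanG f x t) :
    ∃ u : FracSobolev N s, IsGroundState V f u ∧ IsWeakSolution V f u := by
  have hα := h.α_pos
  have hG := jeanjeanG_nonneg hlam hf4
  set A : Set ℝ := {a | ∃ v : FracSobolev N s, v ≠ 0 ∧ (∀ φ, energyDeriv V f v φ = 0) ∧
    energyJ V f v = a} with hA
  have hne : A.Nonempty := by
    obtain ⟨w, hw, hcrit⟩ := h.exists_critical hlam hf3 hf4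
    exact ⟨_, w, hw, hcrit, rfl⟩
  have hnonneg : ∀ a ∈ A, 0 ≤ a := by
    rintro a ⟨v, -, hv, rfl⟩
    have h1 := h.integral_jeanjeanG v
    have h2 : 0 ≤ ∫ x, jeanjeanG f x (v x) := integral_nonneg fun x => hG x _
    rw [hv, sub_zero] at h1
    linarith
  have hbdd : BddBelow A := ⟨0, hnonneg⟩
  obtain ⟨a, ha_anti, ha_lim, haA⟩ := exists_seq_tendsto_sInf hne hbdd
  choose u hu0 hcrit hJ using haA
  obtain ⟨K, hK⟩ := h.exists_norm_bound hlam hf3 hf4 (hnonneg (a 0) ⟨u 0, hu0 0, hcrit 0, hJ 0⟩)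
  obtain ⟨r, hr, hgeom⟩ := h.exists_radius
  have hlow : ∀ n, r ≤ ‖u n‖ := fun n => by
    by_contra! hlt
    have h1 := (hgeom (u n) hlt.le).2
    rw [hcrit] at h1
    have : 0 < ‖u n‖ := norm_pos_iff.2 (hu0 n)
    have : 0 < α / 2 * ‖u n‖ ^ 2 := by positivity
    linarith
  have hbound : ∀ n, ‖u n‖ ≤ K := fun n => hK (u n)
    (by
      rw [hJ, abs_of_nonneg (hnonneg _ ⟨u n, hu0 n, hcrit n, hJ n⟩)]
      exact ha_anti (Nat.zero_le n))
    (by rw [hcrit]; simp)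
  obtain ⟨w, hw, hwcrit, hwJ⟩ := h.exists_critical_of_seq hG hr hbound hlow
    (ε := fun _ => 0) tendsto_const_nhds (fun n v => by rw [hcrit]; simp)
    (ha_lim.congr fun n => (hJ n).symm)
  exact ⟨w, ⟨hw, h.isCriticalPointJ_iff.2 hwcrit, fun v hv hvc =>
    hwJ.trans (csInf_le hbdd ⟨v, hv, h.isCriticalPointJ_iff.1 hvc, rfl⟩)⟩,
    h.isWeakSolution_of_forall hwcrit⟩

end IsAdmissible

theorem theorem1p1 (N : ℕ) (s : ℝ) (hs0 : 0 < s) (hs1 : s < 1) (hN : 2 * s < (N : ℝ))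
    (V : RN N → ℝ) (f : RN N → ℝ → ℝ)
    (hVcont : Continuous V)
    (hVbound : ∃ α β : ℝ, 0 < α ∧ ∀ x, α ≤ V x ∧ V x ≤ β)
    (hVper : IsOnePeriodic V)
    (hfcont : Continuous (fun p : RN N × ℝ => f p.1 p.2))
    (hfper : IsOnePeriodic f)
    (hf1 : TendstoUniformly (fun (t : ℝ) (x : RN N) => f x t / |t| ^ (criticalExponent N s - 1))
      (fun _ => 0) (cocompact ℝ))
    (hf2 : TendstoUniformly (fun (t : ℝ) (x : RN N) => f x t / t) (fun _ => 0) (𝓝[≠] 0))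
    (hf3 : ∀ x : RN N, Tendsto (fun t : ℝ => primitiveF f x t / |t| ^ 2) (cocompact ℝ) atTop)
    (hf4 : ∃ lam : ℝ, 1 ≤ lam ∧ ∀ (x : RN N) (t θ : ℝ), 0 ≤ θ → θ ≤ 1 →
      jeanjeanG f x (θ * t) ≤ lam * jeanjeanG f x t) :
    (∀ v : FracSobolev N s, Integrable (fun x => primitiveF f x (v x))) ∧
      ∃ u : FracSobolev N s, IsGroundState V f u ∧ IsWeakSolution V f u := by
  obtain ⟨α, β, hα, hV⟩ := hVbound
  obtain ⟨lam, hlam, hf4⟩ := hf4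
  have h : IsAdmissible s (min α 1) (max β 1) V f :=
    { s_pos := hs0
      s_lt_one := hs1
      lt_dim := hN
      α_pos := by positivity
      α_le_one := min_le_right _ _
      one_le_β := le_max_right _ _
      V_cont := hVcont
      le_V := fun x => (min_le_left _ _).trans (hV x).1
      V_le := fun x => (hV x).2.trans (le_max_left _ _)
      V_periodic := hVper
      subcritical := isSubcritical_of_tendstoUniformly hfcont hfper hf1 hf2 }
  exact ⟨h.integrable_primitive, h.exists_groundState hlam hf3 hf4⟩
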